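/- Let $-\infty<a<b<\infty$ and let $p,q_0,q_1,r$ be real-valued functions on $(a,b)$ with $p,r>0$ almost everywhere and $p^{-1},q_0,q_1,r\in L^1(a,b)$. For $j=0,1$ put $$\tau_j=\frac1r\Big(-\frac{d}{dx}\,p\,\frac{d}{dx}+q_j\Big),$$ let $\alpha,\beta\in\mathbb R$, and let $H_j$ be the operator $H_jf=\tau_jf$ in $L^2((a,b),r\,dx)$ whose domain consists of all $f\in L^2((a,b),r\,dx)$ such that $f$ and $pf'$ are absolutely continuous on $[a,b]$, $\tau_jf\in L^2((a,b),r\,dx)$, and $$\cos(\alpha)f(a)-\sin(\alpha)\,(pf')(a)=0,\qquad \cos(\beta)f(b)-\sin(\beta)\,(pf')(b)=0 .$$ Then $H_0$ and $H_1$ possess spectral resolutions; write $P_\Omega(H_j)$ for the spectral projection of $H_j$ belonging to a Borel set $\Omega\subseteq\mathbb R$. For $z\in\mathbb R$ let $\psi_{j,-}(z)$ (respectively $\psi_{j,+}(z)$) be a real-valued, not identically vanishing solution of $\tau_ju=zu$ that satisfies the above boundary condition at $a$ (respectively at $b$). If $u$ and $pu'$ are real-valued, absolutely continuous on $[a,b]$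 and have no common zero, a Prüfer angle of $u$ is a continuous function $\theta_u$ on $[a,b]$ with $u=\rho_u\sin\theta_u$ and $pu'=\rho_u\cos\theta_u$ for some $\rho_u>0$. The number of weighted sign flips of two such functions $u_0,u_1$ is $$\#_{(a,b)}(u_0,u_1)=\Big\lceil\frac{\theta_{u_1}(b)-\theta_{u_0}(b)}{\pi}\Big\rceil-\Big\lfloor\frac{\theta_{u_1}(a)-\theta_{u_0}(a)}{\pi}\Big\rfloor-1 ,$$ which does not depend on the choice of the Prüfer angles. Then for all $\lambda_0,\lambda_1\in\mathbb R$ the spaces $\operatorname{Ran}P_{(-\infty,\lambda_1)}(H_1)$ and $\operatorname{Ran}P_{(-\infty,\lambda_0]}(H_0)$ are finite-dimensional, and $$\dim\operatorname{Ran}P_{(-\infty,\lambda_1)}(H_1)-\dim\operatorname{Ran}P_{(-\infty,\lambda_0]}(H_0)=\#_{(a,b)}\big(\psi_{0,+}(\lambda_0),\psi_{1,-}(\lambda_1)\big)=\#_{(a,b)}\big(\psi_{0,-}(\lambda_0),\psi_{1,+}(\lambda_1)\big).$$ -/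

import Mathlib

open MeasureTheory Set

noncomputable section

/-! ### Projection-valued measures and the spectral theorem -/

/-- A projection-valued measure (resolution of the identity) on the Borel sets of `ℝ` with values
in the orthogonal projections of the complex Hilbert space `𝓗`.  Only the values on Borel sets
matter. -/
structure ProjValuedMeasure (𝓗 : Type*) [NormedAddCommGroup 𝓗] [InnerProductSpace ℂ 𝓗]
    [CompleteSpace 𝓗] where
  /-- the projection `P_Ω` attached to a set `Ω` -/
  proj : Set ℝ → 𝓗 →L[ℂ] 𝓗
  isStarProjection : ∀ s, MeasurableSet s → IsStarProjection (proj s)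
  proj_empty : proj ∅ = 0
  proj_univ : proj Set.univ = 1
  proj_inter : ∀ s t, MeasurableSet s → MeasurableSet t → proj (s ∩ t) = proj s * proj t
  /-- countable additivity in the strong operator topology -/
  hasSum_proj : ∀ f : ℕ → Set ℝ, (∀ i, MeasurableSet (f i)) →
    Pairwise (Function.onFun Disjoint f) →
      ∀ x : 𝓗, HasSum (fun i => proj (f i) x) (proj (⋃ i, f i) x)

namespace ProjValuedMeasure

variable {𝓗 : Type*} [NormedAddCommGroup 𝓗] [InnerProductSpace ℂ 𝓗] [CompleteSpace 𝓗]

theorem inner_proj_self (E : ProjValuedMeasure 𝓗) {s : Set ℝ} (hs : MeasurableSet s) (x : 𝓗) :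
    inner ℂ x (E.proj s x) = ((‖E.proj s x‖ ^ 2 : ℝ) : ℂ) := by
  have h := E.isStarProjection s hs
  have h1 : E.proj s (E.proj s x) = E.proj s x := by
    have := congrArg (fun T : 𝓗 →L[ℂ] 𝓗 => T x) h.isIdempotentElem.eq
    simpa using this
  have h2 : inner ℂ (E.proj s x) (E.proj s x) = inner ℂ x (E.proj s (E.proj s x)) := by
    have h3 := ContinuousLinearMap.adjoint_inner_left (E.proj s) (E.proj s x) x
    rw [← ContinuousLinearMap.star_eq_adjoint, h.isSelfAdjoint.star_eq] at h3
    exact h3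
  rw [h1] at h2
  rw [← h2, inner_self_eq_norm_sq_to_K]
  norm_cast

/-- The scalar spectral measure `Ω ↦ ‖P_Ω x‖² = ⟨x, P_Ω x⟩` of a vector `x`. -/
def scalarMeasure (E : ProjValuedMeasure 𝓗) (x : 𝓗) : Measure ℝ :=
  Measure.ofMeasurable (fun s _ => ENNReal.ofReal (‖E.proj s x‖ ^ 2))
    (by simp [E.proj_empty])
    (by
      intro f hf hd
      have h1 := (E.hasSum_proj f hf hd x).mapL (innerSL ℂ x)
      simp only [innerSL_apply_apply, E.inner_proj_self (MeasurableSet.iUnion hf),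
        E.inner_proj_self (hf _)] at h1
      have h2 := Complex.hasSum_ofReal.1 h1
      rw [← h2.tsum_eq, ENNReal.ofReal_tsum_of_nonneg (fun _ => by positivity) h2.summable])

/-- `E` is the spectral resolution of the (unbounded) operator `H`, i.e. `H = ∫ t dE(t)`: the
domain of `H` is `{x | ∫ t² d⟨x, E x⟩ < ∞}`, and `⟨x, H x⟩ = ∫ t d⟨x, E x⟩` for `x` in it (by
polarization this determines `H`). -/
structure IsSpectralResolution (E : ProjValuedMeasure 𝓗) (H : 𝓗 →ₗ.[ℂ] 𝓗) : Prop where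
  mem_domain_iff : ∀ x : 𝓗, x ∈ H.domain ↔ Integrable (fun t : ℝ => t ^ 2) (E.scalarMeasure x)
  inner_apply : ∀ x : H.domain,
    inner ℂ (x : 𝓗) (H x) = ((∫ t, t ∂(E.scalarMeasure (x : 𝓗)) : ℝ) : ℂ)

end ProjValuedMeasure

/-! ### Regular Sturm–Liouville operators -/

namespace SturmLiouville

/-- The coefficients `p, q, r` of `τ = r⁻¹ (-(d/dx) p (d/dx) + q)` are regular on the bounded
interval `(a, b)`: `p, r > 0` and `p⁻¹, q, r ∈ L¹(a, b)`. -/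
structure IsRegular (a b : ℝ) (p q r : ℝ → ℝ) : Prop where
  p_pos : ∀ᵐ x ∂(volume.restrict (Ioo a b)), 0 < p x
  r_pos : ∀ᵐ x ∂(volume.restrict (Ioo a b)), 0 < r x
  integrable_inv_p : IntegrableOn (fun x => (p x)⁻¹) (Ioo a b)
  integrable_q : IntegrableOn q (Ioo a b)
  integrable_r : IntegrableOn r (Ioo a b)

/-- `u` and `w = p u'` are absolutely continuous on `[a, b]` and `τ u = g`, that is
`-(p u')' + q u = r g` almost everywhere on `(a, b)`.  (Scalars `E = ℝ` or `E = ℂ`.) -/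
structure TauEq {E : Type*} [NormedAddCommGroup E] [NormedSpace ℝ E] (a b : ℝ) (p q r : ℝ → ℝ)
    (u w g : ℝ → E) : Prop where
  ac_u : AbsolutelyContinuousOnInterval u a b
  ac_w : AbsolutelyContinuousOnInterval w a b
  deriv_u : ∀ᵐ x ∂(volume.restrict (Ioo a b)), HasDerivAt u ((p x)⁻¹ • w x) x
  deriv_w : ∀ᵐ x ∂(volume.restrict (Ioo a b)), HasDerivAt w (q x • u x - r x • g x) x

/-- The separated boundary condition `cos γ · u(c) - sin γ · (p u')(c) = 0` at `c`, where
`w = p u'`. -/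
def BoundaryCond {E : Type*} [NormedAddCommGroup E] [NormedSpace ℝ E] (c γ : ℝ)
    (u w : ℝ → E) : Prop :=
  Real.cos γ • u c - Real.sin γ • w c = 0

/-- The measure `r dx` on `(a, b)`. -/
def weight (a b : ℝ) (r : ℝ → ℝ) : Measure ℝ :=
  (volume.restrict (Ioo a b)).withDensity (fun x => ENNReal.ofReal (r x))

/-- The Hilbert space `L²((a, b), r dx)`. -/
abbrev L2 (a b : ℝ) (r : ℝ → ℝ) : Type := Lp ℂ 2 (weight a b r)

theorem TauEq.add {E : Type*} [NormedAddCommGroup E] [NormedSpace ℝ E] {a b : ℝ}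
    {p q r : ℝ → ℝ} {u w g u' w' g' : ℝ → E} (h : TauEq a b p q r u w g)
    (h' : TauEq a b p q r u' w' g') : TauEq a b p q r (u + u') (w + w') (g + g') where
  ac_u := h.ac_u.add h'.ac_u
  ac_w := h.ac_w.add h'.ac_w
  deriv_u := by
    filter_upwards [h.deriv_u, h'.deriv_u] with x h1 h2
    simpa [smul_add] using h1.add h2
  deriv_w := by
    filter_upwards [h.deriv_w, h'.deriv_w] with x h1 h2
    convert h1.add h2 using 1
    simp only [Pi.add_apply, smul_add]
    abel

theorem TauEq.const_smul {a b : ℝ} {p q r : ℝ → ℝ} {u w g : ℝ → ℂ}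
    (h : TauEq a b p q r u w g) (c : ℂ) : TauEq a b p q r (c • u) (c • w) (c • g) where
  ac_u := h.ac_u.const_smul c
  ac_w := h.ac_w.const_smul c
  deriv_u := by
    filter_upwards [h.deriv_u] with x h1
    convert h1.const_smul c using 1
    simp only [Pi.smul_apply]
    rw [smul_comm]
  deriv_w := by
    filter_upwards [h.deriv_w] with x h1
    convert h1.const_smul c using 1
    simp only [Pi.smul_apply, smul_sub]
    rw [smul_comm c, smul_comm c]

/-- The graph `{(f, τ f)}` of the Sturm–Liouville operator with the boundary conditions given by
`α` at `a` and `β` at `b`; `f` runs over the functions in `L²((a, b), r dx)` for which `f`, `p f'`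
are absolutely continuous on `[a, b]`, `τ f ∈ L²((a, b), r dx)`, and both boundary conditions
hold. -/
def graph (a b : ℝ) (p q r : ℝ → ℝ) (α β : ℝ) : Submodule ℂ (L2 a b r × L2 a b r) where
  carrier := {F | ∃ u w g : ℝ → ℂ, F.1 =ᵐ[weight a b r] u ∧ F.2 =ᵐ[weight a b r] g ∧
    TauEq a b p q r u w g ∧ BoundaryCond a α u w ∧ BoundaryCond b β u w}
  add_mem' := by
    rintro F G ⟨u, w, g, hu, hg, h, ha, hb⟩ ⟨u', w', g', hu', hg', h', ha', hb'⟩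
    refine ⟨u + u', w + w', g + g', (Lp.coeFn_add _ _).trans (hu.add hu'),
      (Lp.coeFn_add _ _).trans (hg.add hg'), h.add h', ?_, ?_⟩
    · simp only [BoundaryCond, Pi.add_apply, smul_add] at *
      rw [add_sub_add_comm, ha, ha', add_zero]
    · simp only [BoundaryCond, Pi.add_apply, smul_add] at *
      rw [add_sub_add_comm, hb, hb', add_zero]
  zero_mem' := by
    refine ⟨0, 0, 0, Lp.coeFn_zero _ _ _, Lp.coeFn_zero _ _ _, ⟨?_, ?_, ?_, ?_⟩, ?_, ?_⟩
    · exact (LipschitzWith.const (0 : ℂ)).lipschitzOnWith.absolutelyContinuousOnInterval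
    · exact (LipschitzWith.const (0 : ℂ)).lipschitzOnWith.absolutelyContinuousOnInterval
    · exact Filter.Eventually.of_forall fun x => by simp
    · exact Filter.Eventually.of_forall fun x => by simp
    · simp [BoundaryCond]
    · simp [BoundaryCond]
  smul_mem' := by
    rintro c F ⟨u, w, g, hu, hg, h, ha, hb⟩
    refine ⟨c • u, c • w, c • g, (Lp.coeFn_smul _ _).trans (hu.const_smul c),
      (Lp.coeFn_smul _ _).trans (hg.const_smul c), h.const_smul c, ?_, ?_⟩
    · simp only [BoundaryCond, Pi.smul_apply] at *
      rw [smul_comm _ c, smul_comm _ c, ← smul_sub, ha, smul_zero]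
    · simp only [BoundaryCond, Pi.smul_apply] at *
      rw [smul_comm _ c, smul_comm _ c, ← smul_sub, hb, smul_zero]

theorem ae_of_ae_weight {a b : ℝ} {p q r : ℝ → ℝ} (hreg : IsRegular a b p q r) {P : ℝ → Prop}
    (h : ∀ᵐ x ∂(weight a b r), P x) : ∀ᵐ x ∂(volume.restrict (Ioo a b)), P x := by
  have hm : AEMeasurable (fun x => ENNReal.ofReal (r x)) (volume.restrict (Ioo a b)) :=
    hreg.integrable_r.aestronglyMeasurable.aemeasurable.ennreal_ofReal
  filter_upwards [(ae_withDensity_iff' hm).1 h, hreg.r_pos] with x h1 h2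
  exact h1 (by simpa using h2)

theorem eq_zero_of_ae {a b : ℝ} {w : ℝ → ℂ} (hw : ContinuousOn w (Icc a b))
    (h : ∀ᵐ x ∂(volume.restrict (Ioo a b)), w x = 0) : ∀ x ∈ Ioo a b, w x = 0 :=
  Measure.eqOn_open_of_ae_eq (g := fun _ => (0 : ℂ)) h isOpen_Ioo
    (hw.mono Ioo_subset_Icc_self) continuousOn_const

/-- `τ f` is determined by `f`: the graph is single-valued. -/
theorem graph_singleValued {a b : ℝ} (hab : a < b) {p q r : ℝ → ℝ} (hreg : IsRegular a b p q r)
    (α β : ℝ) : ∀ F ∈ graph a b p q r α β, F.1 = 0 → F.2 = 0 := by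
  rintro F ⟨u, w, g, hu, hg, h, -, -⟩ hF
  have hcu : ContinuousOn u (Icc a b) := by simpa [uIcc_of_le hab.le] using h.ac_u.continuousOn
  have hcw : ContinuousOn w (Icc a b) := by simpa [uIcc_of_le hab.le] using h.ac_w.continuousOn
  have hu0 : ∀ x ∈ Ioo a b, u x = 0 := by
    refine eq_zero_of_ae hcu (ae_of_ae_weight hreg ?_)
    rw [hF] at hu
    filter_upwards [hu, Lp.coeFn_zero ℂ 2 (weight a b r)] with x h1 h2
    rw [← h1, h2, Pi.zero_apply]
  have hd : ∀ {v : ℝ → ℂ}, (∀ x ∈ Ioo a b, v x = 0) → ∀ x ∈ Ioo a b, ∀ d,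
      HasDerivAt v d x → d = 0 := by
    intro v hv x hx d hd
    refine hd.unique ((hasDerivAt_const x (0 : ℂ)).congr_of_eventuallyEq ?_)
    filter_upwards [isOpen_Ioo.mem_nhds hx] with y hy using hv y hy
  have hw0 : ∀ x ∈ Ioo a b, w x = 0 := by
    refine eq_zero_of_ae hcw ?_
    filter_upwards [h.deriv_u, hreg.p_pos, ae_restrict_mem measurableSet_Ioo] with x h1 h2 hx
    simpa [h2.ne'] using hd hu0 x hx _ h1
  have hg0 : ∀ᵐ x ∂(volume.restrict (Ioo a b)), g x = 0 := by
    filter_upwards [h.deriv_w, hreg.r_pos, ae_restrict_mem measurableSet_Ioo] with x h1 h2 hx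
    simpa [hu0 x hx, h2.ne'] using hd hw0 x hx _ h1
  have hg1 : ∀ᵐ x ∂(weight a b r), g x = 0 := (withDensity_absolutelyContinuous _ _).ae_le hg0
  refine Lp.ext ?_
  filter_upwards [hg, hg1, Lp.coeFn_zero ℂ 2 (weight a b r)] with x h1 h2 h3
  rw [h1, h2, h3, Pi.zero_apply]

/-- The regular Sturm–Liouville operator `H f = τ f` in `L²((a, b), r dx)` with the separated
boundary conditions `cos α f(a) - sin α (p f')(a) = 0` and `cos β f(b) - sin β (p f')(b) = 0`. -/
def operator (a b : ℝ) (p q r : ℝ → ℝ) (α β : ℝ) : L2 a b r →ₗ.[ℂ] L2 a b r :=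
  (graph a b p q r α β).toLinearPMap

theorem operator_graph {a b : ℝ} (hab : a < b) {p q r : ℝ → ℝ} (hreg : IsRegular a b p q r)
    (α β : ℝ) : (operator a b p q r α β).graph = graph a b p q r α β :=
  Submodule.toLinearPMap_graph_eq _ fun F hF h0 => graph_singleValued hab hreg α β F hF h0

/-- `u` (with `w = p u'`) is a real-valued solution of `τ u = z u`, not identically zero on
`[a, b]`, that satisfies the boundary condition with angle `γ` at `c`.  With `c = a`, `γ = α` it is
a solution `ψ₋(z)`; with `c = b`, `γ = β` it is a solution `ψ₊(z)`. -/
structure IsBoundarySolution (a b : ℝ) (p q r : ℝ → ℝ) (z c γ : ℝ) (u w : ℝ → ℝ) : Prop where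
  tauEq : TauEq a b p q r u w (fun x => z * u x)
  boundary : BoundaryCond c γ u w
  ne_zero : ∃ x ∈ Icc a b, u x ≠ 0

/-- `θ` is a continuous Prüfer angle on `[a, b]` of `u` (with `w = p u'`): `u = ρ sin θ` and
`p u' = ρ cos θ` with `ρ > 0`. -/
def IsPruferAngle (a b : ℝ) (u w θ : ℝ → ℝ) : Prop :=
  ContinuousOn θ (Icc a b) ∧ ∃ ρ : ℝ → ℝ, ∀ x ∈ Icc a b,
    0 < ρ x ∧ u x = ρ x * Real.sin (θ x) ∧ w x = ρ x * Real.cos (θ x)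

/-- The number `#_(c,d)(u₀, u₁)` of weighted sign flips, in terms of Prüfer angles `θ₀` of `u₀` and
`θ₁` of `u₁`. -/
def weightedSignFlips (c d : ℝ) (θ₀ θ₁ : ℝ → ℝ) : ℤ :=
  ⌈(θ₁ d - θ₀ d) / Real.pi⌉ - ⌊(θ₁ c - θ₀ c) / Real.pi⌋ - 1

end SturmLiouville

end

/-!
Let `α ∈ [0, π)` and `β ∈ (0, π]`. The Prüfer angle `θ μ` of the solution of `τ u = μ u` with
`θ μ a = α` solves a first-order equation whose right-hand side increases with `μ`. Hence `θ μ b` is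
continuous and strictly increasing in `μ`, and it tends to `0` as `μ → -∞`. The eigenvalues of `H`
are the `μ` with `θ μ b ∈ β + π ℤ`; they are simple, and counting them below `lam` gives a ceiling
or a floor of `(θ lam b - θ lam a - (β - α)) / π`. Variation of constants provides a compact
resolvent, so the eigenvectors form a Hilbert basis, the spectral resolution exists, and the rank of
a spectral projection is the number of eigenvalues in the set.

If `u` is any solution of `τ u = lam u` that satisfies one of the two boundary conditions, its
Prüfer angle may replace `θ lam` in these formulas: by constancy of the Wronskian, the difference of
two Prüfer angles is a constant multiple of `π` or stays strictly between two consecutive multiples.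
At `a` and at `b` the weighted sign flips of two such solutions reduce, modulo integer shifts, to
exactly these ceilings and floors.
-/

noncomputable section

namespace SturmLiouville

/-! ### Absolutely continuous primitives -/

/-- `f` is an absolutely continuous primitive of `f'` on `[a, b]`: the notion of solution for all
the differential equations below.  The derivative is part of the data, so that equations can be
read off without manipulating `deriv`. -/
structure IsPrimitive {E : Type*} [NormedAddCommGroup E] [NormedSpace ℝ E] (a b : ℝ)
    (f f' : ℝ → E) : Prop where
  ac : AbsolutelyContinuousOnInterval f a b
  hasDerivAt : ∀ᵐ x ∂(volume.restrict (Ioo a b)), HasDerivAt f (f' x) x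

section Auxiliary

variable {E : Type*} [NormedAddCommGroup E] {a b : ℝ}

theorem absolutelyContinuousOnInterval_of_dist_le {X Y : Type*} [PseudoMetricSpace X]
    [PseudoMetricSpace Y] {f : ℝ → X} {g : ℝ → Y} {C : ℝ}
    (hg : AbsolutelyContinuousOnInterval g a b)
    (hfg : ∀ x ∈ uIcc a b, ∀ y ∈ uIcc a b, dist (f x) (f y) ≤ C * dist (g x) (g y)) :
    AbsolutelyContinuousOnInterval f a b := by
  unfold AbsolutelyContinuousOnInterval at hg ⊢
  have hCg := hg.const_mul C
  rw [mul_zero] at hCg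
  refine squeeze_zero' (.of_forall fun _ => Finset.sum_nonneg fun _ _ => dist_nonneg) ?_ hCg
  filter_upwards [Filter.mem_inf_of_right (Filter.mem_principal_self _)] with I hI
  rw [Finset.mul_sum]
  exact Finset.sum_le_sum fun i hi => hfg _ (hI.1 i hi).1 _ (hI.1 i hi).2

theorem absolutelyContinuousOnInterval_comp [NormedSpace ℝ E] {φ : ℝ → E} (hφ : ContDiff ℝ 1 φ)
    {f : ℝ → ℝ} (hf : AbsolutelyContinuousOnInterval f a b) :
    AbsolutelyContinuousOnInterval (fun x => φ (f x)) a b := by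
  obtain ⟨C, hC⟩ := hf.exists_bound
  obtain ⟨K, hK⟩ := hφ.contDiffOn.exists_lipschitzOnWith (s := Icc (-C) C) one_ne_zero
    (convex_Icc _ _) isCompact_Icc
  exact absolutelyContinuousOnInterval_of_dist_le (C := K) hf fun x hx y hy =>
    hK.dist_le_mul _ (abs_le.1 (hC x hx)) _ (abs_le.1 (hC y hy))

theorem absolutelyContinuousOnInterval_integral [NormedSpace ℝ E] {f : ℝ → E}
    (hf : IntervalIntegrable f volume a b) :
    AbsolutelyContinuousOnInterval (fun x => ∫ t in a..x, f t) a b := by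
  refine absolutelyContinuousOnInterval_of_dist_le (C := 1)
    (hf.norm.absolutelyContinuousOnInterval_intervalIntegral (c := a) left_mem_uIcc) ?_
  intro x hx y hy
  have hfx : IntervalIntegrable f volume a x := hf.mono_set (uIcc_subset_uIcc_left hx)
  have hfy : IntervalIntegrable f volume a y := hf.mono_set (uIcc_subset_uIcc_left hy)
  rw [dist_eq_norm, dist_eq_norm, one_mul, intervalIntegral.integral_interval_sub_left hfx hfy,
    intervalIntegral.integral_interval_sub_left hfx.norm hfy.norm, Real.norm_eq_abs]
  exact intervalIntegral.norm_integral_le_abs_integral_norm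

theorem intervalIntegrable_of_integrableOn_Ioo {f : ℝ → E} {x y : ℝ}
    (hf : IntegrableOn f (Ioo a b)) (hx : x ∈ Icc a b) (hy : y ∈ Icc a b) :
    IntervalIntegrable f volume x y := by
  have hab : a ≤ b := hx.1.trans hx.2
  refine ((intervalIntegrable_iff_integrableOn_Ioo_of_le hab).2 hf).mono_set ?_
  rw [uIcc_of_le hab]
  exact uIcc_subset_Icc hx hy

theorem integrableOn_mul_continuousOn {𝕜 : Type*} [RCLike 𝕜] {f g : ℝ → 𝕜}
    (hf : IntegrableOn f (Ioo a b)) (hg : ContinuousOn g (Icc a b)) :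
    IntegrableOn (fun x => f x * g x) (Ioo a b) := by
  rw [← integrableOn_Icc_iff_integrableOn_Ioo] at hf ⊢
  exact hf.mul_continuousOn hg isCompact_Icc

theorem ae_restrict_Ioc_of_ae_restrict_Ioo {t : ℝ} (ht : t ∈ Icc a b) {P : ℝ → Prop}
    (hP : ∀ᵐ x ∂(volume.restrict (Ioo a b)), P x) : ∀ᵐ x ∂(volume.restrict (Ioc a t)), P x := by
  rw [← Measure.restrict_congr_set (Ioo_ae_eq_Ioc (μ := volume) (a := a) (b := t))]
  exact ae_restrict_of_ae_restrict_of_subset (Ioo_subset_Ioo_right ht.2) hP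

end Auxiliary

namespace IsPrimitive

variable {E : Type*} [NormedAddCommGroup E] [NormedSpace ℝ E] {a b : ℝ} {f f' g g' : ℝ → E}

theorem continuousOn (hf : IsPrimitive a b f f') (hab : a ≤ b) : ContinuousOn f (Icc a b) := by
  simpa only [uIcc_of_le hab] using hf.ac.continuousOn

theorem congr_deriv (hf : IsPrimitive a b f f')
    (hfg : ∀ᵐ x ∂(volume.restrict (Ioo a b)), f' x = g' x) : IsPrimitive a b f g' where
  ac := hf.ac
  hasDerivAt := by
    filter_upwards [hf.hasDerivAt, hfg] with x hx hfgx
    rwa [← hfgx]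

theorem add (hf : IsPrimitive a b f f') (hg : IsPrimitive a b g g') :
    IsPrimitive a b (fun x => f x + g x) (fun x => f' x + g' x) where
  ac := hf.ac.add hg.ac
  hasDerivAt := by
    filter_upwards [hf.hasDerivAt, hg.hasDerivAt] with x hfx hgx using hfx.add hgx

theorem sub (hf : IsPrimitive a b f f') (hg : IsPrimitive a b g g') :
    IsPrimitive a b (fun x => f x - g x) (fun x => f' x - g' x) where
  ac := hf.ac.sub hg.ac
  hasDerivAt := by
    filter_upwards [hf.hasDerivAt, hg.hasDerivAt] with x hfx hgx using hfx.sub hgx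

theorem const (c : E) : IsPrimitive a b (fun _ => c) (fun _ => (0 : E)) where
  ac := (LipschitzWith.const c).lipschitzOnWith.absolutelyContinuousOnInterval
  hasDerivAt := .of_forall fun x => hasDerivAt_const x c

theorem mul {𝕜 : Type*} [RCLike 𝕜] {f f' g g' : ℝ → 𝕜} (hf : IsPrimitive a b f f')
    (hg : IsPrimitive a b g g') :
    IsPrimitive a b (fun x => f x * g x) (fun x => f' x * g x + f x * g' x) where
  ac := hf.ac.smul hg.ac
  hasDerivAt := by
    filter_upwards [hf.hasDerivAt, hg.hasDerivAt] with x hfx hgx using hfx.mul hgx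

theorem clm_apply {F : Type*} [NormedAddCommGroup F] [NormedSpace ℝ F] (L : E →L[ℝ] F)
    (hf : IsPrimitive a b f f') : IsPrimitive a b (fun x => L (f x)) (fun x => L (f' x)) where
  ac := absolutelyContinuousOnInterval_of_dist_le (C := ‖L‖) hf.ac fun x _ y _ => by
    simpa only [dist_eq_norm, map_sub] using L.le_opNorm (f x - f y)
  hasDerivAt := by
    filter_upwards [hf.hasDerivAt] with x hx using L.hasFDerivAt.comp_hasDerivAt x hx

theorem comp {φ φ' : ℝ → E} (hφ : ContDiff ℝ 1 φ) (hφ' : ∀ x, HasDerivAt φ (φ' x) x)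
    {f f' : ℝ → ℝ} (hf : IsPrimitive a b f f') :
    IsPrimitive a b (fun x => φ (f x)) (fun x => f' x • φ' (f x)) where
  ac := absolutelyContinuousOnInterval_comp hφ hf.ac
  hasDerivAt := by
    filter_upwards [hf.hasDerivAt] with x hx using (hφ' (f x)).scomp x hx

theorem integral [CompleteSpace E] (hab : a ≤ b) (hf : IntegrableOn f (Ioo a b)) :
    IsPrimitive a b (fun x => ∫ t in a..x, f t) f := by
  have hfi := intervalIntegrable_of_integrableOn_Ioo hf (left_mem_Icc.2 hab) (right_mem_Icc.2 hab)
  refine ⟨absolutelyContinuousOnInterval_integral hfi, ?_⟩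
  rw [ae_restrict_iff' measurableSet_Ioo]
  filter_upwards [hfi.ae_hasDerivAt_integral] with x hx hxI
  exact hx (by simpa only [uIcc_of_le hab] using Ioo_subset_Icc_self hxI) a left_mem_uIcc

theorem congr (hab : a ≤ b) (hf : IsPrimitive a b f f') (hfg : EqOn f g (Icc a b)) :
    IsPrimitive a b g f' where
  ac := absolutelyContinuousOnInterval_of_dist_le (C := 1) hf.ac fun x hx y hy => by
    rw [uIcc_of_le hab] at hx hy
    rw [one_mul, hfg hx, hfg hy]
  hasDerivAt := by
    filter_upwards [hf.hasDerivAt, ae_restrict_mem measurableSet_Ioo] with x hfx hx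
    refine hfx.congr_of_eventuallyEq ?_
    filter_upwards [Icc_mem_nhds hx.1 hx.2] with y hy using (hfg hy).symm

theorem integral_right [CompleteSpace E] (hab : a ≤ b) (hf : IntegrableOn f (Ioo a b)) :
    IsPrimitive a b (fun x => ∫ t in x..b, f t) (fun x => -f x) := by
  have hint : ∀ {x}, x ∈ Icc a b → IntervalIntegrable f volume a x := fun hx =>
    intervalIntegrable_of_integrableOn_Ioo hf (left_mem_Icc.2 hab) hx
  have hsub := (const (a := a) (b := b) (∫ t in a..b, f t)).sub (integral hab hf)
  simp only [zero_sub] at hsub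
  exact hsub.congr hab fun x hx =>
    intervalIntegral.integral_interval_sub_left (hint (right_mem_Icc.2 hab)) (hint hx)

theorem eq_left_of_ae_eq_zero (hab : a ≤ b) (hf : IsPrimitive a b f f')
    (hf' : ∀ᵐ x ∂(volume.restrict (Ioo a b)), f' x = 0) : ∀ x ∈ Icc a b, f x = f a := by
  have hderiv : ∀ᵐ x, x ∈ uIcc a b → HasDerivAt f 0 x := by
    rw [uIcc_of_le hab, ← ae_restrict_iff' measurableSet_Icc,
      ← Measure.restrict_congr_set Ioo_ae_eq_Icc]
    exact (hf.congr_deriv hf').hasDerivAt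
  obtain ⟨C, hC⟩ := hf.ac.const_of_ae_hasDerivAt_zero hderiv
  rw [uIcc_of_le hab] at hC
  exact fun x hx => (hC x hx).trans (hC a (left_mem_Icc.2 hab)).symm

theorem eq_add_integral [CompleteSpace E] (hab : a ≤ b) (hf : IsPrimitive a b f f')
    (hf' : IntegrableOn f' (Ioo a b)) {x : ℝ} (hx : x ∈ Icc a b) :
    f x = f a + ∫ t in a..x, f' t := by
  have hconst := (hf.sub (integral hab hf')).eq_left_of_ae_eq_zero hab (by simp) x hx
  rw [intervalIntegral.integral_same, sub_zero] at hconst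
  exact sub_eq_iff_eq_add.1 hconst

theorem integrableOn {f f' : ℝ → ℝ} (hab : a ≤ b) (hf : IsPrimitive a b f f') :
    IntegrableOn f' (Ioo a b) := by
  have hderiv := hf.ac.intervalIntegrable_deriv
  rw [intervalIntegrable_iff_integrableOn_Ioo_of_le hab] at hderiv
  refine hderiv.congr ?_
  filter_upwards [hf.hasDerivAt] with x hx using hx.deriv

theorem integral_eq_sub {f f' : ℝ → ℝ} (hab : a ≤ b) (hf : IsPrimitive a b f f') {x y : ℝ}
    (hx : x ∈ Icc a b) (hy : y ∈ Icc a b) : ∫ t in x..y, f' t = f y - f x := by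
  have hf' := hf.integrableOn hab
  have ha := left_mem_Icc.2 hab
  rw [hf.eq_add_integral hab hf' hx, hf.eq_add_integral hab hf' hy, add_sub_add_left_eq_sub,
    intervalIntegral.integral_interval_sub_left
      (intervalIntegrable_of_integrableOn_Ioo hf' ha hy)
      (intervalIntegrable_of_integrableOn_Ioo hf' ha hx)]

end IsPrimitive

/-! ### Differential equations with integrable coefficients -/

section Caratheodory

variable {E : Type*} [NormedAddCommGroup E] {a b : ℝ} {F : ℝ → E → E} {k : ℝ → ℝ}

theorem ae_nonneg_of_norm_sub_le [Nontrivial E]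
    (hF : ∀ᵐ x ∂(volume.restrict (Ioo a b)), ∀ y z, ‖F x y - F x z‖ ≤ k x * ‖y - z‖) :
    ∀ᵐ x ∂(volume.restrict (Ioo a b)), 0 ≤ k x := by
  obtain ⟨y, hy⟩ := exists_ne (0 : E)
  filter_upwards [hF] with x hx
  refine nonneg_of_mul_nonneg_left ((norm_nonneg _).trans (hx y 0)) ?_
  simpa only [sub_zero, norm_pos_iff] using hy

variable [NormedSpace ℝ E]

theorem isPrimitive_exp_two_mul_integral (hab : a ≤ b) (hk : IntegrableOn k (Ioo a b)) :
    IsPrimitive a b (fun x => Real.exp (2 * ∫ t in a..x, k t))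
      (fun x => k x * (2 * Real.exp (2 * ∫ t in a..x, k t))) :=
  (IsPrimitive.integral hab hk).comp (φ := fun y => Real.exp (2 * y))
    (φ' := fun y => 2 * Real.exp (2 * y)) (by fun_prop)
    (fun y => by simpa [mul_comm] using ((hasDerivAt_id y).const_mul 2).exp)

theorem norm_integral_sub_integral_le (hk : IntegrableOn k (Ioo a b))
    (hk0 : ∀ᵐ x ∂(volume.restrict (Ioo a b)), 0 ≤ k x)
    (hF : ∀ᵐ x ∂(volume.restrict (Ioo a b)), ∀ y z, ‖F x y - F x z‖ ≤ k x * ‖y - z‖)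
    {u v : ℝ → E} (hu : IntegrableOn (fun x => F x (u x)) (Ioo a b))
    (hv : IntegrableOn (fun x => F x (v x)) (Ioo a b)) {D : ℝ}
    (huv : ∀ x ∈ Icc a b, ‖u x - v x‖ ≤ Real.exp (2 * ∫ s in a..x, k s) * D) {t : ℝ}
    (ht : t ∈ Icc a b) :
    ‖(∫ s in a..t, F s (u s)) - ∫ s in a..t, F s (v s)‖ ≤
      (Real.exp (2 * ∫ s in a..t, k s) - 1) * (D / 2) := by
  have hab : a ≤ b := ht.1.trans ht.2
  have ha : a ∈ Icc a b := left_mem_Icc.2 hab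
  have hexp := isPrimitive_exp_two_mul_integral hab hk
  have hweight : ∫ s in a..t, k s * (2 * Real.exp (2 * ∫ x in a..s, k x)) =
      Real.exp (2 * ∫ s in a..t, k s) - 1 := by
    simpa using hexp.integral_eq_sub hab ha ht
  rw [← hweight, ← intervalIntegral.integral_mul_const, ← intervalIntegral.integral_sub
    (intervalIntegrable_of_integrableOn_Ioo hu ha ht)
    (intervalIntegrable_of_integrableOn_Ioo hv ha ht)]
  refine intervalIntegral.norm_integral_le_of_norm_le ht.1 ?_
    ((intervalIntegrable_of_integrableOn_Ioo (hexp.integrableOn hab) ha ht).mul_const _)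
  rw [← ae_restrict_iff' measurableSet_Ioc]
  filter_upwards [ae_restrict_Ioc_of_ae_restrict_Ioo ht hF,
    ae_restrict_Ioc_of_ae_restrict_Ioo ht hk0, ae_restrict_mem measurableSet_Ioc] with s hFs hks hs
  calc ‖F s (u s) - F s (v s)‖ ≤ k s * ‖u s - v s‖ := hFs _ _
    _ ≤ k s * (Real.exp (2 * ∫ x in a..s, k x) * D) := by
      gcongr
      exact huv s ⟨hs.1.le, hs.2.trans ht.2⟩
    _ = k s * (2 * Real.exp (2 * ∫ x in a..s, k x)) * (D / 2) := by ring

theorem exists_eq_of_weighted_contraction [CompleteSpace E] (hab : a ≤ b) {m : ℝ → ℝ}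
    (hmc : ContinuousOn m (Icc a b)) (hm : ∀ x, 0 < m x) {K : NNReal} (hK : K < 1)
    {Φ : (ℝ → E) → ℝ → E} (hΦc : ∀ u, Continuous u → ContinuousOn (Φ u) (Icc a b))
    (hΦ : ∀ u v, Continuous u → Continuous v → ∀ D,
      (∀ x ∈ Icc a b, ‖u x - v x‖ ≤ m x * D) → ∀ x ∈ Icc a b, ‖Φ u x - Φ v x‖ ≤ m x * (K * D)) :
    ∃ u, Continuous u ∧ ∀ x ∈ Icc a b, u x = Φ u x := by
  have hmI : Continuous ((Icc a b).domRestrict m) := continuousOn_iff_continuous_domRestrict.1 hmc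
  -- `v ↦ m • v` turns the supremum norm of `C([a, b], E)` into the weighted norm `sup ‖u x‖ / m x`.
  let unweight (v : C(Icc a b, E)) : ℝ → E := IccExtend hab fun x => m x • v x
  have unweight_apply (v) {x} (hx : x ∈ Icc a b) : unweight v x = m x • v ⟨x, hx⟩ :=
    IccExtend_of_mem hab _ hx
  have hunweight (v) : Continuous (unweight v) := (hmI.smul v.continuous).Icc_extend'
  let T (v : C(Icc a b, E)) : C(Icc a b, E) := ⟨fun t => (m t)⁻¹ • Φ (unweight v) t,
    (hmI.inv₀ fun t => (hm t).ne').smul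
      (continuousOn_iff_continuous_domRestrict.1 (hΦc _ (hunweight v)))⟩
  have hT : ContractingWith K T := by
    refine ⟨hK, LipschitzWith.of_dist_le_mul fun v w => ?_⟩
    rw [ContinuousMap.dist_le (by positivity)]
    rintro ⟨t, ht⟩
    have hdist : ∀ x ∈ Icc a b, ‖unweight v x - unweight w x‖ ≤ m x * dist v w := fun x hx => by
      rw [unweight_apply v hx, unweight_apply w hx, ← smul_sub, norm_smul,
        Real.norm_of_nonneg (hm x).le, ← dist_eq_norm]
      exact mul_le_mul_of_nonneg_left (ContinuousMap.dist_apply_le_dist _) (hm x).le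
    calc dist (T v ⟨t, ht⟩) (T w ⟨t, ht⟩)
        = ‖(m t)⁻¹ • Φ (unweight v) t - (m t)⁻¹ • Φ (unweight w) t‖ := dist_eq_norm _ _
      _ = (m t)⁻¹ * ‖Φ (unweight v) t - Φ (unweight w) t‖ := by
          rw [← smul_sub, norm_smul, norm_inv, Real.norm_of_nonneg (hm t).le]
      _ ≤ K * dist v w := by
          rw [inv_mul_le_iff₀ (hm t)]
          exact hΦ _ _ (hunweight v) (hunweight w) _ hdist t ht
  obtain ⟨v, hv⟩ : ∃ v, T v = v := ⟨hT.fixedPoint, hT.fixedPoint_isFixedPt⟩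
  refine ⟨unweight v, hunweight v, fun x hx => ?_⟩
  have hvx : v ⟨x, hx⟩ = (m x)⁻¹ • Φ (unweight v) x := congrArg (fun f => f ⟨x, hx⟩) hv.symm
  rw [unweight_apply v hx, hvx, smul_inv_smul₀ (hm x).ne']

-- The Picard map is a contraction for the weight `exp (2 ∫ₐˣ k)`, without splitting the interval.
theorem exists_isPrimitive_of_lipschitz [CompleteSpace E] [Nontrivial E] (hab : a ≤ b)
    (hk : IntegrableOn k (Ioo a b))
    (hFi : ∀ u : ℝ → E, Continuous u → IntegrableOn (fun x => F x (u x)) (Ioo a b))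
    (hF : ∀ᵐ x ∂(volume.restrict (Ioo a b)), ∀ y z, ‖F x y - F x z‖ ≤ k x * ‖y - z‖) (u₀ : E) :
    ∃ u : ℝ → E, u a = u₀ ∧ IsPrimitive a b u (fun x => F x (u x)) := by
  set m : ℝ → ℝ := fun x => Real.exp (2 * ∫ t in a..x, k t)
  have hpicard (u : ℝ → E) (hu : Continuous u) :
      IsPrimitive a b (fun t => u₀ + ∫ s in a..t, F s (u s)) (fun t => F t (u t)) := by
    simpa only [zero_add] using (IsPrimitive.const u₀).add (IsPrimitive.integral hab (hFi u hu))
  obtain ⟨u, hu, hfix⟩ := exists_eq_of_weighted_contraction hab (K := 1 / 2)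
    ((isPrimitive_exp_two_mul_integral hab hk).continuousOn hab) (fun x => Real.exp_pos _)
    (by norm_num) (fun u hu => (hpicard u hu).continuousOn hab) fun u v hu hv D huv t ht => by
      have hD : 0 ≤ D := nonneg_of_mul_nonneg_right ((norm_nonneg _).trans (huv t ht))
        (Real.exp_pos _)
      calc ‖u₀ + (∫ s in a..t, F s (u s)) - (u₀ + ∫ s in a..t, F s (v s))‖
          = ‖(∫ s in a..t, F s (u s)) - ∫ s in a..t, F s (v s)‖ := by
            rw [add_sub_add_left_eq_sub]
        _ ≤ (m t - 1) * (D / 2) := norm_integral_sub_integral_le hk (ae_nonneg_of_norm_sub_le hF)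
            hF (hFi u hu) (hFi v hv) huv ht
        _ ≤ m t * ((1 / 2 : NNReal) * D) := by
            push_cast
            linarith
  refine ⟨fun t => u₀ + ∫ s in a..t, F s (u s), by simp, (hpicard u hu).congr_deriv ?_⟩
  filter_upwards [ae_restrict_mem measurableSet_Ioo] with x hx
  rw [hfix x (Ioo_subset_Icc_self hx)]

end Caratheodory

section LinearScalar

variable {a b : ℝ} {d g h : ℝ → ℝ}

theorem isPrimitive_exp_neg_integral_mul (hab : a ≤ b) (hg : IntegrableOn g (Ioo a b))
    (hd : IsPrimitive a b d (fun x => g x * d x + h x)) :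
    IsPrimitive a b (fun x => Real.exp (-∫ t in a..x, g t) * d x)
      (fun x => Real.exp (-∫ t in a..x, g t) * h x) := by
  have hexp := (IsPrimitive.integral hab hg).comp (φ := fun y => Real.exp (-y))
    (φ' := fun y => -Real.exp (-y)) (by fun_prop)
    (fun y => by simpa using (hasDerivAt_id y).neg.exp)
  refine (hexp.mul hd).congr_deriv (.of_forall fun x => ?_)
  simp only [smul_eq_mul]
  ring

theorem nonneg_of_linear (hab : a ≤ b) (hg : IntegrableOn g (Ioo a b))
    (hd : IsPrimitive a b d (fun x => g x * d x + h x))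
    (hh : ∀ᵐ x ∂(volume.restrict (Ioo a b)), 0 ≤ h x) {x y : ℝ} (hx : x ∈ Icc a b)
    (hy : y ∈ Icc a b) (hxy : x ≤ y) (hdx : 0 ≤ d x) : 0 ≤ d y := by
  have hsub := (isPrimitive_exp_neg_integral_mul hab hg hd).integral_eq_sub hab hx hy
  have hint : 0 ≤ ∫ t in x..y, Real.exp (-∫ s in a..t, g s) * h t := by
    refine intervalIntegral.integral_nonneg_of_ae_restrict hxy ?_
    rw [← Measure.restrict_congr_set (Ioo_ae_eq_Icc (μ := volume) (a := x) (b := y))]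
    filter_upwards [ae_restrict_of_ae_restrict_of_subset (Ioo_subset_Ioo hx.1 hy.2) hh] with t ht
    exact mul_nonneg (Real.exp_pos _).le ht
  have hleft : 0 ≤ Real.exp (-∫ t in a..x, g t) * d x := mul_nonneg (Real.exp_pos _).le hdx
  exact nonneg_of_mul_nonneg_right (by linarith) (Real.exp_pos (-∫ t in a..y, g t))

theorem pos_right_of_linear (hab : a ≤ b) (hg : IntegrableOn g (Ioo a b))
    (hd : IsPrimitive a b d (fun x => g x * d x + h x))
    (hh : ∀ᵐ x ∂(volume.restrict (Ioo a b)), 0 ≤ h x)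
    (hne : ¬ ∀ᵐ x ∂(volume.restrict (Ioo a b)), h x = 0) (hda : 0 ≤ d a) : 0 < d b := by
  have ha := left_mem_Icc.2 hab
  have hb := right_mem_Icc.2 hab
  have hprim := isPrimitive_exp_neg_integral_mul hab hg hd
  refine (nonneg_of_linear hab hg hd hh ha hb hab hda).lt_of_ne' fun hdb => hne ?_
  have hnonneg : ∀ᵐ x ∂(volume.restrict (Ioo a b)),
      0 ≤ Real.exp (-∫ s in a..x, g s) * h x := by
    filter_upwards [hh] with x hx using mul_nonneg (Real.exp_pos _).le hx
  have hint : ∫ t in Ioo a b, Real.exp (-∫ s in a..t, g s) * h t = 0 := by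
    refine le_antisymm ?_ (integral_nonneg_of_ae hnonneg)
    rw [← integral_Ioc_eq_integral_Ioo, ← intervalIntegral.integral_of_le hab,
      hprim.integral_eq_sub hab ha hb, hdb]
    simpa using hda
  filter_upwards [(integral_eq_zero_iff_of_nonneg_ae hnonneg (hprim.integrableOn hab)).1 hint]
    with x hx
  exact (mul_eq_zero.1 hx).resolve_left (Real.exp_pos _).ne'

theorem abs_integral_le_integral_Ioo_abs (hg : IntegrableOn g (Ioo a b)) {x : ℝ}
    (hx : x ∈ Icc a b) : |∫ t in a..x, g t| ≤ ∫ t in Ioo a b, |g t| := by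
  refine (intervalIntegral.abs_integral_le_integral_abs hx.1).trans ?_
  rw [intervalIntegral.integral_of_le hx.1, integral_Ioc_eq_integral_Ioo]
  exact setIntegral_mono_set hg.abs (.of_forall fun _ => abs_nonneg _)
    (Ioo_subset_Ioo_right hx.2).eventuallyLE

theorem abs_right_le_of_linear (hab : a ≤ b) (hg : IntegrableOn g (Ioo a b))
    (hh : IntegrableOn h (Ioo a b)) (hd : IsPrimitive a b d (fun x => g x * d x + h x))
    (hda : d a = 0) :
    |d b| ≤ Real.exp (2 * ∫ x in Ioo a b, |g x|) * ∫ x in Ioo a b, |h x| := by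
  have ha := left_mem_Icc.2 hab
  have hb := right_mem_Icc.2 hab
  set M := ∫ x in Ioo a b, |g x|
  set I := ∫ t in a..b, Real.exp (-∫ s in a..t, g s) * h t with hI
  have hG : ∀ x ∈ Icc a b, |∫ t in a..x, g t| ≤ M := fun x hx =>
    abs_integral_le_integral_Ioo_abs hg hx
  have hdb : d b = Real.exp (∫ t in a..b, g t) * I := by
    rw [hI, (isPrimitive_exp_neg_integral_mul hab hg hd).integral_eq_sub hab ha hb, hda, mul_zero,
      sub_zero, ← mul_assoc, ← Real.exp_add, add_neg_cancel, Real.exp_zero, one_mul]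
  have hI_le : |I| ≤ Real.exp M * ∫ x in Ioo a b, |h x| := by
    rw [← integral_const_mul, ← integral_Ioc_eq_integral_Ioo, ← intervalIntegral.integral_of_le hab,
      ← Real.norm_eq_abs]
    refine intervalIntegral.norm_integral_le_of_norm_le hab (.of_forall fun t ht => ?_)
      ((intervalIntegrable_of_integrableOn_Ioo hh.abs ha hb).const_mul _)
    rw [norm_mul, Real.norm_eq_abs, Real.norm_eq_abs, Real.abs_exp]
    gcongr
    exact (neg_le_abs _).trans (hG t (Ioc_subset_Icc_self ht))
  rw [hdb, abs_mul, Real.abs_exp, two_mul, Real.exp_add, mul_assoc]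
  gcongr
  exact (le_abs_self _).trans (hG b hb)

end LinearScalar

/-! ### The Prüfer equation -/

/-- The right-hand side `p⁻¹ cos² y + (μ r - q) sin² y` of the Prüfer equation, that is, of the
differential equation of the Prüfer angles of the solutions of `τ u = μ u`. -/
def pruferField (p q r : ℝ → ℝ) (μ x y : ℝ) : ℝ :=
  (p x)⁻¹ * Real.cos y ^ 2 + (μ * r x - q x) * Real.sin y ^ 2

/-- The difference quotient in `y, z` of `pruferField p q r μ x`, extended continuously to
`y = z`. -/
def pruferSlope (p q r : ℝ → ℝ) (μ x y z : ℝ) : ℝ :=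
  (μ * r x - q x - (p x)⁻¹) * (Real.sin (y + z) * Real.sinc (y - z))

/-- `θ` is an absolutely continuous solution of the Prüfer equation with spectral parameter `μ`
on `[a, b]`. -/
def IsPruferSolution (a b : ℝ) (p q r : ℝ → ℝ) (μ : ℝ) (θ : ℝ → ℝ) : Prop :=
  IsPrimitive a b θ (fun x => pruferField p q r μ x (θ x))

theorem sin_sq_sub_sin_sq (x y : ℝ) :
    Real.sin x ^ 2 - Real.sin y ^ 2 = Real.sin (x + y) * Real.sinc (x - y) * (x - y) := by
  have hprod : Real.sin (x + y) * Real.sin (x - y) = Real.sin x ^ 2 - Real.sin y ^ 2 := by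
    rw [Real.sin_add, Real.sin_sub]
    linear_combination Real.sin x ^ 2 * Real.sin_sq_add_cos_sq y -
      Real.sin y ^ 2 * Real.sin_sq_add_cos_sq x
  rcases eq_or_ne (x - y) 0 with hxy | hxy
  · rw [hxy, mul_zero, sub_eq_zero.1 hxy, sub_self]
  · rw [Real.sinc_of_ne_zero hxy, mul_assoc, div_mul_cancel₀ _ hxy, hprod]

theorem abs_sin_mul_sinc_le_one (x y : ℝ) : |Real.sin x * Real.sinc y| ≤ 1 := by
  rw [abs_mul]
  exact mul_le_one₀ (Real.abs_sin_le_one x) (abs_nonneg _) (Real.abs_sinc_le_one y)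

theorem sin_le_sin_of_mem_Icc {δ t : ℝ} (hδ : 0 ≤ δ) (ht : t ∈ Icc δ (Real.pi - δ)) :
    Real.sin δ ≤ Real.sin t := by
  rcases le_total t (Real.pi / 2) with h | h
  · exact Real.sin_le_sin_of_le_of_le_pi_div_two (by linarith [Real.pi_pos]) h ht.1
  · rw [← Real.sin_pi_sub t]
    exact Real.sin_le_sin_of_le_of_le_pi_div_two (by linarith [Real.pi_pos]) (by linarith)
      (by linarith [ht.2])

section Field

variable (p q r : ℝ → ℝ)

theorem pruferField_sub_pruferField (μ x y z : ℝ) :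
    pruferField p q r μ x y - pruferField p q r μ x z = pruferSlope p q r μ x y z * (y - z) := by
  rw [pruferField, pruferField, pruferSlope, Real.cos_sq', Real.cos_sq']
  linear_combination (μ * r x - q x - (p x)⁻¹) * sin_sq_sub_sin_sq y z

theorem pruferField_sub_pruferField_param (μ ν x y : ℝ) :
    pruferField p q r ν x y - pruferField p q r μ x y = (ν - μ) * r x * Real.sin y ^ 2 := by
  rw [pruferField, pruferField]
  ring

theorem pruferField_zero (μ x : ℝ) : pruferField p q r μ x 0 = (p x)⁻¹ := by
  simp [pruferField]

theorem abs_pruferSlope_le (μ x y z : ℝ) :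
    |pruferSlope p q r μ x y z| ≤ |μ * r x - q x - (p x)⁻¹| := by
  rw [pruferSlope, abs_mul]
  exact mul_le_of_le_one_right (abs_nonneg _) (abs_sin_mul_sinc_le_one _ _)

end Field

section

variable {a b : ℝ} {p q r : ℝ → ℝ}

theorem IsRegular.integrable_potential (hreg : IsRegular a b p q r) (μ : ℝ) :
    IntegrableOn (fun x => μ * r x - q x) (Ioo a b) :=
  (hreg.integrable_r.const_mul μ).sub hreg.integrable_q

theorem IsRegular.inv_p_pos (hreg : IsRegular a b p q r) :
    ∀ᵐ x ∂(volume.restrict (Ioo a b)), 0 < (p x)⁻¹ := by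
  filter_upwards [hreg.p_pos] with x hx using inv_pos.2 hx

theorem IsRegular.integrable_pruferField (hreg : IsRegular a b p q r) (μ : ℝ) {θ : ℝ → ℝ}
    (hθ : ContinuousOn θ (Icc a b)) :
    IntegrableOn (fun x => pruferField p q r μ x (θ x)) (Ioo a b) :=
  (integrableOn_mul_continuousOn hreg.integrable_inv_p (by fun_prop)).add
    (integrableOn_mul_continuousOn (hreg.integrable_potential μ) (by fun_prop))

theorem IsRegular.integrable_pruferSlope (hreg : IsRegular a b p q r) (μ : ℝ) {θ η : ℝ → ℝ}
    (hθ : ContinuousOn θ (Icc a b)) (hη : ContinuousOn η (Icc a b)) :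
    IntegrableOn (fun x => pruferSlope p q r μ x (θ x) (η x)) (Ioo a b) :=
  integrableOn_mul_continuousOn ((hreg.integrable_potential μ).sub hreg.integrable_inv_p)
    ((Real.continuous_sin.comp_continuousOn (hθ.add hη)).mul
      (Real.continuous_sinc.comp_continuousOn (hθ.sub hη)))

theorem exists_isPruferSolution (hab : a ≤ b) (hreg : IsRegular a b p q r) (μ θ₀ : ℝ) :
    ∃ θ : ℝ → ℝ, θ a = θ₀ ∧ IsPruferSolution a b p q r μ θ := by
  refine exists_isPrimitive_of_lipschitz hab
    (F := pruferField p q r μ) (k := fun x => |μ * r x - q x - (p x)⁻¹|)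
    ((hreg.integrable_potential μ).sub hreg.integrable_inv_p).abs
    (fun θ hθ => hreg.integrable_pruferField μ hθ.continuousOn) (.of_forall fun x y z => ?_) θ₀
  rw [pruferField_sub_pruferField, norm_mul, Real.norm_eq_abs]
  exact mul_le_mul_of_nonneg_right (abs_pruferSlope_le p q r μ x y z) (norm_nonneg _)

theorem volume_restrict_Ioo_ne_zero (hab : a < b) : volume.restrict (Ioo a b) ≠ 0 := by
  rw [Ne, Measure.restrict_eq_zero, Real.volume_Ioo]
  simpa using hab

theorem not_ae_eq_zero_of_ae_pos (hab : a < b) {h : ℝ → ℝ}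
    (hh : ∀ᵐ x ∂(volume.restrict (Ioo a b)), 0 < h x) :
    ¬ ∀ᵐ x ∂(volume.restrict (Ioo a b)), h x = 0 := by
  intro h_zero
  have := ae_neBot.2 (volume_restrict_Ioo_ne_zero hab)
  obtain ⟨x, hpos, hzero⟩ := (hh.and h_zero).exists
  exact hpos.ne' hzero

theorem integral_pos_of_ae_pos {h : ℝ → ℝ} (hi : IntegrableOn h (Ioo a b))
    (hh : ∀ᵐ x ∂(volume.restrict (Ioo a b)), 0 < h x) {x y : ℝ} (hx : x ∈ Icc a b)
    (hy : y ∈ Icc a b) (hxy : x < y) : 0 < ∫ t in x..y, h t := by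
  have hsub := Ioo_subset_Ioo hx.1 hy.2
  have hpos := ae_restrict_of_ae_restrict_of_subset hsub hh
  refine pos_right_of_linear hxy.le (d := fun z => ∫ t in x..z, h t) (g := fun _ => 0) (h := h)
    integrableOn_zero ?_ (hpos.mono fun t ht => ht.le) (not_ae_eq_zero_of_ae_pos hxy hpos)
    (by simp)
  simpa only [zero_mul, zero_add] using IsPrimitive.integral hxy.le (hi.mono_set hsub)

namespace IsPruferSolution

variable {μ ν : ℝ} {θ θ₁ θ₂ : ℝ → ℝ}

theorem isPrimitive_sub (h₁ : IsPruferSolution a b p q r μ θ₁)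
    (h₂ : IsPruferSolution a b p q r ν θ₂) :
    IsPrimitive a b (fun x => θ₂ x - θ₁ x) (fun x =>
      pruferSlope p q r ν x (θ₂ x) (θ₁ x) * (θ₂ x - θ₁ x) +
        (ν - μ) * r x * Real.sin (θ₁ x) ^ 2) := by
  refine (IsPrimitive.sub h₂ h₁).congr_deriv (.of_forall fun x => ?_)
  rw [← pruferField_sub_pruferField, ← pruferField_sub_pruferField_param p q r]
  ring

theorem isPrimitive_slope_zero (h : IsPruferSolution a b p q r μ θ) :
    IsPrimitive a b θ (fun x => pruferSlope p q r μ x (θ x) 0 * θ x + (p x)⁻¹) := by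
  refine IsPrimitive.congr_deriv h (.of_forall fun x => ?_)
  linear_combination pruferField_sub_pruferField p q r μ x (θ x) 0 + pruferField_zero p q r μ x

theorem not_sin_ae_eq_zero (hab : a < b) (hreg : IsRegular a b p q r)
    (h : IsPruferSolution a b p q r μ θ) :
    ¬ ∀ᵐ x ∂(volume.restrict (Ioo a b)), Real.sin (θ x) = 0 := by
  intro h_ae
  have hsin : ∀ x ∈ Ioo a b, Real.sin (θ x) = 0 :=
    Measure.eqOn_open_of_ae_eq (g := fun _ => (0 : ℝ)) h_ae isOpen_Ioo
      (Real.continuous_sin.comp_continuousOn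
        ((IsPrimitive.continuousOn h hab.le).mono Ioo_subset_Icc_self)) continuousOn_const
  have hderiv := (IsPrimitive.comp (φ := Real.sin) (φ' := Real.cos) Real.contDiff_sin
    Real.hasDerivAt_sin h).hasDerivAt
  have := ae_neBot.2 (volume_restrict_Ioo_ne_zero hab)
  obtain ⟨x, ⟨hx_deriv, hpx⟩, hx⟩ :=
    ((hderiv.and hreg.inv_p_pos).and (ae_restrict_mem measurableSet_Ioo)).exists
  have hx_zero := hx_deriv.unique ((hasDerivAt_const x (0 : ℝ)).congr_of_eventuallyEq (by
    filter_upwards [isOpen_Ioo.mem_nhds hx] with y hy using hsin y hy))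
  have hcos_sq : Real.cos (θ x) ^ 2 = 1 := by rw [Real.cos_sq', hsin x hx]; norm_num
  have hcos : Real.cos (θ x) ≠ 0 := fun hzero => by norm_num [hzero] at hcos_sq
  rw [pruferField, hcos_sq, hsin x hx] at hx_zero
  simp only [mul_one, ne_eq, OfNat.ofNat_ne_zero, not_false_eq_true, zero_pow, mul_zero, add_zero,
    smul_eq_mul, mul_eq_zero, hpx.ne', hcos, or_self] at hx_zero

theorem lt_of_lt (hab : a < b) (hreg : IsRegular a b p q r) (hμν : μ < ν)
    (h₁ : IsPruferSolution a b p q r μ θ₁) (h₂ : IsPruferSolution a b p q r ν θ₂)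
    (ha : θ₁ a = θ₂ a) : θ₁ b < θ₂ b := by
  have hpos : 0 < ν - μ := sub_pos.2 hμν
  refine sub_pos.1 (pos_right_of_linear (d := fun x => θ₂ x - θ₁ x) hab.le
    (hreg.integrable_pruferSlope ν (IsPrimitive.continuousOn h₂ hab.le)
      (IsPrimitive.continuousOn h₁ hab.le))
    (isPrimitive_sub h₁ h₂) ?_ (fun h_zero => not_sin_ae_eq_zero hab hreg h₁ ?_)
    (sub_nonneg.2 ha.le))
  · filter_upwards [hreg.r_pos] with x hx
    positivity
  · filter_upwards [h_zero, hreg.r_pos] with x hx hr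
    simpa [hpos.ne', hr.ne'] using hx

theorem abs_sub_le (hab : a ≤ b) (hreg : IsRegular a b p q r) {M : ℝ} (hν : |ν| ≤ M)
    (h₁ : IsPruferSolution a b p q r μ θ₁) (h₂ : IsPruferSolution a b p q r ν θ₂)
    (ha : θ₁ a = θ₂ a) :
    |θ₂ b - θ₁ b| ≤ Real.exp (2 * ∫ x in Ioo a b, (M * |r x| + |q x| + |(p x)⁻¹|)) *
      (∫ x in Ioo a b, |r x|) * |ν - μ| := by
  have hθ₁ := IsPrimitive.continuousOn h₁ hab
  have hslope := hreg.integrable_pruferSlope ν (IsPrimitive.continuousOn h₂ hab) hθ₁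
  have hforcing : IntegrableOn (fun x => (ν - μ) * r x * Real.sin (θ₁ x) ^ 2) (Ioo a b) :=
    integrableOn_mul_continuousOn (hreg.integrable_r.const_mul _) (by fun_prop)
  refine (abs_right_le_of_linear hab hslope hforcing (isPrimitive_sub h₁ h₂)
    (by simp [ha])).trans ?_
  rw [mul_assoc]
  refine mul_le_mul (Real.exp_le_exp.2 (mul_le_mul_of_nonneg_left ?_ zero_le_two)) ?_
    (by positivity) (by positivity)
  · refine setIntegral_mono hslope.abs (((hreg.integrable_r.abs.const_mul M).add
      hreg.integrable_q.abs).add hreg.integrable_inv_p.abs) fun x => ?_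
    refine (abs_pruferSlope_le p q r ν x _ _).trans ((abs_sub _ _).trans
      (add_le_add_left ((abs_sub _ _).trans (add_le_add_left ?_ _)) _))
    rw [abs_mul]
    gcongr
  · rw [← integral_mul_const]
    refine setIntegral_mono hforcing.abs (hreg.integrable_r.abs.mul_const _) fun x => ?_
    simp only [abs_mul, abs_pow, sq_abs, mul_comm |r x|]
    exact mul_le_of_le_one_right (by positivity) (Real.sin_sq_le_one _)

theorem pos_right (hab : a < b) (hreg : IsRegular a b p q r) (h : IsPruferSolution a b p q r μ θ)
    (ha : 0 ≤ θ a) : 0 < θ b :=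
  pos_right_of_linear hab.le
    (hreg.integrable_pruferSlope μ (IsPrimitive.continuousOn h hab.le) continuousOn_const)
    (isPrimitive_slope_zero h) (hreg.inv_p_pos.mono fun _ => le_of_lt)
    (not_ae_eq_zero_of_ae_pos hab hreg.inv_p_pos) ha

theorem sub_le (hab : a ≤ b) (hreg : IsRegular a b p q r) {M s : ℝ} (hM : 0 ≤ M)
    (h : IsPruferSolution a b p q r (-M) θ) {x y : ℝ} (hx : x ∈ Icc a b) (hy : y ∈ Icc a b)
    (hxy : x ≤ y) (hs : ∀ t ∈ Ioo x y, s ≤ Real.sin (θ t) ^ 2) :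
    θ y - θ x ≤ (∫ t in x..y, ((p t)⁻¹ + |q t|)) - M * (s * ∫ t in x..y, r t) := by
  have hk : IntervalIntegrable (fun t => (p t)⁻¹ + |q t|) volume x y :=
    intervalIntegrable_of_integrableOn_Ioo (hreg.integrable_inv_p.add hreg.integrable_q.abs) hx hy
  have hr := (intervalIntegrable_of_integrableOn_Ioo hreg.integrable_r hx hy).const_mul (M * s)
  rw [← IsPrimitive.integral_eq_sub hab h hx hy, ← mul_assoc,
    ← intervalIntegral.integral_const_mul, ← intervalIntegral.integral_sub hk hr]
  refine intervalIntegral.integral_mono_ae_restrict hxy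
    (intervalIntegrable_of_integrableOn_Ioo (IsPrimitive.integrableOn hab h) hx hy)
    (hk.sub hr) ?_
  rw [← Measure.restrict_congr_set (Ioo_ae_eq_Icc (μ := volume) (a := x) (b := y))]
  have hsub := Ioo_subset_Ioo hx.1 hy.2
  filter_upwards [ae_restrict_of_ae_restrict_of_subset hsub hreg.inv_p_pos,
    ae_restrict_of_ae_restrict_of_subset hsub hreg.r_pos,
    ae_restrict_mem measurableSet_Ioo] with t hp hr ht
  have hcos : (p t)⁻¹ * Real.cos (θ t) ^ 2 ≤ (p t)⁻¹ :=
    mul_le_of_le_one_right hp.le (Real.cos_sq_le_one _)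
  have hq : -q t * Real.sin (θ t) ^ 2 ≤ |q t| :=
    (mul_le_mul_of_nonneg_right (neg_le_abs _) (sq_nonneg _)).trans
      (mul_le_of_le_one_right (abs_nonneg _) (Real.sin_sq_le_one _))
  have hsin : (M * r t) * s ≤ (M * r t) * Real.sin (θ t) ^ 2 :=
    mul_le_mul_of_nonneg_left (hs t ht) (mul_nonneg hM hr.le)
  rw [pruferField]
  linarith

theorem sub_le_of_subinterval (hab : a ≤ b) (hreg : IsRegular a b p q r) {M δ : ℝ} (hM : 0 ≤ M)
    (h : IsPruferSolution a b p q r (-M) θ) {x y : ℝ} (hx : x ∈ Icc a b) (hy : y ∈ Icc a b)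
    (hk : ∫ t in x..y, ((p t)⁻¹ + |q t|) ≤ δ) {s t : ℝ} (hxs : x ≤ s) (hst : s ≤ t)
    (hty : t ≤ y) : θ t - θ s ≤ δ := by
  have hs : s ∈ Icc a b := ⟨hx.1.trans hxs, (hst.trans hty).trans hy.2⟩
  have ht : t ∈ Icc a b := ⟨hs.1.trans hst, hty.trans hy.2⟩
  have hgrowth := sub_le hab hreg hM h hs ht hst (s := 0) fun _ _ => sq_nonneg _
  have hk_nonneg : 0 ≤ᵐ[volume.restrict (Ioc x y)] fun t => (p t)⁻¹ + |q t| := by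
    rw [← Measure.restrict_congr_set (Ioo_ae_eq_Ioc (μ := volume) (a := x) (b := y))]
    filter_upwards [ae_restrict_of_ae_restrict_of_subset (Ioo_subset_Ioo hx.1 hy.2)
      hreg.inv_p_pos] with t ht
    exact add_nonneg ht.le (abs_nonneg _)
  have hk_mono := intervalIntegral.integral_mono_interval hxs hst hty hk_nonneg
    (intervalIntegrable_of_integrableOn_Ioo (hreg.integrable_inv_p.add hreg.integrable_q.abs) hx hy)
  simp only [zero_mul, mul_zero, sub_zero] at hgrowth hk_mono
  linarith

/-- If `θ y > 2 δ`, then `θ` stays in `[δ, π - δ]` on `[x, y]`, where the term `-M r sin²` forces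
it to decrease by more than `π`. -/
theorem le_two_mul_of_pi_lt (hab : a ≤ b) (hreg : IsRegular a b p q r) {M δ : ℝ} (hM : 0 ≤ M)
    (hδ : 0 < δ) (h : IsPruferSolution a b p q r (-M) θ) {x y : ℝ}
    (hx : x ∈ Icc a b) (hy : y ∈ Icc a b) (hxy : x ≤ y)
    (hk : ∫ t in x..y, ((p t)⁻¹ + |q t|) ≤ δ)
    (hr : Real.pi < M * (Real.sin δ ^ 2 * ∫ t in x..y, r t)) (hθx : θ x ≤ Real.pi - 2 * δ) :
    θ y ≤ 2 * δ := by
  have hgrowth {s t : ℝ} (hxs : x ≤ s) (hst : s ≤ t) (hty : t ≤ y) : θ t - θ s ≤ δ :=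
    sub_le_of_subinterval hab hreg hM h hx hy hk hxs hst hty
  by_contra! hcon
  have hmem : ∀ t ∈ Ioo x y, θ t ∈ Icc δ (Real.pi - δ) := fun t ht =>
    ⟨by linarith [hgrowth ht.1.le ht.2.le le_rfl], by linarith [hgrowth le_rfl ht.1.le ht.2.le]⟩
  have hδ_sin : 0 ≤ Real.sin δ :=
    Real.sin_nonneg_of_nonneg_of_le_pi hδ.le (by linarith [hgrowth le_rfl hxy le_rfl])
  have hdrop := sub_le hab hreg hM h hx hy hxy fun t ht =>
    pow_le_pow_left₀ hδ_sin (sin_le_sin_of_mem_Icc hδ.le (hmem t ht)) 2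
  linarith

end IsPruferSolution

theorem exists_strictMono_partition (hab : a < b) {k : ℝ → ℝ} (hk : IntegrableOn k (Ioo a b))
    {δ : ℝ} (hδ : 0 < δ) :
    ∃ (n : ℕ) (x : ℕ → ℝ), StrictMono x ∧ x 0 = a ∧ x (n + 1) = b ∧
      ∀ i ≤ n, ∫ t in x i..x (i + 1), k t ≤ δ := by
  obtain ⟨η, hη, hηk⟩ := Metric.uniformContinuousOn_iff.1
    (IsPrimitive.integral hab.le hk).ac.uniformContinuousOn δ hδ
  rw [uIcc_of_le hab.le] at hηk
  obtain ⟨n, hn⟩ := exists_nat_one_div_lt (div_pos hη (sub_pos.2 hab))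
  rw [lt_div_iff₀ (sub_pos.2 hab), one_div_mul_eq_div] at hn
  have hstep : 0 < (b - a) / (n + 1) := div_pos (sub_pos.2 hab) n.cast_add_one_pos
  set x : ℕ → ℝ := fun i => a + i * ((b - a) / (n + 1)) with hx
  have hx_succ (i : ℕ) : x (i + 1) - x i = (b - a) / (n + 1) := by
    simp only [hx, Nat.cast_add, Nat.cast_one]
    ring
  have hmono : StrictMono x := strictMono_nat_of_lt_succ fun i => by linarith [hx_succ i]
  have hx_zero : x 0 = a := by simp [hx]
  have hx_last : x (n + 1) = b := by
    simp only [hx, Nat.cast_add, Nat.cast_one]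
    field_simp
    ring
  have hmem (i : ℕ) (hi : i ≤ n + 1) : x i ∈ Icc a b :=
    ⟨hx_zero ▸ hmono.monotone i.zero_le, hx_last ▸ hmono.monotone hi⟩
  refine ⟨n, x, hmono, hx_zero, hx_last, fun i hi => ?_⟩
  have hi₀ := hmem i (by lia)
  have hi₁ := hmem (i + 1) (by lia)
  have hdist := hηk _ hi₁ _ hi₀ (by rwa [Real.dist_eq, hx_succ, abs_of_pos hstep])
  have ha := left_mem_Icc.2 hab.le
  rw [Real.dist_eq, intervalIntegral.integral_interval_sub_left
    (intervalIntegrable_of_integrableOn_Ioo hk ha hi₁)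
    (intervalIntegrable_of_integrableOn_Ioo hk ha hi₀)] at hdist
  exact ((le_abs_self _).trans_lt hdist).le

theorem eventually_pruferSolution_right_lt (hab : a < b) (hreg : IsRegular a b p q r) {α ε : ℝ}
    (hα0 : 0 ≤ α) (hα : α < Real.pi) (hε : 0 < ε) :
    ∀ᶠ M : ℝ in Filter.atTop, ∀ θ : ℝ → ℝ, θ a = α → IsPruferSolution a b p q r (-M) θ →
      θ b < ε := by
  obtain ⟨δ, hδ, hδε, hδα⟩ : ∃ δ > 0, 4 * δ ≤ ε ∧ 4 * δ ≤ Real.pi - α :=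
    ⟨min ε (Real.pi - α) / 4, div_pos (lt_min hε (sub_pos.2 hα)) (by norm_num),
      by linarith [min_le_left ε (Real.pi - α)], by linarith [min_le_right ε (Real.pi - α)]⟩
  obtain ⟨n, x, hx_mono, hx_zero, hx_last, hk⟩ :=
    exists_strictMono_partition hab (hreg.integrable_inv_p.add hreg.integrable_q.abs) hδ
  have hmem (i : ℕ) (hi : i ≤ n + 1) : x i ∈ Icc a b :=
    ⟨hx_zero ▸ hx_mono.monotone i.zero_le, hx_last ▸ hx_mono.monotone hi⟩
  have hsin : 0 < Real.sin δ := Real.sin_pos_of_pos_of_lt_pi hδ (by linarith)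
  have hlarge : ∀ᶠ M : ℝ in Filter.atTop, ∀ i ∈ Finset.range (n + 1),
      Real.pi < M * (Real.sin δ ^ 2 * ∫ t in x i..x (i + 1), r t) := by
    refine (Filter.eventually_all_finset _).2 fun i hi => ?_
    rw [Finset.mem_range] at hi
    have hr := integral_pos_of_ae_pos hreg.integrable_r hreg.r_pos (hmem i hi.le)
      (hmem (i + 1) hi) (hx_mono i.lt_succ_self)
    exact (Filter.tendsto_id.atTop_mul_const (by positivity)).eventually_gt_atTop _
  filter_upwards [hlarge, Filter.eventually_ge_atTop 0] with M hM hM0 θ hθa hθ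
  have hcell (i : ℕ) (hi : i ≤ n) (hθi : θ (x i) ≤ Real.pi - 2 * δ) : θ (x (i + 1)) ≤ 2 * δ :=
    hθ.le_two_mul_of_pi_lt hab.le hreg hM0 hδ (hmem i (by lia))
      (hmem (i + 1) (by lia)) (hx_mono i.lt_succ_self).le (hk i hi)
      (hM i (Finset.mem_range.2 (by lia))) hθi
  have hall (i : ℕ) (hi : i ≤ n) : θ (x i) ≤ Real.pi - 2 * δ := by
    induction i with
    | zero => rw [hx_zero, hθa]; linarith
    | succ i ih => linarith [hcell i (by lia) (ih (by lia))]
  have hθb := hcell n le_rfl (hall n le_rfl)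
  rw [hx_last] at hθb
  linarith

end

/-! ### Counting spectral parameters by the boundary angle -/

/-- The properties of the right endpoint angle `Θ μ = θ μ b` of the Prüfer equation, as a function
of the spectral parameter, from which the number of eigenvalues in a half-line can be read off. -/
structure IsCountingAngle (Θ : ℝ → ℝ) : Prop where
  strictMono : StrictMono Θ
  continuous : Continuous Θ
  pos : ∀ μ, 0 < Θ μ
  exists_lt : ∀ ε > 0, ∃ μ, Θ μ < ε

/-- For every `μ`, `θ μ` solves the Prüfer equation with parameter `μ` and starts at the angle
`α`. -/
structure IsPruferFamily (a b : ℝ) (p q r : ℝ → ℝ) (α : ℝ) (θ : ℝ → ℝ → ℝ) : Prop where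
  left : ∀ μ, θ μ a = α
  isPruferSolution : ∀ μ, IsPruferSolution a b p q r μ (θ μ)

section

variable {a b : ℝ} {p q r : ℝ → ℝ} {α : ℝ} {θ : ℝ → ℝ → ℝ}

theorem exists_isPruferFamily (hab : a ≤ b) (hreg : IsRegular a b p q r) (α : ℝ) :
    ∃ θ : ℝ → ℝ → ℝ, IsPruferFamily a b p q r α θ := by
  choose θ hleft hsol using fun μ => exists_isPruferSolution hab hreg μ α
  exact ⟨θ, hleft, hsol⟩

namespace IsPruferFamily

theorem continuous_right (h : IsPruferFamily a b p q r α θ) (hab : a ≤ b)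
    (hreg : IsRegular a b p q r) : Continuous (fun μ => θ μ b) := by
  refine continuous_iff_continuousAt.2 fun μ => tendsto_iff_dist_tendsto_zero.2 ?_
  set C := Real.exp (2 * ∫ x in Ioo a b, ((|μ| + 1) * |r x| + |q x| + |(p x)⁻¹|)) *
    (∫ x in Ioo a b, |r x|)
  have hC : Filter.Tendsto (fun ν => C * |ν - μ|) (nhds μ) (nhds 0) := by
    have hcont : Continuous fun ν : ℝ => C * |ν - μ| := by fun_prop
    simpa using hcont.tendsto μ
  refine squeeze_zero' (.of_forall fun _ => dist_nonneg) ?_ hC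
  filter_upwards [Metric.ball_mem_nhds μ one_pos] with ν hν
  rw [Metric.mem_ball, Real.dist_eq] at hν
  exact (h.isPruferSolution μ).abs_sub_le hab hreg (by linarith [abs_sub_abs_le_abs_sub ν μ])
    (h.isPruferSolution ν) ((h.left μ).trans (h.left ν).symm)

theorem isCountingAngle (h : IsPruferFamily a b p q r α θ) (hab : a < b)
    (hreg : IsRegular a b p q r) (hα : α ∈ Ico 0 Real.pi) : IsCountingAngle (fun μ => θ μ b) where
  strictMono μ ν hμν := (h.isPruferSolution μ).lt_of_lt hab hreg hμν (h.isPruferSolution ν)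
    ((h.left μ).trans (h.left ν).symm)
  continuous := h.continuous_right hab.le hreg
  pos μ := (h.isPruferSolution μ).pos_right hab hreg (by rw [h.left]; exact hα.1)
  exists_lt ε hε := by
    obtain ⟨M, hM⟩ := (eventually_pruferSolution_right_lt hab hreg hα.1 hα.2 hε).exists
    exact ⟨-M, hM _ (h.left _) (h.isPruferSolution _)⟩

end IsPruferFamily

end

/-- The parameters in `T` at which the angle `Θ` takes the value `β` modulo `π`. -/
def angleHits (Θ : ℝ → ℝ) (β : ℝ) (T : Set ℝ) : Set ℝ :=
  {μ | μ ∈ T ∧ ∃ k : ℤ, Θ μ = β + k * Real.pi}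

section Counting

variable {Θ : ℝ → ℝ} {β lam : ℝ}

theorem countable_angleHits (hΘ : Function.Injective Θ) (T : Set ℝ) :
    Countable (angleHits Θ β T) := by
  have hrange := (countable_range fun k : ℤ => β + k * Real.pi).preimage hΘ
  refine (hrange.mono ?_).to_subtype
  rintro μ ⟨-, k, hk⟩
  exact ⟨k, hk.symm⟩

theorem floor_of_eq_add_int_mul_pi {x : ℝ} {k : ℤ} (h : x = β + k * Real.pi) :
    ⌊(x - β) / Real.pi⌋ = k := by
  rw [h, add_sub_cancel_left, mul_div_cancel_right₀ _ Real.pi_ne_zero, Int.floor_intCast]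

theorem finite_angleHits_and_ncard_eq (hΘ : Function.Injective Θ) {T : Set ℝ} {J : Finset ℤ}
    (hJ : ∀ k : ℤ, k ∈ J ↔ ∃ μ ∈ T, Θ μ = β + k * Real.pi) :
    (angleHits Θ β T).Finite ∧ (angleHits Θ β T).ncard = J.card := by
  have himg : (fun μ => ⌊(Θ μ - β) / Real.pi⌋) '' angleHits Θ β T = J := by
    ext k
    rw [Finset.mem_coe, hJ]
    constructor
    · rintro ⟨μ, ⟨hμ, j, hj⟩, rfl⟩
      exact ⟨μ, hμ, by simpa only [floor_of_eq_add_int_mul_pi hj] using hj⟩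
    · rintro ⟨μ, hμ, hk⟩
      exact ⟨μ, ⟨hμ, k, hk⟩, floor_of_eq_add_int_mul_pi hk⟩
  have hinj : InjOn (fun μ => ⌊(Θ μ - β) / Real.pi⌋) (angleHits Θ β T) := by
    rintro μ ⟨-, j, hj⟩ ν ⟨-, k, hk⟩ hμν
    simp only [floor_of_eq_add_int_mul_pi hj, floor_of_eq_add_int_mul_pi hk] at hμν
    exact hΘ (hj.trans (hμν ▸ hk.symm))
  exact ⟨.of_finite_image (himg ▸ J.finite_toSet) hinj,
    by rw [← hinj.ncard_image, himg, ncard_coe_finset]⟩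

namespace IsCountingAngle

theorem exists_mem_Iic_eq_iff (hΘ : IsCountingAngle Θ) (hβ : β ∈ Ioc 0 Real.pi) (k : ℤ) :
    (∃ μ ∈ Iic lam, Θ μ = β + k * Real.pi) ↔ 0 ≤ k ∧ β + k * Real.pi ≤ Θ lam := by
  constructor
  · rintro ⟨μ, hμ, hk⟩
    refine ⟨?_, hk ▸ hΘ.strictMono.monotone hμ⟩
    by_contra! hneg
    have hk_le : (k : ℝ) ≤ -1 := by exact_mod_cast Int.le_sub_one_of_lt hneg
    nlinarith [hΘ.pos μ, hβ.2, Real.pi_pos]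
  · rintro ⟨hk, hle⟩
    have hpos : 0 < β + k * Real.pi :=
      add_pos_of_pos_of_nonneg hβ.1 (mul_nonneg (Int.cast_nonneg hk) Real.pi_pos.le)
    obtain ⟨ν, hν⟩ := hΘ.exists_lt _ hpos
    have hν_le : ν ≤ lam := (hΘ.strictMono.lt_iff_lt.1 (hν.trans_le hle)).le
    obtain ⟨μ, hμ, hμk⟩ :=
      intermediate_value_Icc hν_le hΘ.continuous.continuousOn ⟨hν.le, hle⟩
    exact ⟨μ, hμ.2, hμk⟩

theorem exists_mem_Iio_eq_iff (hΘ : IsCountingAngle Θ) (hβ : β ∈ Ioc 0 Real.pi) (k : ℤ) :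
    (∃ μ ∈ Iio lam, Θ μ = β + k * Real.pi) ↔ 0 ≤ k ∧ β + k * Real.pi < Θ lam := by
  constructor
  · rintro ⟨μ, hμ, hk⟩
    exact ⟨((hΘ.exists_mem_Iic_eq_iff hβ k).1 ⟨μ, mem_Iic.2 (le_of_lt hμ), hk⟩).1,
      hk ▸ hΘ.strictMono hμ⟩
  · rintro ⟨hk, hlt⟩
    obtain ⟨μ, -, hμ⟩ := (hΘ.exists_mem_Iic_eq_iff hβ k).2 ⟨hk, hlt.le⟩
    exact ⟨μ, hΘ.strictMono.lt_iff_lt.1 (hμ ▸ hlt), hμ⟩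

theorem finite_angleHits_Iic_and_ncard (hΘ : IsCountingAngle Θ) (hβ : β ∈ Ioc 0 Real.pi) :
    (angleHits Θ β (Iic lam)).Finite ∧
      ((angleHits Θ β (Iic lam)).ncard : ℤ) = ⌊(Θ lam - β) / Real.pi⌋ + 1 := by
  obtain ⟨hfin, hcard⟩ := finite_angleHits_and_ncard_eq (T := Iic lam) (β := β)
    (J := Finset.Ico 0 (⌊(Θ lam - β) / Real.pi⌋ + 1)) hΘ.strictMono.injective fun k => by
      rw [hΘ.exists_mem_Iic_eq_iff hβ, Finset.mem_Ico, Int.lt_add_one_iff, Int.le_floor,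
        le_div_iff₀ Real.pi_pos, le_sub_iff_add_le, add_comm β]
  have hfloor : -1 ≤ ⌊(Θ lam - β) / Real.pi⌋ := by
    rw [Int.le_floor, le_div_iff₀ Real.pi_pos]
    push_cast
    linarith [hΘ.pos lam, hβ.2]
  exact ⟨hfin, by rw [hcard, Int.card_Ico, sub_zero, Int.toNat_of_nonneg (by linarith)]⟩

theorem finite_angleHits_Iio_and_ncard (hΘ : IsCountingAngle Θ) (hβ : β ∈ Ioc 0 Real.pi) :
    (angleHits Θ β (Iio lam)).Finite ∧
      ((angleHits Θ β (Iio lam)).ncard : ℤ) = ⌈(Θ lam - β) / Real.pi⌉ := by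
  obtain ⟨hfin, hcard⟩ := finite_angleHits_and_ncard_eq (T := Iio lam) (β := β)
    (J := Finset.Ico 0 ⌈(Θ lam - β) / Real.pi⌉) hΘ.strictMono.injective fun k => by
      rw [hΘ.exists_mem_Iio_eq_iff hβ, Finset.mem_Ico, Int.lt_ceil, lt_div_iff₀ Real.pi_pos,
        lt_sub_iff_add_lt, add_comm β]
  have hceil : -1 < ⌈(Θ lam - β) / Real.pi⌉ := by
    rw [Int.lt_ceil, lt_div_iff₀ Real.pi_pos]
    push_cast
    linarith [hΘ.pos lam, hβ.2]
  exact ⟨hfin, by rw [hcard, Int.card_Ico, sub_zero, Int.toNat_of_nonneg (by linarith)]⟩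

end IsCountingAngle

end Counting

/-! ### Solutions and their Wronskians -/

section

variable {a b : ℝ} {p q r : ℝ → ℝ}

namespace TauEq

section NormedSpace

variable {E F : Type*} [NormedAddCommGroup E] [NormedSpace ℝ E] [NormedAddCommGroup F]
  [NormedSpace ℝ F] {u w g : ℝ → E}

theorem isPrimitive_u (h : TauEq a b p q r u w g) : IsPrimitive a b u (fun x => (p x)⁻¹ • w x) :=
  ⟨h.ac_u, h.deriv_u⟩

theorem isPrimitive_w (h : TauEq a b p q r u w g) :
    IsPrimitive a b w (fun x => q x • u x - r x • g x) :=
  ⟨h.ac_w, h.deriv_w⟩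

theorem of_isPrimitive (hu : IsPrimitive a b u (fun x => (p x)⁻¹ • w x))
    (hw : IsPrimitive a b w (fun x => q x • u x - r x • g x)) : TauEq a b p q r u w g :=
  ⟨hu.ac, hw.ac, hu.hasDerivAt, hw.hasDerivAt⟩

theorem congr_right {g' : ℝ → E} (h : TauEq a b p q r u w g)
    (hg : ∀ᵐ x ∂(volume.restrict (Ioo a b)), g x = g' x) : TauEq a b p q r u w g' :=
  .of_isPrimitive h.isPrimitive_u <| h.isPrimitive_w.congr_deriv <| by
    filter_upwards [hg] with x hx
    rw [hx]

theorem clm_apply (L : E →L[ℝ] F) (h : TauEq a b p q r u w g) :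
    TauEq a b p q r (fun x => L (u x)) (fun x => L (w x)) (fun x => L (g x)) :=
  .of_isPrimitive (by simpa using h.isPrimitive_u.clm_apply L)
    (by simpa using h.isPrimitive_w.clm_apply L)

end NormedSpace

theorem ofReal {u w : ℝ → ℝ} {z : ℝ} (h : TauEq a b p q r u w (fun x => z * u x)) :
    TauEq a b p q r (fun x => (u x : ℂ)) (fun x => (w x : ℂ)) (fun x => (z : ℂ) * (u x : ℂ)) := by
  simpa using h.clm_apply Complex.ofRealCLM

end TauEq

theorem BoundaryCond.clm_apply {E F : Type*} [NormedAddCommGroup E] [NormedSpace ℝ E]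
    [NormedAddCommGroup F] [NormedSpace ℝ F] (L : E →L[ℝ] F) {c γ : ℝ} {u w : ℝ → E}
    (h : BoundaryCond c γ u w) : BoundaryCond c γ (fun x => L (u x)) (fun x => L (w x)) := by
  rw [BoundaryCond] at *
  rw [← map_smul, ← map_smul, ← map_sub, h, map_zero]

theorem boundaryCond_ofReal {c γ : ℝ} {u w : ℝ → ℝ} :
    BoundaryCond c γ (fun x => (u x : ℂ)) (fun x => (w x : ℂ)) ↔ BoundaryCond c γ u w := by
  simp only [BoundaryCond, Complex.real_smul, smul_eq_mul]
  norm_cast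

section Wronskian

variable {𝕜 : Type*} [RCLike 𝕜] {u w g u₁ w₁ g₁ u₂ w₂ : ℝ → 𝕜} {z : 𝕜}

/-- The Wronskian `u₁ (p u₂') - (p u₁') u₂`, where `wᵢ = p uᵢ'`. -/
def wronskian (u₁ w₁ u₂ w₂ : ℝ → 𝕜) (x : ℝ) : 𝕜 :=
  u₁ x * w₂ x - w₁ x * u₂ x

theorem TauEq.isPrimitive_wronskian (h : TauEq a b p q r u w g)
    (h₁ : TauEq a b p q r u₁ w₁ g₁) :
    IsPrimitive a b (wronskian u w u₁ w₁) (fun x => (r x : 𝕜) * (g x * u₁ x - u x * g₁ x)) := by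
  refine ((h.isPrimitive_u.mul h₁.isPrimitive_w).sub
    (h.isPrimitive_w.mul h₁.isPrimitive_u)).congr_deriv (.of_forall fun x => ?_)
  simp only [RCLike.real_smul_eq_coe_mul]
  ring

theorem TauEq.wronskian_eq_left (hab : a ≤ b) (h : TauEq a b p q r u w (fun x => z * u x))
    (h₁ : TauEq a b p q r u₁ w₁ (fun x => z * u₁ x)) {x : ℝ} (hx : x ∈ Icc a b) :
    wronskian u w u₁ w₁ x = wronskian u w u₁ w₁ a :=
  (h.isPrimitive_wronskian h₁).eq_left_of_ae_eq_zero hab (.of_forall fun x => by ring) x hx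

theorem BoundaryCond.wronskian_eq_zero {c γ : ℝ} (h : BoundaryCond c γ u w)
    (h₁ : BoundaryCond c γ u₁ w₁) : wronskian u w u₁ w₁ c = 0 := by
  simp only [BoundaryCond, RCLike.real_smul_eq_coe_mul] at h h₁
  have hγ : (Real.cos γ : 𝕜) ^ 2 + (Real.sin γ : 𝕜) ^ 2 = 1 := mod_cast Real.cos_sq_add_sin_sq γ
  rw [wronskian]
  linear_combination (-(u c * w₁ c - w c * u₁ c)) * hγ +
    ((Real.cos γ : 𝕜) * w₁ c + (Real.sin γ : 𝕜) * u₁ c) * h -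
    ((Real.sin γ : 𝕜) * u c + (Real.cos γ : 𝕜) * w c) * h₁

theorem TauEq.eq_zero_of_wronskian_eq_zero (hab : a ≤ b)
    (h : TauEq a b p q r u w (fun x => z * u x)) (h₁ : TauEq a b p q r u₁ w₁ (fun x => z * u₁ x))
    (h₂ : TauEq a b p q r u₂ w₂ (fun x => z * u₂ x)) (hne : wronskian u₁ w₁ u₂ w₂ a ≠ 0)
    (hW₁ : wronskian u w u₁ w₁ a = 0) (hW₂ : wronskian u w u₂ w₂ a = 0) {x : ℝ}
    (hx : x ∈ Icc a b) : u x = 0 ∧ w x = 0 := by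
  rw [← h₁.wronskian_eq_left hab h₂ hx] at hne
  rw [← h.wronskian_eq_left hab h₁ hx] at hW₁
  rw [← h.wronskian_eq_left hab h₂ hx] at hW₂
  rw [wronskian] at hne hW₁ hW₂
  exact ⟨(mul_eq_zero.1 (by linear_combination u₁ x * hW₂ - u₂ x * hW₁ :
      u x * (u₁ x * w₂ x - w₁ x * u₂ x) = 0)).resolve_right hne,
    (mul_eq_zero.1 (by linear_combination w₁ x * hW₂ - w₂ x * hW₁ :
      w x * (u₁ x * w₂ x - w₁ x * u₂ x) = 0)).resolve_right hne⟩

end Wronskian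

/-! ### Prüfer angles of solutions -/

/-- The radius solves `ρ' = (1 / p - (μ r - q)) sin θ cos θ ρ`, a linear equation. -/
theorem IsPruferSolution.exists_tauEq (hab : a ≤ b) (hreg : IsRegular a b p q r) {μ : ℝ}
    {θ : ℝ → ℝ} (h : IsPruferSolution a b p q r μ θ) :
    ∃ u w : ℝ → ℝ, TauEq a b p q r u w (fun x => μ * u x) ∧ IsPruferAngle a b u w θ ∧
      u a = Real.sin (θ a) ∧ w a = Real.cos (θ a) := by
  have hcont := IsPrimitive.continuousOn h hab
  have hint : IntegrableOn (fun x => ((p x)⁻¹ - (μ * r x - q x)) *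
      (Real.sin (θ x) * Real.cos (θ x))) (Ioo a b) :=
    integrableOn_mul_continuousOn (hreg.integrable_inv_p.sub (hreg.integrable_potential μ))
      ((Real.continuous_sin.comp_continuousOn hcont).mul
        (Real.continuous_cos.comp_continuousOn hcont))
  have hρ := (IsPrimitive.integral hab hint).comp Real.contDiff_exp Real.hasDerivAt_exp
  have hsin := IsPrimitive.comp Real.contDiff_sin Real.hasDerivAt_sin h
  have hcos := IsPrimitive.comp Real.contDiff_cos Real.hasDerivAt_cos h
  refine ⟨_, _, .of_isPrimitive ((hρ.mul hsin).congr_deriv (.of_forall fun x => ?_))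
    ((hρ.mul hcos).congr_deriv (.of_forall fun x => ?_)),
    ⟨hcont, _, fun x _ => ⟨Real.exp_pos _, rfl, rfl⟩⟩, by simp, by simp⟩ <;>
  generalize (∫ t in a..x, _ : ℝ) = s <;>
  simp only [pruferField, smul_eq_mul]
  · linear_combination (p x)⁻¹ * Real.exp s * Real.cos (θ x) * Real.sin_sq_add_cos_sq (θ x)
  · linear_combination (-(μ * r x - q x)) * Real.exp s * Real.sin (θ x) *
      Real.sin_sq_add_cos_sq (θ x)

theorem exists_tauEq_of_left (hab : a ≤ b) (hreg : IsRegular a b p q r) (μ γ : ℝ) :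
    ∃ u w : ℝ → ℝ, TauEq a b p q r u w (fun x => μ * u x) ∧
      u a = Real.sin γ ∧ w a = Real.cos γ := by
  obtain ⟨θ, rfl, hθ⟩ := exists_isPruferSolution hab hreg μ γ
  obtain ⟨u, w, h, -, hua, hwa⟩ := hθ.exists_tauEq hab hreg
  exact ⟨u, w, h, hua, hwa⟩

theorem TauEq.eq_zero_of_left (hab : a ≤ b) (hreg : IsRegular a b p q r) {μ : ℝ} {u w : ℝ → ℂ}
    (h : TauEq a b p q r u w (fun x => (μ : ℂ) * u x)) (hua : u a = 0) (hwa : w a = 0) {x : ℝ}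
    (hx : x ∈ Icc a b) : u x = 0 ∧ w x = 0 := by
  obtain ⟨u₁, w₁, h₁, hu₁, hw₁⟩ := exists_tauEq_of_left hab hreg μ 0
  obtain ⟨u₂, w₂, h₂, hu₂, -⟩ := exists_tauEq_of_left hab hreg μ (Real.pi / 2)
  refine h.eq_zero_of_wronskian_eq_zero hab h₁.ofReal h₂.ofReal ?_ ?_ ?_ hx
  · simp [wronskian, hu₁, hw₁, hu₂]
  · simp [wronskian, hua, hwa]
  · simp [wronskian, hua, hwa]

theorem TauEq.exists_eq_const_mul (hab : a ≤ b) (hreg : IsRegular a b p q r) {μ α : ℝ}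
    {ψ ψ' : ℝ → ℝ} (hψ : TauEq a b p q r ψ ψ' (fun x => μ * ψ x)) (hψa : ψ a = Real.sin α)
    (hψa' : ψ' a = Real.cos α) {u w : ℝ → ℂ} (hu : TauEq a b p q r u w (fun x => (μ : ℂ) * u x))
    (hua : BoundaryCond a α u w) : ∃ c : ℂ, ∀ x ∈ Icc a b, u x = c * ψ x ∧ w x = c * ψ' x := by
  set c : ℂ := Real.sin α * u a + Real.cos α * w a with hc
  have hdiff : TauEq a b p q r (u + (-c) • fun x => (ψ x : ℂ)) (w + (-c) • fun x => (ψ' x : ℂ))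
      (fun x => (μ : ℂ) * (u + (-c) • fun x => (ψ x : ℂ)) x) :=
    (hu.add (hψ.ofReal.const_smul (-c))).congr_right <| .of_forall fun x => by
      simp only [Pi.add_apply, Pi.smul_apply, smul_eq_mul]
      ring
  have hα : (Real.sin α : ℂ) ^ 2 + (Real.cos α : ℂ) ^ 2 = 1 := mod_cast Real.sin_sq_add_cos_sq α
  simp only [BoundaryCond, Complex.real_smul] at hua
  refine ⟨c, fun x hx => ?_⟩
  have hzero := hdiff.eq_zero_of_left hab hreg ?_ ?_ hx
  · simpa [← sub_eq_add_neg, sub_eq_zero] using hzero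
  · simp only [Pi.add_apply, Pi.smul_apply, smul_eq_mul, hψa]
    linear_combination (-u a) * hα + (Real.cos α : ℂ) * hua - (Real.sin α : ℂ) * hc
  · simp only [Pi.add_apply, Pi.smul_apply, smul_eq_mul, hψa']
    linear_combination (-w a) * hα - (Real.sin α : ℂ) * hua - (Real.cos α : ℂ) * hc

theorem IsPruferAngle.boundaryCond_iff {u w θ : ℝ → ℝ} (h : IsPruferAngle a b u w θ) {c γ : ℝ}
    (hc : c ∈ Icc a b) : BoundaryCond c γ u w ↔ ∃ k : ℤ, θ c = γ + k * Real.pi := by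
  obtain ⟨-, ρ, hρ⟩ := h
  obtain ⟨hpos, hu, hw⟩ := hρ c hc
  have hsin : Real.cos γ • u c - Real.sin γ • w c = ρ c * Real.sin (θ c - γ) := by
    rw [hu, hw, Real.sin_sub, smul_eq_mul, smul_eq_mul]
    ring
  rw [BoundaryCond, hsin, mul_eq_zero, or_iff_right hpos.ne', Real.sin_eq_zero_iff]
  exact exists_congr fun k => ⟨fun h => by linarith, fun h => by linarith⟩

theorem IsPruferAngle.wronskian_eq_zero_iff {u w θ u₁ w₁ θ₁ : ℝ → ℝ}
    (h : IsPruferAngle a b u w θ) (h₁ : IsPruferAngle a b u₁ w₁ θ₁) {x : ℝ} (hx : x ∈ Icc a b) :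
    wronskian u w u₁ w₁ x = 0 ↔ Real.sin (θ x - θ₁ x) = 0 := by
  obtain ⟨-, ρ, hρ⟩ := h
  obtain ⟨-, ρ₁, hρ₁⟩ := h₁
  obtain ⟨hpos, hu, hw⟩ := hρ x hx
  obtain ⟨hpos₁, hu₁, hw₁⟩ := hρ₁ x hx
  have hsin : wronskian u w u₁ w₁ x = ρ x * ρ₁ x * Real.sin (θ x - θ₁ x) := by
    rw [wronskian, hu, hw, hu₁, hw₁, Real.sin_sub]
    ring
  rw [hsin, mul_eq_zero, or_iff_right (mul_pos hpos hpos₁).ne']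

theorem exists_mem_Ioo_of_sin_ne_zero_on {δ : ℝ → ℝ}
    (hδ : ContinuousOn δ (Icc a b)) (h : ∀ x ∈ Icc a b, Real.sin (δ x) ≠ 0) :
    ∃ j : ℤ, ∀ x ∈ Icc a b, δ x ∈ Ioo (j * Real.pi) ((j + 1) * Real.pi) := by
  refine ⟨⌊δ a / Real.pi⌋, fun x hx => ?_⟩
  have hfloor := Int.floor_le (δ a / Real.pi)
  have hlt := Int.lt_floor_add_one (δ a / Real.pi)
  rw [le_div_iff₀ Real.pi_pos] at hfloor
  rw [div_lt_iff₀ Real.pi_pos] at hlt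
  have hsub : Icc a x ⊆ Icc a b := Icc_subset_Icc_right hx.2
  constructor
  · by_contra! hle
    obtain ⟨y, hy, hδy⟩ := intermediate_value_Icc' hx.1 (hδ.mono hsub) ⟨hle, hfloor⟩
    exact h y (hsub hy) (hδy ▸ Real.sin_int_mul_pi _)
  · by_contra! hle
    obtain ⟨y, hy, hδy⟩ := intermediate_value_Icc hx.1 (hδ.mono hsub) ⟨hlt.le, hle⟩
    exact h y (hsub hy) (hδy ▸ mod_cast Real.sin_int_mul_pi (⌊δ a / Real.pi⌋ + 1))

theorem eq_of_sin_eq_zero_on (hab : a ≤ b) {δ : ℝ → ℝ} (hδ : ContinuousOn δ (Icc a b))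
    (h : ∀ x ∈ Icc a b, Real.sin (δ x) = 0) : δ a = δ b := by
  have hcos : ∀ x ∈ Icc a b, Real.sin (δ x + Real.pi / 2) ≠ 0 := fun x hx hzero => by
    have hsq := Real.sin_sq_add_cos_sq (δ x)
    rw [h x hx, ← Real.sin_add_pi_div_two, hzero] at hsq
    norm_num at hsq
  obtain ⟨j, hj⟩ := exists_mem_Ioo_of_sin_ne_zero_on (δ := fun x => δ x + Real.pi / 2)
    (hδ.add continuousOn_const) hcos
  have hconst : ∀ x ∈ Icc a b, δ x = j * Real.pi := fun x hx => by
    obtain ⟨k, hk⟩ := Real.sin_eq_zero_iff.1 (h x hx)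
    obtain ⟨hlt, hgt⟩ := hj x hx
    rw [← hk] at hlt hgt ⊢
    have hjk : (j : ℝ) < k + 1 := lt_of_mul_lt_mul_right (by linarith) Real.pi_pos.le
    have hkj : (k : ℝ) < j + 1 := lt_of_mul_lt_mul_right (by linarith) Real.pi_pos.le
    have : k = j := by
      norm_cast at hjk hkj
      omega
    rw [this]
  rw [hconst a (left_mem_Icc.2 hab), hconst b (right_mem_Icc.2 hab)]

/-- The Wronskian is constant, so the difference of two Prüfer angles either is a constant multiple
of `π` or avoids the multiples of `π` altogether. -/
theorem IsPruferAngle.sub_eq_or_exists_mem_Ioo (hab : a ≤ b) {z : ℝ} {u w θ u₁ w₁ θ₁ : ℝ → ℝ}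
    (hu : TauEq a b p q r u w (fun x => z * u x))
    (hu₁ : TauEq a b p q r u₁ w₁ (fun x => z * u₁ x)) (hθ : IsPruferAngle a b u w θ)
    (hθ₁ : IsPruferAngle a b u₁ w₁ θ₁) :
    θ a - θ₁ a = θ b - θ₁ b ∨
      Real.sin (θ a - θ₁ a) ≠ 0 ∧ ∃ j : ℤ, ∀ x ∈ Icc a b,
        θ x - θ₁ x ∈ Ioo (j * Real.pi) ((j + 1) * Real.pi) := by
  have hδ : ContinuousOn (fun x => θ x - θ₁ x) (Icc a b) := hθ.1.sub hθ₁.1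
  have hsin : ∀ x ∈ Icc a b, Real.sin (θ x - θ₁ x) = 0 ↔ Real.sin (θ a - θ₁ a) = 0 :=
    fun x hx => by
      rw [← hθ.wronskian_eq_zero_iff hθ₁ hx, hu.wronskian_eq_left hab hu₁ hx,
        hθ.wronskian_eq_zero_iff hθ₁ (left_mem_Icc.2 hab)]
  by_cases ha : Real.sin (θ a - θ₁ a) = 0
  · exact .inl (eq_of_sin_eq_zero_on hab hδ fun x hx => (hsin x hx).2 ha)
  · exact .inr ⟨ha, exists_mem_Ioo_of_sin_ne_zero_on hδ fun x hx => mt (hsin x hx).1 ha⟩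

theorem floor_and_ceil_eq_of_mem_Ioo {x y : ℝ} {n : ℤ} (hx : x ∈ Ioo (n : ℝ) (n + 1))
    (hy : y ∈ Ioo (n : ℝ) (n + 1)) : ⌊x⌋ = ⌊y⌋ ∧ ⌈x⌉ = ⌈y⌉ := by
  have hfloor : ∀ {t : ℝ}, t ∈ Ioo (n : ℝ) (n + 1) → ⌊t⌋ = n := fun ht =>
    Int.floor_eq_iff.2 ⟨ht.1.le, ht.2⟩
  have hceil : ∀ {t : ℝ}, t ∈ Ioo (n : ℝ) (n + 1) → ⌈t⌉ = n + 1 := fun ht =>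
    Int.ceil_eq_iff.2 ⟨by push_cast; linarith [ht.1], mod_cast ht.2.le⟩
  exact ⟨(hfloor hx).trans (hfloor hy).symm, (hceil hx).trans (hceil hy).symm⟩

theorem IsPruferAngle.floor_and_ceil_eq (hab : a ≤ b) (hreg : IsRegular a b p q r) {μ α β : ℝ}
    {θ₀ : ℝ → ℝ} (h₀ : IsPruferSolution a b p q r μ θ₀) (h₀a : θ₀ a = α) {u w θ : ℝ → ℝ}
    (hu : TauEq a b p q r u w (fun x => μ * u x)) (hθ : IsPruferAngle a b u w θ)
    (hbc : BoundaryCond a α u w ∨ BoundaryCond b β u w) :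
    ⌊(θ b - θ a - (β - α)) / Real.pi⌋ = ⌊(θ₀ b - β) / Real.pi⌋ ∧
      ⌈(θ b - θ a - (β - α)) / Real.pi⌉ = ⌈(θ₀ b - β) / Real.pi⌉ := by
  have ha := left_mem_Icc.2 hab
  have hb := right_mem_Icc.2 hab
  obtain ⟨u₀, w₀, hu₀, hθ₀, -, -⟩ := h₀.exists_tauEq hab hreg
  rcases hθ.sub_eq_or_exists_mem_Ioo hab hu hu₀ hθ₀ with heq | ⟨hsin, j, hj⟩
  · rw [show θ b - θ a - (β - α) = θ₀ b - β by linarith]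
    exact ⟨rfl, rfl⟩
  · have hnot : ¬ BoundaryCond a α u w := fun h => by
      obtain ⟨k, hk⟩ := (hθ.boundaryCond_iff ha).1 h
      exact hsin (by rw [hk, h₀a, add_sub_cancel_left, Real.sin_int_mul_pi])
    obtain ⟨m, hm⟩ := (hθ.boundaryCond_iff hb).1 (hbc.resolve_left hnot)
    obtain ⟨hja, hja'⟩ := hj a ha
    obtain ⟨hjb, hjb'⟩ := hj b hb
    refine floor_and_ceil_eq_of_mem_Ioo (n := m - j - 1) ⟨?_, ?_⟩ ⟨?_, ?_⟩ <;>
    first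
    | rw [lt_div_iff₀ Real.pi_pos]; push_cast; linarith
    | rw [div_lt_iff₀ Real.pi_pos]; push_cast; linarith

end

end SturmLiouville

namespace ProjValuedMeasure

variable {𝓗 : Type*} [NormedAddCommGroup 𝓗] [InnerProductSpace ℂ 𝓗] [CompleteSpace 𝓗]

section Basic

variable (E : ProjValuedMeasure 𝓗) {s t : Set ℝ}

theorem proj_proj (hs : MeasurableSet s) (ht : MeasurableSet t) (x : 𝓗) :
    E.proj s (E.proj t x) = E.proj (s ∩ t) x := by
  rw [E.proj_inter s t hs ht]
  rfl

theorem inner_proj_left (hs : MeasurableSet s) (x y : 𝓗) :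
    inner ℂ (E.proj s x) y = inner ℂ x (E.proj s y) := by
  have h := ContinuousLinearMap.adjoint_inner_left (E.proj s) y x
  rwa [← ContinuousLinearMap.star_eq_adjoint,
    (E.isStarProjection s hs).isSelfAdjoint.star_eq] at h

theorem inner_proj_compl (hs : MeasurableSet s) (x y : 𝓗) :
    inner ℂ (E.proj s x) (E.proj sᶜ y) = 0 := by
  rw [E.inner_proj_left hs, E.proj_proj hs hs.compl, inter_compl_self, E.proj_empty,
    zero_apply, inner_zero_right]

theorem scalarMeasure_apply (x : 𝓗) (hs : MeasurableSet s) :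
    E.scalarMeasure x s = ENNReal.ofReal (‖E.proj s x‖ ^ 2) :=
  Measure.ofMeasurable_apply s hs

theorem scalarMeasure_univ (x : 𝓗) : E.scalarMeasure x Set.univ = ENNReal.ofReal (‖x‖ ^ 2) := by
  rw [E.scalarMeasure_apply _ MeasurableSet.univ, E.proj_univ]
  rfl

instance isFiniteMeasure_scalarMeasure (x : 𝓗) : IsFiniteMeasure (E.scalarMeasure x) :=
  ⟨by rw [E.scalarMeasure_univ]; exact ENNReal.ofReal_lt_top⟩

theorem measureReal_scalarMeasure (x : 𝓗) (hs : MeasurableSet s) :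
    (E.scalarMeasure x).real s = ‖E.proj s x‖ ^ 2 := by
  rw [measureReal_def, E.scalarMeasure_apply x hs, ENNReal.toReal_ofReal (by positivity)]

theorem scalarMeasure_eq_zero_iff (x : 𝓗) (hs : MeasurableSet s) :
    E.scalarMeasure x s = 0 ↔ E.proj s x = 0 := by
  rw [E.scalarMeasure_apply x hs, ENNReal.ofReal_eq_zero, sq_nonpos_iff, norm_eq_zero]

theorem proj_add_compl (hs : MeasurableSet s) (x : 𝓗) : E.proj s x + E.proj sᶜ x = x := by
  set y := x - (E.proj s x + E.proj sᶜ x) with hy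
  have hys : E.proj s y = 0 := by
    rw [hy, map_sub, map_add, E.proj_proj hs hs, E.proj_proj hs hs.compl, inter_self,
      inter_compl_self, E.proj_empty, zero_apply, add_zero, sub_self]
  have hysc : E.proj sᶜ y = 0 := by
    rw [hy, map_sub, map_add, E.proj_proj hs.compl hs, E.proj_proj hs.compl hs.compl, inter_self,
      compl_inter_self, E.proj_empty, zero_apply, zero_add, sub_self]
  have hy_univ : E.scalarMeasure y Set.univ = 0 := by
    rw [← measure_add_measure_compl hs, (E.scalarMeasure_eq_zero_iff y hs).2 hys,
      (E.scalarMeasure_eq_zero_iff y hs.compl).2 hysc, add_zero]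
  have hy0 : y = 0 := by
    rwa [E.scalarMeasure_eq_zero_iff y .univ, E.proj_univ, one_apply_eq_self] at hy_univ
  exact (sub_eq_zero.1 hy0).symm

theorem norm_sq_proj_add_smul_proj_compl (hs : MeasurableSet s) {c : ℂ} (hc : ‖c‖ = 1) (x : 𝓗) :
    ‖E.proj s x + c • E.proj sᶜ x‖ ^ 2 = ‖x‖ ^ 2 := by
  have pythagoras : ∀ {c : ℂ}, ‖c‖ = 1 → ‖E.proj s x + c • E.proj sᶜ x‖ ^ 2 =
      ‖E.proj s x‖ ^ 2 + ‖E.proj sᶜ x‖ ^ 2 := by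
    intro c hc
    rw [sq, sq, sq, norm_add_sq_eq_norm_sq_add_norm_sq_of_inner_eq_zero (𝕜 := ℂ) _ _
      (by rw [inner_smul_right, E.inner_proj_compl hs, mul_zero]), norm_smul, hc, one_mul]
  rw [pythagoras hc, ← pythagoras (c := 1) norm_one, one_smul, E.proj_add_compl hs]

theorem scalarMeasure_proj_add_smul_proj_compl (hs : MeasurableSet s) {c : ℂ} (hc : ‖c‖ = 1)
    (x : 𝓗) : E.scalarMeasure (E.proj s x + c • E.proj sᶜ x) = E.scalarMeasure x := by
  ext t ht
  rw [E.scalarMeasure_apply _ ht, E.scalarMeasure_apply _ ht, map_add, map_smul,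
    E.proj_proj ht hs, E.proj_proj ht hs.compl, inter_comm t, inter_comm t, ← E.proj_proj hs ht,
    ← E.proj_proj hs.compl ht, E.norm_sq_proj_add_smul_proj_compl hs hc]

theorem scalarMeasure_proj (hs : MeasurableSet s) (x : 𝓗) :
    E.scalarMeasure (E.proj s x) = (E.scalarMeasure x).restrict s := by
  ext t ht
  rw [E.scalarMeasure_apply _ ht, Measure.restrict_apply ht, E.scalarMeasure_apply _ (ht.inter hs),
    E.proj_proj ht hs]

end Basic

theorem eq_zero_of_forall_norm_eq_one_add_conj_mul_eq {A B Y Z : ℂ}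
    (h : ∀ c : ℂ, ‖c‖ = 1 → A + c * Y + (starRingEnd ℂ) c * Z = B) : Y = 0 := by
  have h_one := h 1 norm_one
  have h_neg := h (-1) (by simp)
  have h_I := h Complex.I Complex.norm_I
  simp only [map_one, map_neg, Complex.conj_I] at h_one h_neg h_I
  linear_combination (1 / 4 + Complex.I / 4) * h_one - (1 / 4 - Complex.I / 4) * h_neg -
    Complex.I / 2 * h_I + (Y / 2 - Z / 2) * Complex.I_mul_I

theorem integrable_id_of_integrable_sq {ν : Measure ℝ} [IsFiniteMeasure ν]
    (h : Integrable (fun t : ℝ => t ^ 2) ν) : Integrable (fun t : ℝ => t) ν :=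
  ((memLp_two_iff_integrable_sq (by fun_prop)).2 h).integrable one_le_two

namespace IsSpectralResolution

variable {E : ProjValuedMeasure 𝓗} {H : 𝓗 →ₗ.[ℂ] 𝓗} {s : Set ℝ}

theorem proj_mem_domain (hE : E.IsSpectralResolution H) (x : H.domain) (hs : MeasurableSet s) :
    E.proj s (x : 𝓗) ∈ H.domain := by
  rw [hE.mem_domain_iff, E.scalarMeasure_proj hs]
  exact ((hE.mem_domain_iff x).1 x.2).restrict

/-- For `|c| = 1` the vectors `x` and `E s x + c • E sᶜ x` have the same scalar measure, hence the
same quadratic form; varying `c` isolates the cross term. -/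
theorem inner_proj_apply_proj_compl (hE : E.IsSpectralResolution H) (x : H.domain)
    (hs : MeasurableSet s) :
    inner ℂ (E.proj s (x : 𝓗)) (H ⟨E.proj sᶜ x, hE.proj_mem_domain x hs.compl⟩) = 0 := by
  set y : H.domain := ⟨E.proj s x, hE.proj_mem_domain x hs⟩
  set z : H.domain := ⟨E.proj sᶜ x, hE.proj_mem_domain x hs.compl⟩
  refine eq_zero_of_forall_norm_eq_one_add_conj_mul_eq
    (A := inner ℂ (y : 𝓗) (H y) + inner ℂ (z : 𝓗) (H z)) (B := inner ℂ (x : 𝓗) (H x))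
    (Z := inner ℂ (z : 𝓗) (H y)) fun c hc => ?_
  have hform := hE.inner_apply (y + c • z)
  have hcoe : ((y + c • z : H.domain) : 𝓗) = E.proj s x + c • E.proj sᶜ x := rfl
  rw [hcoe, E.scalarMeasure_proj_add_smul_proj_compl hs hc, ← hE.inner_apply x, ← hcoe, H.map_add,
    H.map_smul, Submodule.coe_add, Submodule.coe_smul, inner_add_left, inner_add_right,
    inner_add_right, inner_smul_left, inner_smul_left, inner_smul_right, inner_smul_right] at hform
  have hconj : (starRingEnd ℂ) c * c = 1 := by
    rw [← Complex.normSq_eq_conj_mul_self, Complex.normSq_eq_norm_sq, hc, one_pow,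
      Complex.ofReal_one]
  rw [← hform]
  linear_combination (-inner ℂ (z : 𝓗) (H z)) * hconj

theorem inner_proj_apply (hE : E.IsSpectralResolution H) (x : H.domain) (hs : MeasurableSet s) :
    inner ℂ (E.proj s (x : 𝓗)) (H x) = ((∫ t in s, t ∂(E.scalarMeasure (x : 𝓗)) : ℝ) : ℂ) := by
  set y : H.domain := ⟨E.proj s x, hE.proj_mem_domain x hs⟩
  set z : H.domain := ⟨E.proj sᶜ x, hE.proj_mem_domain x hs.compl⟩
  have hyz : y + z = x := Subtype.ext (E.proj_add_compl hs x)
  calc inner ℂ (y : 𝓗) (H x) = inner ℂ (y : 𝓗) (H y) + inner ℂ (y : 𝓗) (H z) := by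
        rw [← inner_add_right, ← H.map_add, hyz]
    _ = inner ℂ (y : 𝓗) (H y) := by rw [hE.inner_proj_apply_proj_compl x hs, add_zero]
    _ = _ := by rw [hE.inner_apply y, E.scalarMeasure_proj hs]

theorem ae_eq_of_apply_eq_smul (hE : E.IsSpectralResolution H) {μ : ℝ} (x : H.domain)
    (hx : H x = (μ : ℂ) • (x : 𝓗)) : ∀ᵐ t ∂(E.scalarMeasure (x : 𝓗)), t = μ := by
  have hid := integrable_id_of_integrable_sq ((hE.mem_domain_iff x).1 x.2)
  have hzero : ∀ s, MeasurableSet s → ∫ t in s, (t - μ) ∂(E.scalarMeasure (x : 𝓗)) = 0 := by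
    intro s hs
    have hs_int : μ * ‖E.proj s (x : 𝓗)‖ ^ 2 = ∫ t in s, t ∂(E.scalarMeasure (x : 𝓗)) := by
      have h := hE.inner_proj_apply x hs
      rw [hx, inner_smul_right, E.inner_proj_left hs, E.inner_proj_self hs] at h
      exact_mod_cast h
    rw [integral_sub hid.integrableOn (integrable_const _), ← hs_int, setIntegral_const,
      E.measureReal_scalarMeasure _ hs, smul_eq_mul]
    ring
  have hae := ae_eq_zero_of_forall_setIntegral_eq_of_sigmaFinite (μ := E.scalarMeasure (x : 𝓗))
    (f := fun t => t - μ) (fun s _ _ => (hid.sub (integrable_const _)).integrableOn)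
    (fun s hs _ => hzero s hs)
  filter_upwards [hae] with t ht
  exact sub_eq_zero.1 ht

theorem proj_eigenvector_of_notMem (hE : E.IsSpectralResolution H) {μ : ℝ} (x : H.domain)
    (hx : H x = (μ : ℂ) • (x : 𝓗)) (hs : MeasurableSet s) (hμ : μ ∉ s) :
    E.proj s (x : 𝓗) = 0 :=
  (E.scalarMeasure_eq_zero_iff _ hs).1 <|
    measure_mono_null (fun t ht (htμ : t = μ) => hμ (htμ ▸ ht)) (hE.ae_eq_of_apply_eq_smul x hx)

theorem proj_eigenvector_of_mem (hE : E.IsSpectralResolution H) {μ : ℝ} (x : H.domain)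
    (hx : H x = (μ : ℂ) • (x : 𝓗)) (hs : MeasurableSet s) (hμ : μ ∈ s) :
    E.proj s (x : 𝓗) = x := by
  have h := E.proj_add_compl hs (x : 𝓗)
  rwa [hE.proj_eigenvector_of_notMem x hx hs.compl (by simpa using hμ), add_zero] at h

variable {ι : Type*} (e : HilbertBasis ι ℂ 𝓗) {m : ι → ℝ}

theorem range_proj_eq_span (hE : E.IsSpectralResolution H)
    (he : ∀ i, ∃ h : e i ∈ H.domain, H ⟨e i, h⟩ = (m i : ℂ) • e i)
    (hs : MeasurableSet s) (hfin : {i | m i ∈ s}.Finite) :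
    (E.proj s).range = Submodule.span ℂ (Set.range fun i : {i | m i ∈ s} => e (i : ι)) := by
  have hmem : ∀ i, m i ∈ s → E.proj s (e i) = e i := fun i hi =>
    hE.proj_eigenvector_of_mem ⟨e i, (he i).1⟩ (he i).2 hs hi
  refine le_antisymm ?_ (Submodule.span_le.2 ?_)
  · rintro _ ⟨x, rfl⟩
    have hexpand := (e.hasSum_repr x).mapL (E.proj s)
    have hfinite := hasSum_sum_of_ne_finset_zero (L := .unconditional _)
      (f := fun i => E.proj s (e.repr x i • e i)) (s := hfin.toFinset) fun i hi => by
        rw [map_smul, hE.proj_eigenvector_of_notMem ⟨e i, (he i).1⟩ (he i).2 hs (by simpa using hi),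
          smul_zero]
    change E.proj s x ∈ _
    rw [hexpand.unique hfinite]
    refine Submodule.sum_mem _ fun i hi => ?_
    have his : m i ∈ s := by simpa using hi
    rw [map_smul, hmem i his]
    exact Submodule.smul_mem _ _ (Submodule.subset_span ⟨⟨i, his⟩, rfl⟩)
  · rintro _ ⟨i, rfl⟩
    exact ⟨e i, hmem i i.2⟩

theorem finiteDimensional_and_finrank_range (hE : E.IsSpectralResolution H)
    (he : ∀ i, ∃ h : e i ∈ H.domain, H ⟨e i, h⟩ = (m i : ℂ) • e i)
    (hs : MeasurableSet s) (hfin : {i | m i ∈ s}.Finite) :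
    FiniteDimensional ℂ (E.proj s).range ∧
      Module.finrank ℂ (E.proj s).range = {i | m i ∈ s}.ncard := by
  have := hfin.fintype
  have hli : LinearIndependent ℂ (fun i : {i | m i ∈ s} => e (i : ι)) :=
    e.orthonormal.linearIndependent.comp _ Subtype.val_injective
  rw [hE.range_proj_eq_span e he hs hfin]
  refine ⟨FiniteDimensional.span_of_finite ℂ (Set.finite_range _), ?_⟩
  rw [finrank_span_eq_card hli, ← Nat.card_eq_fintype_card, Nat.card_coe_set_eq]

end IsSpectralResolution

variable {𝓗 : Type*} [NormedAddCommGroup 𝓗] [InnerProductSpace ℂ 𝓗] {ι : Type*}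

theorem hasSum_norm_sq_repr_mul (e : HilbertBasis ι ℂ 𝓗) {x y : 𝓗} {m : ι → ℝ}
    (h : ∀ i, e.repr y i = m i * e.repr x i) :
    HasSum (fun i => ((‖e.repr x i‖ ^ 2 * m i : ℝ) : ℂ)) (inner ℂ x y) := by
  refine (e.hasSum_inner_mul_inner x y).congr_fun fun i => ?_
  rw [← inner_conj_symm, ← e.repr_apply_apply, ← e.repr_apply_apply, h, Complex.ofReal_mul,
    Complex.ofReal_pow, ← Complex.conj_mul']
  ring

theorem hasSum_norm_sq_repr (e : HilbertBasis ι ℂ 𝓗) (x : 𝓗) :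
    HasSum (fun i => ‖e.repr x i‖ ^ 2) (‖x‖ ^ 2) := by
  have h := hasSum_norm_sq_repr_mul e (x := x) (y := x) (m := fun _ => 1) (by simp)
  rw [inner_self_eq_norm_sq_to_K] at h
  simp only [mul_one] at h
  exact Complex.hasSum_ofReal.1 (by rwa [Complex.ofReal_pow])

variable [CompleteSpace 𝓗] (e : HilbertBasis ι ℂ 𝓗) (m : ι → ℝ)

/-- The projection onto the closed span of the basis vectors `e i` with `m i ∈ s`, encoded as the
projection onto the orthogonal complement of the remaining ones. -/
def diagonalProj (s : Set ℝ) : 𝓗 →L[ℂ] 𝓗 :=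
  (Submodule.span ℂ (e '' {i | m i ∉ s}))ᗮ.starProjection

theorem diagonalProj_of_mem {s : Set ℝ} {i : ι} (hi : m i ∈ s) :
    diagonalProj e m s (e i) = e i := by
  rw [diagonalProj, Submodule.starProjection_eq_self_iff, Submodule.mem_orthogonal]
  intro u hu
  induction hu using Submodule.span_induction with
  | mem x hx =>
    obtain ⟨j, hj, rfl⟩ := hx
    exact e.orthonormal.inner_eq_zero fun h => hj (h ▸ hi)
  | zero => exact inner_zero_left _
  | add x y _ _ hx hy => rw [inner_add_left, hx, hy, add_zero]
  | smul c x _ hx => rw [inner_smul_left, hx, mul_zero]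

theorem diagonalProj_of_notMem {s : Set ℝ} {i : ι} (hi : m i ∉ s) :
    diagonalProj e m s (e i) = 0 := by
  rw [diagonalProj, Submodule.starProjection_apply_eq_zero_iff]
  exact Submodule.le_orthogonal_orthogonal _ (Submodule.subset_span ⟨i, hi, rfl⟩)

theorem hasSum_diagonalProj (s : Set ℝ) (x : 𝓗) :
    HasSum (({i | m i ∈ s} : Set ι).indicator fun i => e.repr x i • e i)
      (diagonalProj e m s x) := by
  convert (e.hasSum_repr x).mapL (diagonalProj e m s) using 2 with i
  by_cases hi : m i ∈ s
  · rw [indicator_of_mem (by exact hi), map_smul, diagonalProj_of_mem e m hi]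
  · rw [indicator_of_notMem (by exact hi), map_smul, diagonalProj_of_notMem e m hi, smul_zero]

theorem repr_diagonalProj (s : Set ℝ) (x : 𝓗) (i : ι) :
    e.repr (diagonalProj e m s x) i =
      ({i | m i ∈ s} : Set ι).indicator (fun i => e.repr x i) i := by
  have hself : inner ℂ (e i) (diagonalProj e m s x) = inner ℂ (diagonalProj e m s (e i)) x :=
    (Submodule.inner_starProjection_left_eq_right _ _ _).symm
  rw [e.repr_apply_apply, hself]
  by_cases hi : m i ∈ s
  · rw [indicator_of_mem (by exact hi), diagonalProj_of_mem e m hi, e.repr_apply_apply]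
  · rw [indicator_of_notMem (by exact hi), diagonalProj_of_notMem e m hi, inner_zero_left]

/-- The projection-valued measure of the diagonal operator with eigenvectors `e i` and eigenvalues
`m i`. -/
def diagonal : ProjValuedMeasure 𝓗 where
  proj := diagonalProj e m
  isStarProjection _ _ := isStarProjection_starProjection
  proj_empty := by
    ext x
    have h := hasSum_diagonalProj e m ∅ x
    simp only [mem_empty_iff_false, ofPred_false, indicator_empty] at h
    simpa using h.unique hasSum_zero
  proj_univ := by
    ext x
    have h := hasSum_diagonalProj e m Set.univ x
    simp only [mem_univ, ofPred_true, indicator_univ] at h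
    simpa using h.unique (e.hasSum_repr x)
  proj_inter s t _ _ := by
    ext x
    apply e.repr.injective
    ext i
    change _ = e.repr (diagonalProj e m s (diagonalProj e m t x)) i
    rw [repr_diagonalProj, repr_diagonalProj]
    by_cases hs : m i ∈ s <;> by_cases ht : m i ∈ t <;> simp [indicator, hs, ht, repr_diagonalProj]
  hasSum_proj f _ hd x := by
    have hdisj : ∀ i j, i ≠ j → Disjoint {k | m k ∈ f i} {k | m k ∈ f j} := fun i j hij =>
      Disjoint.preimage m (hd hij)
    have hUnion : {k | m k ∈ ⋃ n, f n} = ⋃ n, {k | m k ∈ f n} := preimage_iUnion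
    have hsum := hasSum_diagonalProj e m (⋃ n, f n) x
    rw [← hasSum_subtype_iff_indicator, hUnion,
      ← (Set.unionEqSigmaOfDisjoint hdisj).symm.hasSum_iff] at hsum
    refine hsum.sigma fun n => ?_
    have hsum_n := hasSum_diagonalProj e m (f n) x
    rwa [← hasSum_subtype_iff_indicator] at hsum_n

theorem scalarMeasure_diagonal (x : 𝓗) :
    (diagonal e m).scalarMeasure x =
      Measure.sum (fun i => ENNReal.ofReal (‖e.repr x i‖ ^ 2) • Measure.dirac (m i)) := by
  ext s hs
  rw [scalarMeasure_apply _ _ hs, Measure.sum_apply _ hs]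
  have h := hasSum_norm_sq_repr e (diagonalProj e m s x)
  change ENNReal.ofReal (‖diagonalProj e m s x‖ ^ 2) = _
  rw [← h.tsum_eq, ENNReal.ofReal_tsum_of_nonneg (fun _ => by positivity) h.summable]
  refine tsum_congr fun i => ?_
  rw [repr_diagonalProj, Measure.smul_apply, Measure.dirac_apply' _ hs]
  by_cases hi : m i ∈ s <;> simp [indicator, hi]

theorem integrable_sq_scalarMeasure_diagonal_iff [Countable ι] (x : 𝓗) :
    Integrable (fun t : ℝ => t ^ 2) ((diagonal e m).scalarMeasure x) ↔
      Summable fun i => m i ^ 2 * ‖e.repr x i‖ ^ 2 := by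
  rw [scalarMeasure_diagonal, integrable_sum_dirac_iff fun i => ENNReal.ofReal_ne_top]
  refine summable_congr fun i => ?_
  rw [ENNReal.toReal_ofReal (by positivity), Real.norm_of_nonneg (by positivity), mul_comm]

theorem isSpectralResolution_diagonal [Countable ι] {H : 𝓗 →ₗ.[ℂ] 𝓗}
    (hdom : ∀ x, x ∈ H.domain ↔ Summable fun i => m i ^ 2 * ‖e.repr x i‖ ^ 2)
    (hH : ∀ (x : H.domain) i, e.repr (H x) i = m i * e.repr (x : 𝓗) i) :
    (diagonal e m).IsSpectralResolution H where
  mem_domain_iff x := (hdom x).trans (integrable_sq_scalarMeasure_diagonal_iff e m x).symm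
  inner_apply x := by
    have hint : Integrable (fun t : ℝ => t) ((diagonal e m).scalarMeasure (x : 𝓗)) :=
      integrable_id_of_integrable_sq <|
        (integrable_sq_scalarMeasure_diagonal_iff e m _).2 ((hdom x).1 x.2)
    rw [scalarMeasure_diagonal] at hint ⊢
    have hsum := hasSum_integral_measure hint
    simp only [integral_smul_measure, integral_dirac, smul_eq_mul,
      ENNReal.toReal_ofReal (sq_nonneg _)] at hsum
    exact (hasSum_norm_sq_repr_mul e (hH x)).unique (Complex.hasSum_ofReal.2 hsum)

end ProjValuedMeasure

/-- `T` is the resolvent `(H - lam)⁻¹` of the unbounded operator `H` at the real point `lam`: it is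
a right inverse (`apply_self`) and a left inverse (`apply_sub`) of `H - lam`. -/
structure IsResolventAt {𝓗 : Type*} [NormedAddCommGroup 𝓗] [InnerProductSpace ℂ 𝓗]
    (H : 𝓗 →ₗ.[ℂ] 𝓗) (lam : ℝ) (T : 𝓗 →L[ℂ] 𝓗) : Prop where
  mem_domain : ∀ f, T f ∈ H.domain
  apply_self : ∀ f, H ⟨T f, mem_domain f⟩ = (lam : ℂ) • T f + f
  apply_sub : ∀ x : H.domain, T (H x - (lam : ℂ) • (x : 𝓗)) = x

namespace IsResolventAt

variable {𝓗 : Type*} [NormedAddCommGroup 𝓗] [InnerProductSpace ℂ 𝓗]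
  {H : 𝓗 →ₗ.[ℂ] 𝓗} {lam : ℝ} {T : 𝓗 →L[ℂ] 𝓗}

/-- A symmetric operator for which `H - lam` is bijective has a bounded resolvent at `lam`, by the
Hellinger–Toeplitz theorem. -/
theorem exists_of_isSymmetric [CompleteSpace 𝓗]
    (hsymm : ∀ x y : H.domain, inner ℂ (H x) (y : 𝓗) = inner ℂ (x : 𝓗) (H y))
    (hinj : ∀ x : H.domain, H x = (lam : ℂ) • (x : 𝓗) → x = 0)
    (hsurj : ∀ f : 𝓗, ∃ x : H.domain, H x = (lam : ℂ) • (x : 𝓗) + f) :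
    ∃ T : 𝓗 →L[ℂ] 𝓗, IsResolventAt H lam T ∧ T.IsSymmetric := by
  set L : H.domain →ₗ[ℂ] 𝓗 := H.toFun - (lam : ℂ) • H.domain.subtype
  have hL : ∀ x, L x = H x - (lam : ℂ) • (x : 𝓗) := fun _ => rfl
  have hLinj : Function.Injective L := (injective_iff_map_eq_zero L).2 fun x hx =>
    hinj x (sub_eq_zero.1 ((hL x).symm.trans hx))
  have hLsurj : Function.Surjective L := fun f => by
    obtain ⟨x, hx⟩ := hsurj f
    exact ⟨x, by rw [hL, hx, add_sub_cancel_left]⟩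
  set e := LinearEquiv.ofBijective L ⟨hLinj, hLsurj⟩
  have he : ∀ f, H (e.symm f) = (lam : ℂ) • (e.symm f : 𝓗) + f := fun f =>
    sub_eq_iff_eq_add'.1 (e.apply_symm_apply f)
  set T : 𝓗 →ₗ[ℂ] 𝓗 := H.domain.subtype.comp e.symm.toLinearMap
  have hT : T.IsSymmetric := fun f g => by
    have h := hsymm (e.symm f) (e.symm g)
    rw [he, he, inner_add_left, inner_add_right, inner_smul_left, inner_smul_right,
      Complex.conj_ofReal] at h
    exact (add_left_cancel h).symm
  exact ⟨⟨T, hT.continuous⟩, ⟨fun f => (e.symm f).2, he,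
    fun x => congrArg Subtype.val (e.symm_apply_apply x)⟩, hT⟩

theorem inner_apply_left (hT : IsResolventAt H lam T) (hsymm : T.IsSymmetric) (x y : H.domain) :
    inner ℂ (H x) (y : 𝓗) = inner ℂ (x : 𝓗) (H y) := by
  have h := hsymm (H x - (lam : ℂ) • (x : 𝓗)) (H y - (lam : ℂ) • (y : 𝓗))
  simp only [ContinuousLinearMap.coe_coe] at h
  rw [hT.apply_sub, hT.apply_sub, inner_sub_right, inner_sub_left, inner_smul_left,
    inner_smul_right, Complex.conj_ofReal] at h
  linear_combination -h

theorem inner_eq_zero (hT : IsResolventAt H lam T) (hsymm : T.IsSymmetric) {μ ν : ℝ}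
    (hμν : μ ≠ ν) (x y : H.domain) (hx : H x = (μ : ℂ) • (x : 𝓗))
    (hy : H y = (ν : ℂ) • (y : 𝓗)) : inner ℂ (x : 𝓗) (y : 𝓗) = 0 := by
  have h := hT.inner_apply_left hsymm x y
  rw [hx, hy, inner_smul_left, inner_smul_right, Complex.conj_ofReal] at h
  have hne : (μ : ℂ) - (ν : ℂ) ≠ 0 := sub_ne_zero.2 fun h => hμν (Complex.ofReal_injective h)
  exact (mul_eq_zero.1 (by rw [sub_mul, h, sub_self])).resolve_left hne

theorem eq_zero_of_apply_eq_zero (hT : IsResolventAt H lam T) {f : 𝓗} (hf : T f = 0) :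
    f = 0 := by
  have h := hT.apply_self f
  have hTf : (⟨T f, hT.mem_domain f⟩ : H.domain) = 0 := Subtype.ext hf
  rwa [hTf, H.map_zero, hf, smul_zero, zero_add, eq_comm] at h

theorem apply_eq_smul_of_resolvent_eq_smul (hT : IsResolventAt H lam T) {k : ℝ} (hk : k ≠ 0)
    {f : 𝓗} (hf : T f = (k : ℂ) • f) :
    ∃ h : f ∈ H.domain, H ⟨f, h⟩ = ((lam + k⁻¹ : ℝ) : ℂ) • f := by
  have hk' : (k : ℂ) ≠ 0 := Complex.ofReal_ne_zero.2 hk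
  have hdom : f ∈ H.domain := by
    have h := H.domain.smul_mem (k : ℂ)⁻¹ (hT.mem_domain f)
    rwa [hf, inv_smul_smul₀ hk'] at h
  refine ⟨hdom, ?_⟩
  have hH := hT.apply_self f
  have hTf : (⟨T f, hT.mem_domain f⟩ : H.domain) = (k : ℂ) • ⟨f, hdom⟩ := Subtype.ext hf
  rw [hTf, H.map_smul, hf, ← eq_inv_smul_iff₀ hk'] at hH
  rw [hH, smul_add, smul_comm, inv_smul_smul₀ hk', ← add_smul, Complex.ofReal_add,
    Complex.ofReal_inv]

variable {ι : Type*}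

theorem exists_hilbertBasis [CompleteSpace 𝓗] (hT : IsResolventAt H lam T) (hsymm : T.IsSymmetric)
    (hcomp : IsCompactOperator T) {m : ι → ℝ} (hm : Function.Injective m) (v : ι → 𝓗)
    (hnorm : ∀ i, ‖v i‖ = 1) (hv : ∀ i, ∃ h : v i ∈ H.domain, H ⟨v i, h⟩ = (m i : ℂ) • v i)
    (hspan : ∀ (μ : ℝ) (x : H.domain), H x = (μ : ℂ) • (x : 𝓗) →
      (x : 𝓗) ∈ Submodule.span ℂ (Set.range v)) :
    ∃ e : HilbertBasis ι ℂ 𝓗, ∀ i, e i = v i := by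
  have hortho : Orthonormal ℂ v := ⟨hnorm, fun i j hij =>
    hT.inner_eq_zero hsymm (hm.ne hij) ⟨v i, (hv i).1⟩ ⟨v j, (hv j).1⟩ (hv i).2 (hv j).2⟩
  have hle : ⨆ κ, Module.End.eigenspace (T : Module.End ℂ 𝓗) κ ≤
      Submodule.span ℂ (Set.range v) := by
    refine iSup_le fun κ f hf => ?_
    obtain rfl | hf0 := eq_or_ne f 0
    · exact zero_mem _
    obtain ⟨k, rfl⟩ := Complex.conj_eq_iff_real.1 <|
      hsymm.conj_eigenvalue_eq_self (Module.End.hasEigenvalue_of_hasEigenvector ⟨hf, hf0⟩)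
    have hTf : T f = (k : ℂ) • f := Module.End.mem_eigenspace_iff.1 hf
    have hk : k ≠ 0 := by
      rintro rfl
      exact hf0 (hT.eq_zero_of_apply_eq_zero (by rw [hTf, Complex.ofReal_zero, zero_smul]))
    obtain ⟨hdom, hHf⟩ := hT.apply_eq_smul_of_resolvent_eq_smul hk hTf
    exact hspan _ ⟨f, hdom⟩ hHf
  have hbot : (Submodule.span ℂ (Set.range v))ᗮ = ⊥ :=
    le_bot_iff.1 <| (Submodule.orthogonal_le hle).trans_eq <|
      ContinuousLinearMap.orthogonalComplement_iSup_eigenspaces_eq_bot hcomp hsymm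
  exact ⟨HilbertBasis.mkOfOrthogonalEqBot hortho hbot, fun i => by
    rw [HilbertBasis.coe_mkOfOrthogonalEqBot]⟩

section EigenBasis

variable (e : HilbertBasis ι ℂ 𝓗) (m : ι → ℝ)
  (he : ∀ i, ∃ h : e i ∈ H.domain, H ⟨e i, h⟩ = (m i : ℂ) • e i)
include he

theorem repr_apply (hT : IsResolventAt H lam T) (hsymm : T.IsSymmetric) (x : H.domain) (i : ι) :
    e.repr (H x) i = m i * e.repr (x : 𝓗) i := by
  obtain ⟨hdom, heig⟩ := he i
  rw [e.repr_apply_apply, e.repr_apply_apply, ← hT.inner_apply_left hsymm ⟨e i, hdom⟩ x, heig,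
    inner_smul_left, Complex.conj_ofReal]

theorem repr_resolvent (hT : IsResolventAt H lam T) (hsymm : T.IsSymmetric) (f : 𝓗) (i : ι) :
    ((m i : ℂ) - lam) * e.repr (T f) i = e.repr f i := by
  have h := hT.repr_apply e m he hsymm ⟨T f, hT.mem_domain f⟩ i
  rw [hT.apply_self, map_add, map_smul] at h
  simp only [lp.coeFn_add, lp.coeFn_smul, Pi.add_apply, Pi.smul_apply, smul_eq_mul] at h
  linear_combination -h

theorem sub_ne_zero (hT : IsResolventAt H lam T) (i : ι) : (m i : ℂ) - lam ≠ 0 := by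
  obtain ⟨hdom, heig⟩ := he i
  intro h
  have hres := hT.apply_sub ⟨e i, hdom⟩
  rw [heig, ← sub_smul, h, zero_smul, map_zero] at hres
  exact e.orthonormal.ne_zero i hres.symm

theorem mem_domain_iff_summable (hT : IsResolventAt H lam T) (hsymm : T.IsSymmetric) (x : 𝓗) :
    x ∈ H.domain ↔ Summable fun i => m i ^ 2 * ‖e.repr x i‖ ^ 2 := by
  have hsq : ∀ i, ‖(m i : ℂ) * e.repr x i‖ ^ 2 = m i ^ 2 * ‖e.repr x i‖ ^ 2 := fun i => by
    rw [norm_mul, mul_pow, Complex.norm_real, Real.norm_eq_abs, sq_abs]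
  constructor
  · intro hx
    refine (ProjValuedMeasure.hasSum_norm_sq_repr e (H ⟨x, hx⟩)).summable.congr fun i => ?_
    rw [hT.repr_apply e m he hsymm, hsq]
  · intro hx
    have hmem : Memℓp (fun i => (m i : ℂ) * e.repr x i) 2 := by
      rw [memℓp_gen_iff (by norm_num)]
      exact hx.congr fun i => by rw [← hsq, ENNReal.toReal_ofNat, Real.rpow_two]
    set y : 𝓗 := e.repr.symm ⟨_, hmem⟩ with hy
    have hy_repr : ∀ i, e.repr y i = m i * e.repr x i := fun i => by
      rw [hy, LinearIsometryEquiv.apply_symm_apply]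
    suffices hTx : T (y - (lam : ℂ) • x) = x from hTx ▸ hT.mem_domain _
    apply e.repr.injective
    ext i
    refine mul_left_cancel₀ (hT.sub_ne_zero e m he i) ?_
    rw [hT.repr_resolvent e m he hsymm, map_sub, map_smul]
    simp only [lp.coeFn_sub, lp.coeFn_smul, Pi.sub_apply, Pi.smul_apply, smul_eq_mul]
    rw [hy_repr, sub_mul]

theorem isSpectralResolution_diagonal [CompleteSpace 𝓗] [Countable ι] (hT : IsResolventAt H lam T)
    (hsymm : T.IsSymmetric) : (ProjValuedMeasure.diagonal e m).IsSpectralResolution H :=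
  ProjValuedMeasure.isSpectralResolution_diagonal e m (hT.mem_domain_iff_summable e m he hsymm)
    (hT.repr_apply e m he hsymm)

end EigenBasis

end IsResolventAt

namespace SturmLiouville

variable {a b : ℝ} {p q r : ℝ → ℝ} {α β : ℝ}

namespace IsRegular

variable {E : Type*} [NormedAddCommGroup E] [NormedSpace ℝ E]

theorem aemeasurable_ofReal_r (hreg : IsRegular a b p q r) :
    AEMeasurable (fun x => ENNReal.ofReal (r x)) (volume.restrict (Ioo a b)) :=
  hreg.integrable_r.aestronglyMeasurable.aemeasurable.ennreal_ofReal

theorem ae_toReal_ofReal_r (hreg : IsRegular a b p q r) :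
    ∀ᵐ x ∂(volume.restrict (Ioo a b)), (ENNReal.ofReal (r x)).toReal = r x := by
  filter_upwards [hreg.r_pos] with x hx using ENNReal.toReal_ofReal hx.le

theorem integrable_weight_iff (hreg : IsRegular a b p q r) {f : ℝ → E} :
    Integrable f (weight a b r) ↔ IntegrableOn (fun x => r x • f x) (Ioo a b) := by
  rw [weight, integrable_withDensity_iff_integrable_smul₀' hreg.aemeasurable_ofReal_r
    (.of_forall fun _ => ENNReal.ofReal_lt_top)]
  refine integrable_congr ?_
  filter_upwards [hreg.ae_toReal_ofReal_r] with x hx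
  rw [hx]

theorem integral_weight (hreg : IsRegular a b p q r) (f : ℝ → E) :
    ∫ x, f x ∂(weight a b r) = ∫ x in Ioo a b, r x • f x := by
  rw [weight, integral_withDensity_eq_integral_toReal_smul₀ hreg.aemeasurable_ofReal_r
    (.of_forall fun _ => ENNReal.ofReal_lt_top)]
  refine integral_congr_ae ?_
  filter_upwards [hreg.ae_toReal_ofReal_r] with x hx
  rw [hx]

theorem isFiniteMeasure_weight (hreg : IsRegular a b p q r) : IsFiniteMeasure (weight a b r) := by
  have h := (hreg.integrable_weight_iff (f := fun _ => (1 : ℝ))).2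
    (by simpa using hreg.integrable_r)
  rwa [integrable_const_iff_isFiniteMeasure one_ne_zero] at h

theorem integrableOn_smul_coeFn (hreg : IsRegular a b p q r) (f : L2 a b r) :
    IntegrableOn (fun x => r x • f x) (Ioo a b) := by
  have := hreg.isFiniteMeasure_weight
  exact hreg.integrable_weight_iff.1 ((Lp.memLp f).integrable one_le_two)

theorem exists_integral_norm_le (hreg : IsRegular a b p q r) :
    ∃ c : ℝ, 0 ≤ c ∧ ∀ f : L2 a b r, ∫ x in Ioo a b, ‖r x • f x‖ ≤ c * ‖f‖ := by
  have := hreg.isFiniteMeasure_weight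
  set C : ENNReal := weight a b r Set.univ ^ (1 / (1 : ENNReal).toReal - 1 / (2 : ENNReal).toReal)
  have hC : C ≠ ⊤ := ENNReal.rpow_ne_top_of_nonneg (by norm_num) (measure_ne_top _ _)
  refine ⟨C.toReal, ENNReal.toReal_nonneg, fun f => ?_⟩
  have hf := (Lp.memLp f).aestronglyMeasurable
  calc ∫ x in Ioo a b, ‖r x • f x‖ = ∫ x, ‖f x‖ ∂(weight a b r) := by
        rw [hreg.integral_weight]
        refine integral_congr_ae ?_
        filter_upwards [hreg.r_pos] with x hx
        rw [norm_smul, Real.norm_of_nonneg hx.le, smul_eq_mul]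
    _ = (eLpNorm f 1 (weight a b r)).toReal := by
        rw [integral_norm_eq_lintegral_enorm hf, ← eLpNorm_one_eq_lintegral_enorm]
    _ ≤ (eLpNorm f 2 (weight a b r) * C).toReal :=
        ENNReal.toReal_mono (ENNReal.mul_ne_top (Lp.eLpNorm_ne_top f) hC)
          (eLpNorm_le_eLpNorm_mul_rpow_measure_univ one_le_two hf)
    _ = C.toReal * ‖f‖ := by rw [ENNReal.toReal_mul, mul_comm, Lp.norm_def]

end IsRegular

theorem ae_weight_of_ae {P : ℝ → Prop} (h : ∀ᵐ x ∂(volume.restrict (Ioo a b)), P x) :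
    ∀ᵐ x ∂(weight a b r), P x :=
  (withDensity_absolutelyContinuous _ _).ae_le h

theorem TauEq.inner_sub_inner (hab : a ≤ b) (hreg : IsRegular a b p q r)
    {f g f₁ g₁ : L2 a b r} {u w τu u₁ w₁ τu₁ : ℝ → ℂ} (h : TauEq a b p q r u w τu)
    (h₁ : TauEq a b p q r u₁ w₁ τu₁) (hf : f =ᵐ[weight a b r] u) (hg : g =ᵐ[weight a b r] τu)
    (hf₁ : f₁ =ᵐ[weight a b r] u₁) (hg₁ : g₁ =ᵐ[weight a b r] τu₁) :
    inner ℂ g f₁ - inner ℂ f g₁ =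
      wronskian (fun x => Complex.conjCLE (u x)) (fun x => Complex.conjCLE (w x)) u₁ w₁ b -
        wronskian (fun x => Complex.conjCLE (u x)) (fun x => Complex.conjCLE (w x)) u₁ w₁ a := by
  have hae : (fun x => inner ℂ (g x) (f₁ x) - inner ℂ (f x) (g₁ x)) =ᵐ[weight a b r]
      fun x => Complex.conjCLE (τu x) * u₁ x - Complex.conjCLE (u x) * τu₁ x := by
    filter_upwards [hf, hg, hf₁, hg₁] with x hf hg hf₁ hg₁
    rw [hf, hg, hf₁, hg₁, RCLike.inner_apply, RCLike.inner_apply, Complex.conjCLE_apply,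
      Complex.conjCLE_apply]
    ring
  have hint := hreg.integrable_weight_iff.1 <|
    ((L2.integrable_inner g f₁).sub (L2.integrable_inner f g₁)).congr hae
  have hW := ((h.clm_apply (Complex.conjCLE : ℂ →L[ℝ] ℂ)).isPrimitive_wronskian h₁).eq_add_integral
    hab hint (right_mem_Icc.2 hab)
  rw [intervalIntegral.integral_of_le hab, integral_Ioc_eq_integral_Ioo] at hW
  rw [L2.inner_def, L2.inner_def, ← integral_sub (L2.integrable_inner g f₁)
    (L2.integrable_inner f g₁), integral_congr_ae hae, hreg.integral_weight]
  exact eq_sub_of_add_eq' hW.symm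

theorem inner_snd_fst_eq_inner_fst_snd (hab : a ≤ b) (hreg : IsRegular a b p q r)
    {F G : L2 a b r × L2 a b r} (hF : F ∈ graph a b p q r α β) (hG : G ∈ graph a b p q r α β) :
    inner ℂ F.2 G.1 = inner ℂ F.1 G.2 := by
  obtain ⟨u, w, g, hu, hg, h, ha, hb⟩ := hF
  obtain ⟨u₁, w₁, g₁, hu₁, hg₁, h₁, ha₁, hb₁⟩ := hG
  have hWa : wronskian (fun x => Complex.conjCLE (u x)) (fun x => Complex.conjCLE (w x))
      u₁ w₁ a = 0 :=
    (ha.clm_apply (Complex.conjCLE : ℂ →L[ℝ] ℂ)).wronskian_eq_zero ha₁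
  have hWb : wronskian (fun x => Complex.conjCLE (u x)) (fun x => Complex.conjCLE (w x))
      u₁ w₁ b = 0 :=
    (hb.clm_apply (Complex.conjCLE : ℂ →L[ℝ] ℂ)).wronskian_eq_zero hb₁
  rw [← sub_eq_zero, h.inner_sub_inner hab hreg h₁ hu hg hu₁ hg₁, hWa, hWb, sub_zero]

theorem TauEq.exists_bound (hab : a ≤ b) {E : Type*} [NormedAddCommGroup E] [NormedSpace ℝ E]
    {u w g : ℝ → E} (h : TauEq a b p q r u w g) :
    ∃ C, ∀ x ∈ Icc a b, ‖u x‖ ≤ C ∧ ‖w x‖ ≤ C := by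
  obtain ⟨C, hC⟩ := h.ac_u.exists_bound
  obtain ⟨D, hD⟩ := h.ac_w.exists_bound
  rw [uIcc_of_le hab] at hC hD
  exact ⟨max C D, fun x hx =>
    ⟨(hC x hx).trans (le_max_left _ _), (hD x hx).trans (le_max_right _ _)⟩⟩

section GreenIntegral

theorem norm_integral_mul_le {k φ : ℝ → ℂ} (hk : IntegrableOn k (Ioo a b)) {C : ℝ}
    (hφ : ∀ x ∈ Icc a b, ‖φ x‖ ≤ C) {x y : ℝ} (hx : x ∈ Icc a b) (hy : y ∈ Icc a b)
    (hxy : x ≤ y) : ‖∫ t in x..y, k t * φ t‖ ≤ C * ∫ t in Ioo a b, ‖k t‖ :=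
  calc ‖∫ t in x..y, k t * φ t‖ ≤ ∫ t in x..y, C * ‖k t‖ := by
        refine intervalIntegral.norm_integral_le_of_norm_le hxy (.of_forall fun t ht => ?_)
          ((intervalIntegrable_of_integrableOn_Ioo hk.norm hx hy).const_mul C)
        rw [norm_mul, mul_comm]
        exact mul_le_mul_of_nonneg_right (hφ t ⟨hx.1.trans ht.1.le, ht.2.trans hy.2⟩)
          (norm_nonneg _)
    _ = C * ∫ t in Ioo x y, ‖k t‖ := by
        rw [intervalIntegral.integral_const_mul, intervalIntegral.integral_of_le hxy,
          integral_Ioc_eq_integral_Ioo]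
    _ ≤ C * ∫ t in Ioo a b, ‖k t‖ :=
        mul_le_mul_of_nonneg_left
          (setIntegral_mono_set hk.norm (.of_forall fun _ => norm_nonneg _)
            (Ioo_subset_Ioo hx.1 hy.2).eventuallyLE) ((norm_nonneg _).trans (hφ x hx))

/-- The variation-of-constants integral `χ₁ x * ∫ₐˣ k ψ + ψ₁ x * ∫ₓᵇ k χ`.  Green's function is
obtained for `(ψ₁, χ₁) = (ψ, χ)`, its quasi-derivative for `(ψ₁, χ₁) = (p ψ', p χ')`. -/
def greenIntegral (a b : ℝ) (ψ χ ψ₁ χ₁ k : ℝ → ℂ) (x : ℝ) : ℂ :=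
  χ₁ x * (∫ t in a..x, k t * ψ t) + ψ₁ x * ∫ t in x..b, k t * χ t

variable {ψ χ ψ₁ χ₁ k : ℝ → ℂ}

theorem norm_greenIntegral_le (hk : IntegrableOn k (Ioo a b)) {C : ℝ}
    (hψ : ∀ x ∈ Icc a b, ‖ψ x‖ ≤ C) (hχ : ∀ x ∈ Icc a b, ‖χ x‖ ≤ C)
    (hψ₁ : ∀ x ∈ Icc a b, ‖ψ₁ x‖ ≤ C) (hχ₁ : ∀ x ∈ Icc a b, ‖χ₁ x‖ ≤ C) {x : ℝ}
    (hx : x ∈ Icc a b) :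
    ‖greenIntegral a b ψ χ ψ₁ χ₁ k x‖ ≤ 2 * C ^ 2 * ∫ t in Ioo a b, ‖k t‖ := by
  have hab : a ≤ b := hx.1.trans hx.2
  have hC : 0 ≤ C := (norm_nonneg _).trans (hψ x hx)
  calc ‖greenIntegral a b ψ χ ψ₁ χ₁ k x‖
      ≤ ‖χ₁ x‖ * ‖∫ t in a..x, k t * ψ t‖ + ‖ψ₁ x‖ * ‖∫ t in x..b, k t * χ t‖ := by
        rw [← norm_mul, ← norm_mul]
        exact norm_add_le _ _
    _ ≤ C * (C * ∫ t in Ioo a b, ‖k t‖) + C * (C * ∫ t in Ioo a b, ‖k t‖) := by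
        gcongr
        · exact hχ₁ x hx
        · exact norm_integral_mul_le hk hψ (left_mem_Icc.2 hab) hx hx.1
        · exact hψ₁ x hx
        · exact norm_integral_mul_le hk hχ hx (right_mem_Icc.2 hab) hx.2
    _ = 2 * C ^ 2 * ∫ t in Ioo a b, ‖k t‖ := by ring

theorem isPrimitive_greenIntegral (hab : a ≤ b) (hk : IntegrableOn k (Ioo a b))
    {ψ₁' χ₁' : ℝ → ℂ} (hψ : ContinuousOn ψ (Icc a b)) (hχ : ContinuousOn χ (Icc a b))
    (hψ₁ : IsPrimitive a b ψ₁ ψ₁') (hχ₁ : IsPrimitive a b χ₁ χ₁') :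
    IsPrimitive a b (greenIntegral a b ψ χ ψ₁ χ₁ k) fun x =>
      greenIntegral a b ψ χ ψ₁' χ₁' k x + k x * (ψ x * χ₁ x - ψ₁ x * χ x) := by
  refine ((hχ₁.mul (.integral hab (integrableOn_mul_continuousOn hk hψ))).add
    (hψ₁.mul (.integral_right hab (integrableOn_mul_continuousOn hk hχ)))).congr_deriv
    (.of_forall fun x => ?_)
  rw [greenIntegral]
  ring

end GreenIntegral

/-- A solution `ψ` of `τ u = lam u` (with `ψ' = p dψ/dx`) that satisfies the boundary condition at
`a` and a solution `χ` that satisfies the boundary condition at `b`, linearly independent.  Green's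
function of `H - lam` is built from such a pair. -/
structure GreenPair (a b : ℝ) (p q r : ℝ → ℝ) (α β lam : ℝ) (ψ ψ' χ χ' : ℝ → ℝ) : Prop where
  tauEq_left : TauEq a b p q r ψ ψ' (fun x => lam * ψ x)
  tauEq_right : TauEq a b p q r χ χ' (fun x => lam * χ x)
  boundary_left : BoundaryCond a α ψ ψ'
  boundary_right : BoundaryCond b β χ χ'
  wronskian_ne_zero : wronskian ψ ψ' χ χ' a ≠ 0

theorem exists_greenPair_of_not_boundaryCond (hab : a ≤ b) (hreg : IsRegular a b p q r) {lam : ℝ}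
    {ψ ψ' : ℝ → ℝ} (hψ : TauEq a b p q r ψ ψ' (fun x => lam * ψ x)) (hψa : ψ a = Real.sin α)
    (hψa' : ψ' a = Real.cos α) (hψb : ¬ BoundaryCond b β ψ ψ') :
    ∃ χ χ' : ℝ → ℝ, GreenPair a b p q r α β lam ψ ψ' χ χ' := by
  obtain ⟨φ, φ', hφ, hφa, hφa'⟩ := exists_tauEq_of_left hab hreg lam (α + Real.pi / 2)
  rw [Real.sin_add_pi_div_two] at hφa
  rw [Real.cos_add_pi_div_two] at hφa'
  set c : ℝ := Real.cos β * φ b - Real.sin β * φ' b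
  set d : ℝ := -(Real.cos β * ψ b - Real.sin β * ψ' b) with hd
  refine ⟨fun x => c * ψ x + d * φ x, fun x => c * ψ' x + d * φ' x, hψ, ?_, ?_, ?_, ?_⟩
  · refine .of_isPrimitive
      ((((IsPrimitive.const c).mul hψ.isPrimitive_u).add
        ((IsPrimitive.const d).mul hφ.isPrimitive_u)).congr_deriv (.of_forall fun x => ?_))
      ((((IsPrimitive.const c).mul hψ.isPrimitive_w).add
        ((IsPrimitive.const d).mul hφ.isPrimitive_w)).congr_deriv (.of_forall fun x => ?_))
    all_goals
      simp only [smul_eq_mul]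
      ring
  · rw [BoundaryCond, hψa, hψa', smul_eq_mul, smul_eq_mul]
    ring
  · rw [BoundaryCond, smul_eq_mul, smul_eq_mul]
    ring
  · have hW : wronskian ψ ψ' (fun x => c * ψ x + d * φ x) (fun x => c * ψ' x + d * φ' x) a =
        -d := by
      rw [wronskian, hψa, hψa', hφa, hφa']
      linear_combination (-d) * Real.sin_sq_add_cos_sq α
    rw [hW, hd, neg_neg]
    exact hψb

namespace GreenPair

variable {lam : ℝ} {ψ ψ' χ χ' : ℝ → ℝ}

theorem tauEq_greenIntegral (h : GreenPair a b p q r α β lam ψ ψ' χ χ') (hab : a ≤ b)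
    {f : ℝ → ℂ} (hf : IntegrableOn (fun x => r x • f x) (Ioo a b)) :
    TauEq a b p q r
      (fun x => -((wronskian ψ ψ' χ χ' a : ℝ) : ℂ)⁻¹ *
        greenIntegral a b (fun x => ψ x) (fun x => χ x) (fun x => ψ x) (fun x => χ x)
          (fun x => r x • f x) x)
      (fun x => -((wronskian ψ ψ' χ χ' a : ℝ) : ℂ)⁻¹ *
        greenIntegral a b (fun x => ψ x) (fun x => χ x) (fun x => ψ' x) (fun x => χ' x)
          (fun x => r x • f x) x)
      (fun x => lam * (-((wronskian ψ ψ' χ χ' a : ℝ) : ℂ)⁻¹ *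
        greenIntegral a b (fun x => ψ x) (fun x => χ x) (fun x => ψ x) (fun x => χ x)
          (fun x => r x • f x) x) + f x) := by
  have hψ := h.tauEq_left.ofReal
  have hχ := h.tauEq_right.ofReal
  have hψc := hψ.isPrimitive_u.continuousOn hab
  have hχc := hχ.isPrimitive_u.continuousOn hab
  have hW : ((wronskian ψ ψ' χ χ' a : ℝ) : ℂ) ≠ 0 := Complex.ofReal_ne_zero.2 h.wronskian_ne_zero
  refine .of_isPrimitive ?_ ?_
  · refine ((IsPrimitive.const _).mul (isPrimitive_greenIntegral hab hf hψc hχc hψ.isPrimitive_u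
      hχ.isPrimitive_u)).congr_deriv (.of_forall fun x => ?_)
    simp only [greenIntegral, Complex.real_smul]
    ring
  · refine ((IsPrimitive.const _).mul (isPrimitive_greenIntegral hab hf hψc hχc hψ.isPrimitive_w
      hχ.isPrimitive_w)).congr_deriv ?_
    filter_upwards [ae_restrict_mem measurableSet_Ioo] with x hx
    have hWx : (ψ x : ℂ) * χ' x - ψ' x * χ x = (wronskian ψ ψ' χ χ' a : ℝ) := by
      rw [← h.tauEq_left.wronskian_eq_left hab h.tauEq_right (Ioo_subset_Icc_self hx), wronskian]
      push_cast
      rfl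
    rw [hWx]
    simp only [greenIntegral, Complex.real_smul]
    field_simp
    ring

theorem exists_solution (h : GreenPair a b p q r α β lam ψ ψ' χ χ') (hab : a ≤ b)
    (hreg : IsRegular a b p q r) :
    ∃ C : ℝ, 0 ≤ C ∧ ∀ f : L2 a b r, ∃ u w : ℝ → ℂ,
      TauEq a b p q r u w (fun x => (lam : ℂ) * u x + f x) ∧ BoundaryCond a α u w ∧
        BoundaryCond b β u w ∧ ∀ x ∈ Icc a b, ‖u x‖ ≤ C * ‖f‖ ∧ ‖w x‖ ≤ C * ‖f‖ := by
  obtain ⟨c, hc, hint_le⟩ := hreg.exists_integral_norm_le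
  obtain ⟨Cψ, hCψ⟩ := h.tauEq_left.ofReal.exists_bound hab
  obtain ⟨Cχ, hCχ⟩ := h.tauEq_right.ofReal.exists_bound hab
  set C := max Cψ Cχ
  have hψ : ∀ x ∈ Icc a b, ‖(ψ x : ℂ)‖ ≤ C := fun x hx => (hCψ x hx).1.trans (le_max_left _ _)
  have hψ' : ∀ x ∈ Icc a b, ‖(ψ' x : ℂ)‖ ≤ C := fun x hx => (hCψ x hx).2.trans (le_max_left _ _)
  have hχ : ∀ x ∈ Icc a b, ‖(χ x : ℂ)‖ ≤ C := fun x hx => (hCχ x hx).1.trans (le_max_right _ _)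
  have hχ' : ∀ x ∈ Icc a b, ‖(χ' x : ℂ)‖ ≤ C := fun x hx => (hCχ x hx).2.trans (le_max_right _ _)
  set V : ℂ := -((wronskian ψ ψ' χ χ' a : ℝ) : ℂ)⁻¹
  refine ⟨‖V‖ * (2 * C ^ 2 * c), by positivity, fun f => ?_⟩
  have hf := hreg.integrableOn_smul_coeFn f
  have hbound : ∀ {y : ℂ}, ‖y‖ ≤ 2 * C ^ 2 * ∫ t in Ioo a b, ‖r t • f t‖ →
      ‖V * y‖ ≤ ‖V‖ * (2 * C ^ 2 * c) * ‖f‖ := fun hy => by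
    rw [norm_mul, mul_assoc, mul_assoc (2 * C ^ 2)]
    gcongr
    exact hy.trans (by gcongr; exact hint_le f)
  refine ⟨_, _, h.tauEq_greenIntegral hab hf, ?_, ?_, fun x hx =>
    ⟨hbound (norm_greenIntegral_le hf hψ hχ hψ hχ hx),
      hbound (norm_greenIntegral_le hf hψ hχ hψ' hχ' hx)⟩⟩
  · have hbc := boundaryCond_ofReal.2 h.boundary_left
    simp only [BoundaryCond, Complex.real_smul, greenIntegral, intervalIntegral.integral_same,
      mul_zero, zero_add] at hbc ⊢
    linear_combination V * (∫ t in a..b, (r t : ℂ) * f t * (χ t : ℂ)) * hbc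
  · have hbc := boundaryCond_ofReal.2 h.boundary_right
    simp only [BoundaryCond, Complex.real_smul, greenIntegral, intervalIntegral.integral_same,
      mul_zero, add_zero] at hbc ⊢
    linear_combination V * (∫ t in a..b, (r t : ℂ) * f t * (ψ t : ℂ)) * hbc

end GreenPair

end SturmLiouville

theorem isCompactOperator_of_continuity_modulus {X E V W : Type*} [TopologicalSpace X]
    [CompactSpace X] [NormedAddCommGroup E] [ProperSpace E] [SeminormedAddCommGroup V]
    [TopologicalSpace W] {J : BoundedContinuousFunction X E → W} (hJ : Continuous J)
    (S : V → BoundedContinuousFunction X E) {K : X → ℝ} (hK : Continuous K) {C : ℝ} (hC : 0 ≤ C)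
    (hbound : ∀ f x, ‖S f x‖ ≤ C * ‖f‖)
    (hmod : ∀ f x y, ‖S f x - S f y‖ ≤ C * ‖f‖ * |K y - K x|) :
    IsCompactOperator fun f => J (S f) := by
  set A := S '' Metric.ball 0 1
  have hle : ∀ f ∈ Metric.ball (0 : V) 1, C * ‖f‖ ≤ C := fun f hf =>
    mul_le_of_le_one_right hC (mem_ball_zero_iff.1 hf).le
  have hequi : Equicontinuous ((↑) : A → X → E) := fun x₀ => by
    refine Metric.equicontinuousAt_of_continuity_modulus (fun x => C * |K x - K x₀|) ?_ _
      (.of_forall fun x => ?_)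
    · have hlim : Continuous fun x => C * |K x - K x₀| := by fun_prop
      simpa using hlim.tendsto x₀
    · rintro ⟨_, f, hf, rfl⟩
      rw [dist_eq_norm]
      exact (hmod f x₀ x).trans (mul_le_mul_of_nonneg_right (hle f hf) (abs_nonneg _))
  have hA : IsCompact (closure A) := by
    refine BoundedContinuousFunction.arzela_ascoli (Metric.closedBall 0 C)
      (isCompact_closedBall _ _) A ?_ hequi
    rintro _ x ⟨f, hf, rfl⟩
    exact mem_closedBall_zero_iff.2 ((hbound f x).trans (hle f hf))
  exact ⟨J '' closure A, hA.image hJ,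
    Filter.mem_of_superset (Metric.ball_mem_nhds 0 one_pos) fun f hf =>
      ⟨S f, subset_closure ⟨f, hf, rfl⟩, rfl⟩⟩

namespace SturmLiouville

variable {a b : ℝ} {p q r : ℝ → ℝ} {α β : ℝ}

theorem mem_graph_iff_operator (hab : a < b) (hreg : IsRegular a b p q r) {x y : L2 a b r} :
    (x, y) ∈ graph a b p q r α β ↔ ∃ h : x ∈ (operator a b p q r α β).domain,
      operator a b p q r α β ⟨x, h⟩ = y := by
  rw [← operator_graph hab hreg, LinearPMap.mem_graph_iff]
  constructor
  · rintro ⟨z, rfl, rfl⟩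
    exact ⟨z.2, rfl⟩
  · rintro ⟨h, rfl⟩
    exact ⟨⟨x, h⟩, rfl, rfl⟩

theorem mem_graph_operator (hab : a < b) (hreg : IsRegular a b p q r)
    (x : (operator a b p q r α β).domain) :
    ((x : L2 a b r), operator a b p q r α β x) ∈ graph a b p q r α β :=
  (mem_graph_iff_operator hab hreg).2 ⟨x.2, rfl⟩

theorem exists_tauEq_of_mem_graph (hreg : IsRegular a b p q r) {x : L2 a b r} {z : ℂ}
    (h : (x, z • x) ∈ graph a b p q r α β) :
    ∃ u w : ℝ → ℂ, x =ᵐ[weight a b r] u ∧ TauEq a b p q r u w (fun t => z * u t) ∧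
      BoundaryCond a α u w ∧ BoundaryCond b β u w := by
  obtain ⟨u, w, g, hu, hg, h, ha, hb⟩ := h
  refine ⟨u, w, hu, h.congr_right (ae_of_ae_weight hreg ?_), ha, hb⟩
  filter_upwards [hu, hg, Lp.coeFn_smul z x] with t hut hgt hsmul
  rw [← hgt, hsmul, Pi.smul_apply, smul_eq_mul, hut]

theorem ae_eq_of_eqOn {f : L2 a b r} {u v : ℝ → ℂ} (hf : f =ᵐ[weight a b r] u)
    (huv : EqOn u v (Icc a b)) : f =ᵐ[weight a b r] v := by
  filter_upwards [hf, ae_weight_of_ae (ae_restrict_mem measurableSet_Ioo)] with x hfx hx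
  rw [hfx, huv (Ioo_subset_Icc_self hx)]

theorem GreenPair.eq_zero_of_mem_graph {lam : ℝ} {ψ ψ' χ χ' : ℝ → ℝ}
    (h : GreenPair a b p q r α β lam ψ ψ' χ χ') (hab : a ≤ b) (hreg : IsRegular a b p q r)
    {x : L2 a b r} (hx : (x, (lam : ℂ) • x) ∈ graph a b p q r α β) : x = 0 := by
  obtain ⟨u, w, hu, hτ, hua, hub⟩ := exists_tauEq_of_mem_graph hreg hx
  have hψ := h.tauEq_left.ofReal
  have hχ := h.tauEq_right.ofReal
  have hne : wronskian (fun x => (ψ x : ℂ)) (fun x => (ψ' x : ℂ)) (fun x => (χ x : ℂ))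
      (fun x => (χ' x : ℂ)) a ≠ 0 := by
    simpa only [wronskian, ← Complex.ofReal_mul, ← Complex.ofReal_sub, Complex.ofReal_ne_zero]
      using h.wronskian_ne_zero
  have hWψ := hua.wronskian_eq_zero (boundaryCond_ofReal.2 h.boundary_left)
  have hWχ := (hτ.wronskian_eq_left hab hχ (right_mem_Icc.2 hab)).symm.trans
    (hub.wronskian_eq_zero (boundaryCond_ofReal.2 h.boundary_right))
  have hzero : EqOn u 0 (Icc a b) := fun t ht =>
    (hτ.eq_zero_of_wronskian_eq_zero hab hψ hχ hne hWψ hWχ ht).1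
  exact Lp.ext ((ae_eq_of_eqOn hu hzero).trans (Lp.coeFn_zero ℂ 2 _).symm)

/-- Continuous functions on `[a, b]` as elements of `L²((a, b), r dx)`.  The detour through
`projIcc` extends them to `ℝ`. -/
def toL2 (hab : a ≤ b) (r : ℝ → ℝ) [IsFiniteMeasure (weight a b r)] :
    BoundedContinuousFunction (Icc a b) ℂ →L[ℂ] L2 a b r :=
  (BoundedContinuousFunction.toLp 2 (weight a b r) ℂ).comp
    (BoundedContinuousFunction.compContinuousCLM ℂ ℂ ⟨projIcc a b hab, continuous_projIcc⟩)

theorem exists_toL2_ae_eq (hab : a ≤ b) [IsFiniteMeasure (weight a b r)] {u : ℝ → ℂ}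
    (hu : ContinuousOn u (Icc a b)) :
    ∃ g : BoundedContinuousFunction (Icc a b) ℂ,
      (∀ x, g x = u x) ∧ toL2 hab r g =ᵐ[weight a b r] u := by
  set g : BoundedContinuousFunction (Icc a b) ℂ := .mkOfCompact
    ⟨(Icc a b).domRestrict u, continuousOn_iff_continuous_domRestrict.1 hu⟩
  refine ⟨g, fun _ => rfl, ?_⟩
  have hg : toL2 hab r g =ᵐ[weight a b r] fun x => g (projIcc a b hab x) :=
    BoundedContinuousFunction.coeFn_toLp 2 (weight a b r) ℂ
      (g.compContinuous ⟨projIcc a b hab, continuous_projIcc⟩)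
  exact ae_eq_of_eqOn hg fun x hx => congrArg g (projIcc_of_mem hab hx)

theorem TauEq.norm_sub_le (hab : a ≤ b) (hreg : IsRegular a b p q r) {u w g : ℝ → ℂ} {C : ℝ}
    (h : TauEq a b p q r u w g) (hC : ∀ x ∈ Icc a b, ‖w x‖ ≤ C) {x y : ℝ} (hx : x ∈ Icc a b)
    (hy : y ∈ Icc a b) :
    ‖u x - u y‖ ≤ C * |(∫ t in a..y, ‖(p t)⁻¹‖) - ∫ t in a..x, ‖(p t)⁻¹‖| := by
  have ha := left_mem_Icc.2 hab
  have hC₀ : 0 ≤ C := (norm_nonneg _).trans (hC a ha)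
  have hp := hreg.integrable_inv_p.norm
  have hderiv : IntegrableOn (fun x => (p x)⁻¹ • w x) (Ioo a b) := by
    simp only [Complex.real_smul]
    exact integrableOn_mul_continuousOn hreg.integrable_inv_p.ofReal
      (h.isPrimitive_w.continuousOn hab)
  have hu : u y - u x = ∫ t in x..y, (p t)⁻¹ • w t := by
    rw [h.isPrimitive_u.eq_add_integral hab hderiv hx,
      h.isPrimitive_u.eq_add_integral hab hderiv hy, add_sub_add_left_eq_sub,
      intervalIntegral.integral_interval_sub_left
        (intervalIntegrable_of_integrableOn_Ioo hderiv ha hy)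
        (intervalIntegrable_of_integrableOn_Ioo hderiv ha hx)]
  calc ‖u x - u y‖ = ‖∫ t in x..y, (p t)⁻¹ • w t‖ := by rw [norm_sub_rev, hu]
    _ ≤ |∫ t in x..y, C * ‖(p t)⁻¹‖| := by
        refine intervalIntegral.norm_integral_le_abs_of_norm_le ?_
          ((intervalIntegrable_of_integrableOn_Ioo hp hx hy).const_mul C)
        filter_upwards [ae_restrict_mem measurableSet_uIoc] with t ht
        rw [norm_smul, mul_comm]
        exact mul_le_mul_of_nonneg_right (hC t (uIcc_subset_Icc hx hy (uIoc_subset_uIcc ht)))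
          (norm_nonneg _)
    _ = C * |(∫ t in a..y, ‖(p t)⁻¹‖) - ∫ t in a..x, ‖(p t)⁻¹‖| := by
        rw [intervalIntegral.integral_const_mul, abs_mul, abs_of_nonneg hC₀,
          intervalIntegral.integral_interval_sub_left
            (intervalIntegrable_of_integrableOn_Ioo hp ha hy)
            (intervalIntegrable_of_integrableOn_Ioo hp ha hx)]

theorem GreenPair.exists_bounded_solution {lam : ℝ} {ψ ψ' χ χ' : ℝ → ℝ}
    (h : GreenPair a b p q r α β lam ψ ψ' χ χ') (hab : a ≤ b) (hreg : IsRegular a b p q r)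
    [IsFiniteMeasure (weight a b r)] :
    ∃ C : ℝ, 0 ≤ C ∧ ∀ f : L2 a b r, ∃ g : BoundedContinuousFunction (Icc a b) ℂ,
      (toL2 hab r g, (lam : ℂ) • toL2 hab r g + f) ∈ graph a b p q r α β ∧
        (∀ x, ‖g x‖ ≤ C * ‖f‖) ∧ ∀ x y : Icc a b, ‖g x - g y‖ ≤ C * ‖f‖ *
          |(∫ t in a..(y : ℝ), ‖(p t)⁻¹‖) - ∫ t in a..(x : ℝ), ‖(p t)⁻¹‖| := by
  obtain ⟨C, hC₀, hC⟩ := h.exists_solution hab hreg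
  refine ⟨C, hC₀, fun f => ?_⟩
  obtain ⟨u, w, hτ, hua, hub, hbound⟩ := hC f
  obtain ⟨g, hgu, hg⟩ := exists_toL2_ae_eq (r := r) hab (hτ.isPrimitive_u.continuousOn hab)
  refine ⟨g, ⟨u, w, fun x => (lam : ℂ) * u x + f x, hg, ?_, hτ, hua, hub⟩,
    fun x => (hgu x).symm ▸ (hbound x x.2).1, fun x y => ?_⟩
  swap
  · rw [hgu, hgu]
    exact hτ.norm_sub_le hab hreg (fun z hz => (hbound z hz).2) x.2 y.2
  filter_upwards [hg, Lp.coeFn_add ((lam : ℂ) • toL2 hab r g) f,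
    Lp.coeFn_smul (lam : ℂ) (toL2 hab r g)] with x hgx hadd hsmul
  rw [hadd, Pi.add_apply, hsmul, Pi.smul_apply, hgx, smul_eq_mul]

theorem GreenPair.exists_isResolventAt {lam : ℝ} {ψ ψ' χ χ' : ℝ → ℝ}
    (h : GreenPair a b p q r α β lam ψ ψ' χ χ') (hab : a < b) (hreg : IsRegular a b p q r) :
    ∃ T : L2 a b r →L[ℂ] L2 a b r, IsResolventAt (operator a b p q r α β) lam T ∧
      T.IsSymmetric ∧ IsCompactOperator T := by
  have := hreg.isFiniteMeasure_weight
  obtain ⟨C, hC₀, hC⟩ := h.exists_bounded_solution hab.le hreg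
  choose S hgraph hbound hmod using hC
  have hS : ∀ f, ∃ hdom, operator a b p q r α β ⟨toL2 hab.le r (S f), hdom⟩ =
      (lam : ℂ) • toL2 hab.le r (S f) + f := fun f =>
    (mem_graph_iff_operator hab hreg).1 (hgraph f)
  obtain ⟨T, hT, hsymm⟩ := IsResolventAt.exists_of_isSymmetric (lam := lam)
    (fun x y => inner_snd_fst_eq_inner_fst_snd hab.le hreg (mem_graph_operator hab hreg x)
      (mem_graph_operator hab hreg y))
    (fun x hx => Subtype.ext <| h.eq_zero_of_mem_graph hab.le hreg <|
      hx ▸ mem_graph_operator hab hreg x)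
    (fun f => ⟨_, (hS f).2⟩)
  have hTS : ⇑T = fun f => toL2 hab.le r (S f) := funext fun f => by
    have hsub := hT.apply_sub ⟨_, (hS f).1⟩
    rwa [(hS f).2, add_sub_cancel_left] at hsub
  have hK : ContinuousOn (fun x => ∫ t in a..x, ‖(p t)⁻¹‖) (Icc a b) :=
    (IsPrimitive.integral hab.le hreg.integrable_inv_p.norm).continuousOn hab.le
  exact ⟨T, hT, hsymm, hTS ▸ isCompactOperator_of_continuity_modulus (toL2 hab.le r).continuous
    S (continuousOn_iff_continuous_domRestrict.1 hK) hC₀ hbound hmod⟩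

variable {a b : ℝ} {p q r : ℝ → ℝ} {α β : ℝ} {θ : ℝ → ℝ → ℝ}

/-! ### Eigenvalues and spectral subspaces -/

theorem IsPruferSolution.not_ae_eq_zero (hab : a < b) (hreg : IsRegular a b p q r) {μ : ℝ}
    {θ u w : ℝ → ℝ} (h : IsPruferSolution a b p q r μ θ) (hangle : IsPruferAngle a b u w θ) :
    ¬ ∀ᵐ x ∂(volume.restrict (Ioo a b)), u x = 0 := fun hzero => by
  obtain ⟨-, ρ, hρ⟩ := hangle
  refine h.not_sin_ae_eq_zero hab hreg ?_
  filter_upwards [hzero, ae_restrict_mem measurableSet_Ioo] with x hux hx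
  obtain ⟨hpos, hu, -⟩ := hρ x (Ioo_subset_Icc_self hx)
  exact (mul_eq_zero.1 (hu.symm.trans hux)).resolve_left hpos.ne'

theorem exists_ae_eq_const_mul_of_mem_graph (hab : a ≤ b) (hreg : IsRegular a b p q r) {μ : ℝ}
    {ψ ψ' : ℝ → ℝ} (hψ : TauEq a b p q r ψ ψ' (fun x => μ * ψ x)) (hψa : ψ a = Real.sin α)
    (hψa' : ψ' a = Real.cos α) {x : L2 a b r} (hx : (x, (μ : ℂ) • x) ∈ graph a b p q r α β) :
    ∃ c : ℂ, x =ᵐ[weight a b r] (fun t => c * ψ t) ∧ (c = 0 ∨ BoundaryCond b β ψ ψ') := by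
  obtain ⟨u, w, hxu, hu, hua, hub⟩ := exists_tauEq_of_mem_graph hreg hx
  obtain ⟨c, hc⟩ := hψ.exists_eq_const_mul hab hreg hψa hψa' hu hua
  refine ⟨c, ae_eq_of_eqOn hxu fun t ht => (hc t ht).1, ?_⟩
  obtain ⟨hcu, hcw⟩ := hc b (right_mem_Icc.2 hab)
  rw [BoundaryCond, hcu, hcw, Complex.real_smul, Complex.real_smul] at hub
  rw [BoundaryCond, ← Complex.ofReal_eq_zero, ← mul_eq_zero, smul_eq_mul, smul_eq_mul]
  push_cast at hub ⊢
  linear_combination hub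

theorem exists_ne_zero_mem_graph (hab : a ≤ b) (hreg : IsRegular a b p q r) {μ : ℝ}
    {ψ ψ' : ℝ → ℝ} (hψ : TauEq a b p q r ψ ψ' (fun x => μ * ψ x)) (hψa : BoundaryCond a α ψ ψ')
    (hψb : BoundaryCond b β ψ ψ') (hne : ¬ ∀ᵐ x ∂(volume.restrict (Ioo a b)), ψ x = 0) :
    ∃ y : L2 a b r, y ≠ 0 ∧ y =ᵐ[weight a b r] (fun t => (ψ t : ℂ)) ∧
      (y, (μ : ℂ) • y) ∈ graph a b p q r α β := by
  have := hreg.isFiniteMeasure_weight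
  obtain ⟨g, -, hg⟩ := exists_toL2_ae_eq (r := r) hab (hψ.ofReal.isPrimitive_u.continuousOn hab)
  refine ⟨toL2 hab r g, fun hzero => hne (ae_of_ae_weight hreg ?_), hg, _, _, _, hg, ?_, hψ.ofReal,
    boundaryCond_ofReal.2 hψa, boundaryCond_ofReal.2 hψb⟩
  · rw [hzero] at hg
    filter_upwards [hg, Lp.coeFn_zero ℂ 2 (weight a b r)] with x hgx hx
    exact Complex.ofReal_eq_zero.1 (hgx.symm.trans hx)
  · filter_upwards [hg, Lp.coeFn_smul (μ : ℂ) (toL2 hab r g)] with x hgx hsmul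
    rw [hsmul, Pi.smul_apply, hgx, smul_eq_mul]

namespace IsPruferFamily

theorem exists_tauEq (h : IsPruferFamily a b p q r α θ) (hab : a ≤ b)
    (hreg : IsRegular a b p q r) (μ : ℝ) :
    ∃ ψ ψ' : ℝ → ℝ, TauEq a b p q r ψ ψ' (fun x => μ * ψ x) ∧ IsPruferAngle a b ψ ψ' (θ μ) ∧
      ψ a = Real.sin α ∧ ψ' a = Real.cos α := by
  obtain ⟨ψ, ψ', hψ, hangle, hψa, hψa'⟩ := (h.isPruferSolution μ).exists_tauEq hab hreg
  exact ⟨ψ, ψ', hψ, hangle, hψa.trans (by rw [h.left]), hψa'.trans (by rw [h.left])⟩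

theorem exists_isResolventAt (h : IsPruferFamily a b p q r α θ) (hab : a < b)
    (hreg : IsRegular a b p q r) (hα : α ∈ Ico 0 Real.pi) (hβ : β ∈ Ioc 0 Real.pi) :
    ∃ (lam : ℝ) (T : L2 a b r →L[ℂ] L2 a b r), IsResolventAt (operator a b p q r α β) lam T ∧
      T.IsSymmetric ∧ IsCompactOperator T := by
  have hΘ := h.isCountingAngle hab hreg hα
  obtain ⟨lam, hlam⟩ := hΘ.exists_lt β hβ.1
  obtain ⟨ψ, ψ', hψ, hangle, hψa, hψa'⟩ := h.exists_tauEq hab.le hreg lam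
  have hψb : ¬ BoundaryCond b β ψ ψ' := fun hbc => by
    obtain ⟨k, hk⟩ := (hangle.boundaryCond_iff (right_mem_Icc.2 hab.le)).1 hbc
    have hk₀ := ((hΘ.exists_mem_Iic_eq_iff hβ k).1 ⟨lam, self_mem_Iic, hk⟩).1
    have hkπ : 0 ≤ k * Real.pi := by positivity
    linarith
  obtain ⟨χ, χ', hG⟩ := exists_greenPair_of_not_boundaryCond hab.le hreg hψ hψa hψa' hψb
  exact ⟨lam, hG.exists_isResolventAt hab hreg⟩

theorem mem_angleHits_of_mem_graph (h : IsPruferFamily a b p q r α θ) (hab : a ≤ b)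
    (hreg : IsRegular a b p q r) {μ : ℝ} {x : L2 a b r} (hx₀ : x ≠ 0)
    (hx : (x, (μ : ℂ) • x) ∈ graph a b p q r α β) : μ ∈ angleHits (fun μ => θ μ b) β univ := by
  obtain ⟨ψ, ψ', hψ, hangle, hψa, hψa'⟩ := h.exists_tauEq hab hreg μ
  obtain ⟨c, hxψ, hc⟩ := exists_ae_eq_const_mul_of_mem_graph hab hreg hψ hψa hψa' hx
  refine ⟨mem_univ μ, (hangle.boundaryCond_iff (right_mem_Icc.2 hab)).1 (hc.resolve_left ?_)⟩
  rintro rfl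
  refine hx₀ (Lp.ext ?_)
  filter_upwards [hxψ, Lp.coeFn_zero ℂ 2 (weight a b r)] with t htψ ht
  rw [htψ, ht, zero_mul, Pi.zero_apply]

theorem exists_eigenvector (h : IsPruferFamily a b p q r α θ) (hab : a < b)
    (hreg : IsRegular a b p q r) {μ : ℝ} (hμ : μ ∈ angleHits (fun μ => θ μ b) β univ) :
    ∃ v : L2 a b r, ‖v‖ = 1 ∧ (v, (μ : ℂ) • v) ∈ graph a b p q r α β ∧
      ∀ x, (x, (μ : ℂ) • x) ∈ graph a b p q r α β → x ∈ Submodule.span ℂ {v} := by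
  obtain ⟨ψ, ψ', hψ, hangle, hψa, hψa'⟩ := h.exists_tauEq hab.le hreg μ
  have hbc_left : BoundaryCond a α ψ ψ' :=
    (hangle.boundaryCond_iff (left_mem_Icc.2 hab.le)).2 ⟨0, by simp [h.left]⟩
  have hbc_right := (hangle.boundaryCond_iff (right_mem_Icc.2 hab.le)).2 hμ.2
  obtain ⟨y, hy₀, hyψ, hy⟩ := exists_ne_zero_mem_graph hab.le hreg hψ hbc_left hbc_right
    ((h.isPruferSolution μ).not_ae_eq_zero hab hreg hangle)
  have hynorm : (‖y‖ : ℂ)⁻¹ ≠ 0 := inv_ne_zero (Complex.ofReal_ne_zero.2 (norm_ne_zero_iff.2 hy₀))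
  refine ⟨(‖y‖ : ℂ)⁻¹ • y, norm_smul_inv_norm hy₀, ?_, fun x hx => ?_⟩
  · rw [smul_comm]
    exact Submodule.smul_mem _ _ hy
  · obtain ⟨c, hxψ, -⟩ := exists_ae_eq_const_mul_of_mem_graph hab.le hreg hψ hψa hψa' hx
    rw [Submodule.span_singleton_smul_eq hynorm.isUnit, Submodule.mem_span_singleton]
    refine ⟨c, Lp.ext ?_⟩
    filter_upwards [hxψ, hyψ, Lp.coeFn_smul c y] with t hxt hyt hsmul
    rw [hsmul, hxt, Pi.smul_apply, hyt, smul_eq_mul]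

theorem exists_hilbertBasis (h : IsPruferFamily a b p q r α θ) (hab : a < b)
    (hreg : IsRegular a b p q r) {lam : ℝ} {T : L2 a b r →L[ℂ] L2 a b r}
    (hT : IsResolventAt (operator a b p q r α β) lam T) (hsymm : T.IsSymmetric)
    (hcomp : IsCompactOperator T) :
    ∃ e : HilbertBasis (angleHits (fun μ => θ μ b) β univ) ℂ (L2 a b r), ∀ μ,
      ∃ hdom : e μ ∈ (operator a b p q r α β).domain,
        operator a b p q r α β ⟨e μ, hdom⟩ = ((μ : ℝ) : ℂ) • e μ := by
  choose v hnorm hgraph hsimple using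
    fun μ : angleHits (fun μ => θ μ b) β univ => h.exists_eigenvector hab hreg μ.2
  have hv := fun μ => (mem_graph_iff_operator hab hreg).1 (hgraph μ)
  suffices hspan : ∀ (μ : ℝ) (x : (operator a b p q r α β).domain),
      operator a b p q r α β x = (μ : ℂ) • (x : L2 a b r) →
        (x : L2 a b r) ∈ Submodule.span ℂ (range v) by
    obtain ⟨e, he⟩ := hT.exists_hilbertBasis hsymm hcomp Subtype.val_injective v hnorm hv hspan
    exact ⟨e, fun μ => (he μ).symm ▸ hv μ⟩
  intro μ x hx
  obtain hx₀ | hx₀ := eq_or_ne (x : L2 a b r) 0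
  · exact hx₀ ▸ zero_mem _
  have hxgraph := hx ▸ mem_graph_operator hab hreg x
  have hμ := h.mem_angleHits_of_mem_graph hab.le hreg hx₀ hxgraph
  exact Submodule.span_mono (singleton_subset_iff.2 (mem_range_self _)) (hsimple ⟨μ, hμ⟩ x hxgraph)

theorem exists_isSpectralResolution (h : IsPruferFamily a b p q r α θ) (hab : a < b)
    (hreg : IsRegular a b p q r) (hα : α ∈ Ico 0 Real.pi) (hβ : β ∈ Ioc 0 Real.pi) :
    ∃ E : ProjValuedMeasure (L2 a b r), E.IsSpectralResolution (operator a b p q r α β) := by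
  obtain ⟨lam, T, hT, hsymm, hcomp⟩ := h.exists_isResolventAt hab hreg hα hβ
  obtain ⟨e, he⟩ := h.exists_hilbertBasis hab hreg hT hsymm hcomp
  have := countable_angleHits (β := β) (h.isCountingAngle hab hreg hα).strictMono.injective univ
  exact ⟨_, hT.isSpectralResolution_diagonal e _ he hsymm⟩

theorem finiteDimensional_and_finrank_range (h : IsPruferFamily a b p q r α θ) (hab : a < b)
    (hreg : IsRegular a b p q r) (hα : α ∈ Ico 0 Real.pi) (hβ : β ∈ Ioc 0 Real.pi)
    {P : ProjValuedMeasure (L2 a b r)} (hP : P.IsSpectralResolution (operator a b p q r α β))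
    {s : Set ℝ} (hs : MeasurableSet s) (hfin : (angleHits (fun μ => θ μ b) β s).Finite) :
    FiniteDimensional ℂ (P.proj s).range ∧
      Module.finrank ℂ (P.proj s).range = (angleHits (fun μ => θ μ b) β s).ncard := by
  obtain ⟨lam, T, hT, hsymm, hcomp⟩ := h.exists_isResolventAt hab hreg hα hβ
  obtain ⟨e, he⟩ := h.exists_hilbertBasis hab hreg hT hsymm hcomp
  have himage : angleHits (fun μ => θ μ b) β s =
      (↑) '' {μ : angleHits (fun μ => θ μ b) β univ | (μ : ℝ) ∈ s} := by
    ext μ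
    simp [angleHits, and_comm]
  rw [himage] at hfin ⊢
  rw [ncard_image_of_injective _ Subtype.val_injective]
  exact hP.finiteDimensional_and_finrank_range e he hs
    (hfin.of_finite_image Subtype.val_injective.injOn)

end IsPruferFamily

theorem exists_isSpectralResolution (hab : a < b) (hreg : IsRegular a b p q r)
    (hα : α ∈ Ico 0 Real.pi) (hβ : β ∈ Ioc 0 Real.pi) :
    ∃ E : ProjValuedMeasure (L2 a b r), E.IsSpectralResolution (operator a b p q r α β) := by
  obtain ⟨θ, h⟩ := exists_isPruferFamily hab.le hreg α
  exact h.exists_isSpectralResolution hab hreg hα hβ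

section Rank

variable {P : ProjValuedMeasure (L2 a b r)}

theorem finiteDimensional_and_finrank_range_Iic (hab : a < b) (hreg : IsRegular a b p q r)
    (hα : α ∈ Ico 0 Real.pi) (hβ : β ∈ Ioc 0 Real.pi)
    (hP : P.IsSpectralResolution (operator a b p q r α β)) (lam : ℝ) :
    FiniteDimensional ℂ (P.proj (Iic lam)).range ∧ ∀ {u w θ : ℝ → ℝ},
      TauEq a b p q r u w (fun x => lam * u x) → IsPruferAngle a b u w θ →
      BoundaryCond a α u w ∨ BoundaryCond b β u w →
        (Module.finrank ℂ (P.proj (Iic lam)).range : ℤ) =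
          ⌊(θ b - θ a - (β - α)) / Real.pi⌋ + 1 := by
  obtain ⟨θ₀, h⟩ := exists_isPruferFamily hab.le hreg α
  obtain ⟨hfin, hncard⟩ :=
    (h.isCountingAngle hab hreg hα).finite_angleHits_Iic_and_ncard (lam := lam) hβ
  obtain ⟨hdim, hrank⟩ :=
    h.finiteDimensional_and_finrank_range hab hreg hα hβ hP measurableSet_Iic hfin
  refine ⟨hdim, fun hu hθ hbc => ?_⟩
  rw [hrank, hncard, (hθ.floor_and_ceil_eq hab.le hreg (h.isPruferSolution lam) (h.left lam) hu
    hbc).1]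

theorem finiteDimensional_and_finrank_range_Iio (hab : a < b) (hreg : IsRegular a b p q r)
    (hα : α ∈ Ico 0 Real.pi) (hβ : β ∈ Ioc 0 Real.pi)
    (hP : P.IsSpectralResolution (operator a b p q r α β)) (lam : ℝ) :
    FiniteDimensional ℂ (P.proj (Iio lam)).range ∧ ∀ {u w θ : ℝ → ℝ},
      TauEq a b p q r u w (fun x => lam * u x) → IsPruferAngle a b u w θ →
      BoundaryCond a α u w ∨ BoundaryCond b β u w →
        (Module.finrank ℂ (P.proj (Iio lam)).range : ℤ) =
          ⌈(θ b - θ a - (β - α)) / Real.pi⌉ := by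
  obtain ⟨θ₀, h⟩ := exists_isPruferFamily hab.le hreg α
  obtain ⟨hfin, hncard⟩ :=
    (h.isCountingAngle hab hreg hα).finite_angleHits_Iio_and_ncard (lam := lam) hβ
  obtain ⟨hdim, hrank⟩ :=
    h.finiteDimensional_and_finrank_range hab hreg hα hβ hP measurableSet_Iio hfin
  refine ⟨hdim, fun hu hθ hbc => ?_⟩
  rw [hrank, hncard, (hθ.floor_and_ceil_eq hab.le hreg (h.isPruferSolution lam) (h.left lam) hu
    hbc).2]

end Rank

/-! ### Normalization of the boundary angles -/

theorem boundaryCond_add_int_mul_pi {E : Type*} [NormedAddCommGroup E] [NormedSpace ℝ E]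
    (c γ : ℝ) (n : ℤ) (u w : ℝ → E) :
    BoundaryCond c (γ + n * Real.pi) u w ↔ BoundaryCond c γ u w := by
  have hsign : ((-1 : ℝ) ^ n) ≠ 0 := zpow_ne_zero _ (by norm_num)
  rw [BoundaryCond, BoundaryCond, Real.cos_add_int_mul_pi, Real.sin_add_int_mul_pi, mul_smul,
    mul_smul, ← smul_sub, smul_eq_zero, or_iff_right hsign]

theorem operator_add_int_mul_pi (a b : ℝ) (p q r : ℝ → ℝ) (α β : ℝ) (n k : ℤ) :
    operator a b p q r (α + n * Real.pi) (β + k * Real.pi) = operator a b p q r α β := by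
  have hgraph : graph a b p q r (α + n * Real.pi) (β + k * Real.pi) = graph a b p q r α β := by
    ext F
    simp only [graph, Submodule.mem_mk, AddSubmonoid.mem_mk, AddSubsemigroup.mem_mk, mem_ofPred_eq,
      boundaryCond_add_int_mul_pi]
  rw [operator, operator, hgraph]

theorem isBoundarySolution_add_int_mul_pi {z c γ : ℝ} (n : ℤ) {u w : ℝ → ℝ} :
    IsBoundarySolution a b p q r z c (γ + n * Real.pi) u w ↔
      IsBoundarySolution a b p q r z c γ u w :=
  ⟨fun h => ⟨h.tauEq, (boundaryCond_add_int_mul_pi c γ n u w).1 h.boundary, h.ne_zero⟩,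
    fun h => ⟨h.tauEq, (boundaryCond_add_int_mul_pi c γ n u w).2 h.boundary, h.ne_zero⟩⟩

theorem exists_eq_add_int_mul_pi_Ico (α : ℝ) :
    ∃ (n : ℤ) (α' : ℝ), α' ∈ Ico 0 Real.pi ∧ α = α' + n * Real.pi :=
  ⟨toIcoDiv Real.pi_pos 0 α, toIcoMod Real.pi_pos 0 α,
    by simpa using toIcoMod_mem_Ico Real.pi_pos 0 α, by simp⟩

theorem exists_eq_add_int_mul_pi_Ioc (β : ℝ) :
    ∃ (n : ℤ) (β' : ℝ), β' ∈ Ioc 0 Real.pi ∧ β = β' + n * Real.pi :=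
  ⟨toIocDiv Real.pi_pos 0 β, toIocMod Real.pi_pos 0 β,
    by simpa using toIocMod_mem_Ioc Real.pi_pos 0 β, by simp⟩

/-! ### Weighted sign flips -/

theorem add_int_mul_pi_div_pi (x : ℝ) (k : ℤ) :
    (x + k * Real.pi) / Real.pi = x / Real.pi + k := by
  rw [add_div, mul_div_cancel_right₀ _ Real.pi_ne_zero]

variable {θ₀ θ₁ : ℝ → ℝ}

theorem weightedSignFlips_eq_of_right_left (h₀ : ∃ m : ℤ, θ₀ b = β + m * Real.pi)
    (h₁ : ∃ n : ℤ, θ₁ a = α + n * Real.pi) :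
    weightedSignFlips a b θ₀ θ₁ = ⌈(θ₁ b - θ₁ a - (β - α)) / Real.pi⌉ -
      (⌊(θ₀ b - θ₀ a - (β - α)) / Real.pi⌋ + 1) := by
  obtain ⟨m, hm⟩ := h₀
  obtain ⟨n, hn⟩ := h₁
  rw [weightedSignFlips,
    show θ₁ b - θ₀ b = θ₁ b - θ₁ a - (β - α) + (n - m : ℤ) * Real.pi by
      rw [hm, hn]
      push_cast
      ring,
    show θ₁ a - θ₀ a = θ₀ b - θ₀ a - (β - α) + (n - m : ℤ) * Real.pi by
      rw [hm, hn]
      push_cast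
      ring,
    add_int_mul_pi_div_pi, add_int_mul_pi_div_pi, Int.ceil_add_intCast, Int.floor_add_intCast]
  ring

theorem weightedSignFlips_eq_of_left_right (h₀ : ∃ n : ℤ, θ₀ a = α + n * Real.pi)
    (h₁ : ∃ m : ℤ, θ₁ b = β + m * Real.pi) :
    weightedSignFlips a b θ₀ θ₁ = ⌈(θ₁ b - θ₁ a - (β - α)) / Real.pi⌉ -
      (⌊(θ₀ b - θ₀ a - (β - α)) / Real.pi⌋ + 1) := by
  obtain ⟨n, hn⟩ := h₀
  obtain ⟨m, hm⟩ := h₁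
  rw [weightedSignFlips,
    show θ₁ b - θ₀ b = -(θ₀ b - θ₀ a - (β - α)) + (m - n : ℤ) * Real.pi by
      rw [hm, hn]
      push_cast
      ring,
    show θ₁ a - θ₀ a = -(θ₁ b - θ₁ a - (β - α)) + (m - n : ℤ) * Real.pi by
      rw [hm, hn]
      push_cast
      ring,
    add_int_mul_pi_div_pi, add_int_mul_pi_div_pi, Int.ceil_add_intCast, Int.floor_add_intCast,
    neg_div, neg_div, Int.ceil_neg, Int.floor_neg]
  ring

end SturmLiouville

end

open SturmLiouville in
theorem theorem2p3_general (a b : ℝ) (hab : a < b) (p₀ p₁ q₀ q₁ r₀ r₁ : ℝ → ℝ)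
    (hreg₀ : IsRegular a b p₀ q₀ r₀) (hreg₁ : IsRegular a b p₁ q₁ r₁) (α β lam₀ lam₁ : ℝ) :
    (∃ E : ProjValuedMeasure (L2 a b r₀), E.IsSpectralResolution (operator a b p₀ q₀ r₀ α β)) ∧
    (∃ E : ProjValuedMeasure (L2 a b r₁), E.IsSpectralResolution (operator a b p₁ q₁ r₁ α β)) ∧
    ∀ (P₀ : ProjValuedMeasure (L2 a b r₀)) (P₁ : ProjValuedMeasure (L2 a b r₁)),
      P₀.IsSpectralResolution (operator a b p₀ q₀ r₀ α β) →
      P₁.IsSpectralResolution (operator a b p₁ q₁ r₁ α β) →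
      FiniteDimensional ℂ (P₀.proj (Set.Iic lam₀)).range ∧
      FiniteDimensional ℂ (P₁.proj (Set.Iio lam₁)).range ∧
      (∀ u₀ w₀ u₁ w₁ θ₀ θ₁ : ℝ → ℝ,
        IsBoundarySolution a b p₀ q₀ r₀ lam₀ b β u₀ w₀ →
        IsBoundarySolution a b p₁ q₁ r₁ lam₁ a α u₁ w₁ →
        IsPruferAngle a b u₀ w₀ θ₀ → IsPruferAngle a b u₁ w₁ θ₁ →
        (Module.finrank ℂ (P₁.proj (Set.Iio lam₁)).range : ℤ)
            - Module.finrank ℂ (P₀.proj (Set.Iic lam₀)).range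
          = weightedSignFlips a b θ₀ θ₁) ∧
      (∀ u₀ w₀ u₁ w₁ θ₀ θ₁ : ℝ → ℝ,
        IsBoundarySolution a b p₀ q₀ r₀ lam₀ a α u₀ w₀ →
        IsBoundarySolution a b p₁ q₁ r₁ lam₁ b β u₁ w₁ →
        IsPruferAngle a b u₀ w₀ θ₀ → IsPruferAngle a b u₁ w₁ θ₁ →
        (Module.finrank ℂ (P₁.proj (Set.Iio lam₁)).range : ℤ)
            - Module.finrank ℂ (P₀.proj (Set.Iic lam₀)).range
          = weightedSignFlips a b θ₀ θ₁) := by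
  obtain ⟨n, α, hα, rfl⟩ := exists_eq_add_int_mul_pi_Ico α
  obtain ⟨k, β, hβ, rfl⟩ := exists_eq_add_int_mul_pi_Ioc β
  simp only [operator_add_int_mul_pi, isBoundarySolution_add_int_mul_pi]
  refine ⟨exists_isSpectralResolution hab hreg₀ hα hβ, exists_isSpectralResolution hab hreg₁ hα hβ,
    fun P₀ P₁ hP₀ hP₁ => ?_⟩
  have ha := left_mem_Icc.2 hab.le
  have hb := right_mem_Icc.2 hab.le
  obtain ⟨hdim₀, hrank₀⟩ := finiteDimensional_and_finrank_range_Iic hab hreg₀ hα hβ hP₀ lam₀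
  obtain ⟨hdim₁, hrank₁⟩ := finiteDimensional_and_finrank_range_Iio hab hreg₁ hα hβ hP₁ lam₁
  refine ⟨hdim₀, hdim₁, fun u₀ w₀ u₁ w₁ θ₀ θ₁ hu₀ hu₁ hθ₀ hθ₁ => ?_,
    fun u₀ w₀ u₁ w₁ θ₀ θ₁ hu₀ hu₁ hθ₀ hθ₁ => ?_⟩
  · rw [hrank₀ hu₀.tauEq hθ₀ (.inr hu₀.boundary), hrank₁ hu₁.tauEq hθ₁ (.inl hu₁.boundary),
      weightedSignFlips_eq_of_right_left ((hθ₀.boundaryCond_iff hb).1 hu₀.boundary)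
        ((hθ₁.boundaryCond_iff ha).1 hu₁.boundary)]
  · rw [hrank₀ hu₀.tauEq hθ₀ (.inl hu₀.boundary), hrank₁ hu₁.tauEq hθ₁ (.inr hu₁.boundary),
      weightedSignFlips_eq_of_left_right ((hθ₀.boundaryCond_iff ha).1 hu₀.boundary)
        ((hθ₁.boundaryCond_iff hb).1 hu₁.boundary)]

open SturmLiouville in
theorem theorem2p3 (a b : ℝ) (hab : a < b) (p q₀ q₁ r : ℝ → ℝ)
    (hreg₀ : IsRegular a b p q₀ r) (hreg₁ : IsRegular a b p q₁ r)
    (α β lam₀ lam₁ : ℝ) :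
    (∃ E : ProjValuedMeasure (L2 a b r), E.IsSpectralResolution (operator a b p q₀ r α β)) ∧
    (∃ E : ProjValuedMeasure (L2 a b r), E.IsSpectralResolution (operator a b p q₁ r α β)) ∧
    ∀ P₀ P₁ : ProjValuedMeasure (L2 a b r),
      P₀.IsSpectralResolution (operator a b p q₀ r α β) →
      P₁.IsSpectralResolution (operator a b p q₁ r α β) →
      FiniteDimensional ℂ (P₀.proj (Set.Iic lam₀)).range ∧
      FiniteDimensional ℂ (P₁.proj (Set.Iio lam₁)).range ∧
      (∀ u₀ w₀ u₁ w₁ θ₀ θ₁ : ℝ → ℝ,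
        IsBoundarySolution a b p q₀ r lam₀ b β u₀ w₀ →
        IsBoundarySolution a b p q₁ r lam₁ a α u₁ w₁ →
        IsPruferAngle a b u₀ w₀ θ₀ → IsPruferAngle a b u₁ w₁ θ₁ →
        (Module.finrank ℂ (P₁.proj (Set.Iio lam₁)).range : ℤ)
            - Module.finrank ℂ (P₀.proj (Set.Iic lam₀)).range
          = weightedSignFlips a b θ₀ θ₁) ∧
      (∀ u₀ w₀ u₁ w₁ θ₀ θ₁ : ℝ → ℝ,
        IsBoundarySolution a b p q₀ r lam₀ a α u₀ w₀ →
        IsBoundarySolution a b p q₁ r lam₁ b β u₁ w₁ →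
        IsPruferAngle a b u₀ w₀ θ₀ → IsPruferAngle a b u₁ w₁ θ₁ →
        (Module.finrank ℂ (P₁.proj (Set.Iio lam₁)).range : ℤ)
            - Module.finrank ℂ (P₀.proj (Set.Iic lam₀)).range
          = weightedSignFlips a b θ₀ θ₁) :=
  theorem2p3_general a b hab p p q₀ q₁ r r hreg₀ hreg₁ α β lam₀ lam₁
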